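/- Fix complex numbers $q\neq 0$ with $|q|<1$ and $r$, write $q^x=e^{x\log q}$, $p=q^{2r}$, $\tau=-2\pi i/\log p$ with $\log p=2r\log q$, and assume that $|p|<1$ and that $r$ is generic: $q^mp^n=1$ with $m,n\in\mathbb Z$ only for $m=n=0$. Let $[x]_q=\frac{q^x-q^{-x}}{q-q^{-1}}$ and $$[u]=\frac{q^{u^2/r-u}}{(p;p)_\infty^3}\,\Theta_p(q^{2u}),\qquad \Theta_p(z)=(z;p)_\infty(p/z;p)_\infty(p;p)_\infty,\qquad (z;p)_\infty=\prod_{n\ge0}(1-zp^n).$$ Let $U_q(L(\mathfrak{sl}_2))$ be the quantum loop algebra over $\mathbb C$ in Drinfeld's realization: the generators are $x^\pm_n$ ($n\in\mathbb Z$), $a_n$ ($n\in\mathbb Z\setminus\{0\}$), $h$, $q^{\pm h}$, and with $x^\pm(z)=\sum_nx^\pm_nz^{-n}$, $\delta(z)=\sum_{n\in\mathbb Z}z^n$ the relations are: $h$, $q^{\pm h}$ and the $a_n$ commute with each other, $q^hq^{-h}=1$, $[h,x^\pm(z)]=\pm2x^\pm(z)$, $q^hx^\pm(z)q^{-h}=q^{\pm2}x^\pm(z)$,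 $[a_n,x^\pm(z)]=\pm\frac{[2n]_q}{n}z^nx^\pm(z)$, $(z-q^{\pm2}w)x^\pm(z)x^\pm(w)=(q^{\pm2}z-w)x^\pm(w)x^\pm(z)$ and $[x^+(z),x^-(w)]=\frac{1}{q-q^{-1}}\delta(z/w)\big(\psi(w)-\varphi(w)\big)$, where $\psi(z)=\sum_{n\ge0}\psi_nz^{-n}=q^h\exp\big((q-q^{-1})\sum_{n>0}a_nz^{-n}\big)$ and $\varphi(z)=\sum_{n\ge0}\phi_{-n}z^{n}=q^{-h}\exp\big(-(q-q^{-1})\sum_{n>0}a_{-n}z^{n}\big)$. Let $\mathbb F$ be the field of meromorphic functions $f(P)$ on $\mathbb C$. The elliptic loop algebra is $U_{q,p}(L(\mathfrak{sl}_2))=\big(\mathbb F\otimes_{\mathbb C}U_q(L(\mathfrak{sl}_2))\big)\otimes_{\mathbb C}\mathbb C[\mathbb ZQ]$, with the semi-direct product given by $e^{Q}f(P)e^{-Q}=f(P+1)$, where $e^Q$ commutes with $U_q(L(\mathfrak{sl}_2))$. With $z=q^{2u}$, its elliptic currents are $$K(u)=\exp\Big(\sum_{n>0}\tfrac{[n]_q}{[2n]_q[rn]_q}a_{-n}z^n\Big)\exp\Big(-\sum_{n>0}\tfrac{[n]_q}{[2n]_q[rn]_q}a_{n}z^{-n}\Big)e^Qz^{\frac{h}{2r}},\qquad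 H^\pm(u)=K\big(u\pm\tfrac r2+\tfrac12\big)K\big(u\pm\tfrac r2-\tfrac12\big).$$ For $l\in\mathbb Z_{\ge0}$, $v\in\mathbb C$ and $w=q^{2v}$, let $\widehat V^{(l)}(q^{2v})=\bigoplus_{m=0}^l\mathbb F v_m$ be the evaluation representation of $U_{q,p}(L(\mathfrak{sl}_2))$: functions of $P$ act by multiplication, $e^Q\cdot f(P)v_m=f(P+1)v_m$, the algebra $U_q(L(\mathfrak{sl}_2))$ acts $\mathbb F$-linearly, $hv_m=(l-2m)v_m$, $q^{\pm h}v_m=q^{\pm(l-2m)}v_m$, and $$a_n=\frac{w^n}{n(q-q^{-1})}\big((q^n+q^{-n})q^{nh}-q^{(l+1)n}-q^{-(l+1)n}\big),\qquad x^\pm_n=S^\pm\Big[\frac{\pm h+l+2}{2}\Big]_q(q^{h\pm1}w)^n,\qquad S^\pm v_m=v_{m\mp1},$$ where $v_{-1}=v_{l+1}=0$. A pseudo-highest weight vector of a representation of $U_{q,p}(L(\mathfrak{sl}_2))$ is a non-zero cyclic vector $\widehat\Omega$ with $e^Q\widehat\Omega=\widehat\Omega$, $x^+_n\widehat\Omega=0$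 for all $n\in\mathbb Z$, and $\psi_n\widehat\Omega=d^+_n\widehat\Omega$, $\phi_{-n}\widehat\Omega=d^-_{-n}\widehat\Omega$ for all $n\ge0$, with complex numbers $d^\pm_{\pm n}$ such that $d^+_0d^-_0=1$. An entire function $P$ is called an elliptic Drinfeld polynomial of the representation, with constant $c$, if there are $\alpha_1,\dots,\alpha_d\in\mathbb C$ that represent the zeros of $P$, with multiplicities, modulo $\mathbb Zr+\mathbb Zr\tau$, such that $$P(u+r)=(-1)^dP(u),\qquad P(u+r\tau)=(-1)^d\exp\Big(-\pi i\sum_{j=1}^d\big(\tfrac{2(u-\alpha_j)}{r}+\tau\big)\Big)P(u),\qquad c=q^{-d/r}\prod_{j=1}^dq^{2\alpha_j/r},$$ and if there is a pseudo-highest weight vector $\widehat\Omega$ with $$H^\pm(u)\,\widehat\Omega=c\,\frac{P(u+1)}{P(u)}\,\widehat\Omega.$$ Here, for each sign, the series in $z$ and the series in $z^{-1}$ by which the factors of $H^\pm(u)$ act on $\widehat\Omega$ converge on a common non-empty annulus $s<|z|<t$, and the equality is one of meromorphic functions of $u$, with both sides compared there. Then $$P_{l,v}(u)=\Big[u-v-\frac{l-1}2\Big]\Big[u-v-\frac{l-1}2+1\Big]\cdots\Big[u-v+\frac{l-1}2\Big]$$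 is an elliptic Drinfeld polynomial of $\widehat V^{(l)}(q^{2v})$, with constant $c=q^{l(2v-1)/r}$, and every elliptic Drinfeld polynomial of $\widehat V^{(l)}(q^{2v})$ with this constant is a non-zero scalar multiple of $P_{l,v}$. -/

import Mathlib

open scoped TensorProduct

namespace EllipticSl2

noncomputable section

/-- The number `[x]_q = (q^x - q^(-x)) / (q - q⁻¹)`, for a complex `x` (powers of `q` through the
principal logarithm). -/
def qNum (q x : ℂ) : ℂ := (q ^ x - q ^ (-x)) / (q - q⁻¹)

section Series
variable {A : Type*} [Ring A] [Algebra ℂ A]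

/-- The power series `∑_{n ≥ 1} c n • b n X^n`, without constant term. -/
def modeSeries (c : ℕ → ℂ) (b : ℕ → A) : PowerSeries A :=
  PowerSeries.mk fun n => if n = 0 then 0 else c n • b n

/-- The exponential `∑_k X^k / k!` of a power series `X` without constant term, over a possibly
non-commutative algebra; only `k ≤ n` contributes to the `n`-th coefficient. -/
def expSeries (X : PowerSeries A) : PowerSeries A :=
  PowerSeries.mk fun n =>
    ∑ k ∈ Finset.range (n + 1), ((k.factorial : ℂ)⁻¹) • PowerSeries.coeff n (X ^ k)

/-- The substitution `X ↦ s X` in a power series. -/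
def rescaleSeries (s : ℂ) (X : PowerSeries A) : PowerSeries A :=
  PowerSeries.mk fun n => s ^ n • PowerSeries.coeff n X

/-- The mode `ψ_m` of `ψ(z) = ∑_{m ≥ 0} ψ_m z^(-m) = q^h exp((q - q⁻¹) ∑_{n>0} a_n z^(-n))`
(and `ψ_m = 0` for `m < 0`), where `k` stands for `q^h`. -/
def psiMode (q : ℂ) (k : A) (a : ℤ → A) (m : ℤ) : A :=
  if 0 ≤ m then
    k * PowerSeries.coeff m.toNat
      (expSeries (modeSeries (fun _ => q - q⁻¹) fun n => a n))
  else 0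

/-- The mode `φ_m` of `φ(z) = ∑_{m ≤ 0} φ_m z^(-m) = q^(-h) exp(-(q - q⁻¹) ∑_{n>0} a_{-n} z^n)`
(and `φ_m = 0` for `m > 0`), where `kinv` stands for `q^(-h)`. -/
def phiMode (q : ℂ) (kinv : A) (a : ℤ → A) (m : ℤ) : A :=
  if m ≤ 0 then
    kinv * PowerSeries.coeff (-m).toNat
      (expSeries (modeSeries (fun _ => -(q - q⁻¹)) fun n => a (-(n : ℤ))))
  else 0

variable {B : Type*} [Ring B] [Algebra ℂ B]

theorem map_expSeries_modeSeries (f : A →ₐ[ℂ] B) (c : ℕ → ℂ) (b : ℕ → A) (n : ℕ) :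
    f (PowerSeries.coeff n (expSeries (modeSeries c b))) =
      PowerSeries.coeff n (expSeries (modeSeries c fun n => f (b n))) := by
  have h : PowerSeries.map (f : A →+* B) (modeSeries c b) = modeSeries c fun n => f (b n) := by
    ext n
    simp only [modeSeries, PowerSeries.coeff_map, PowerSeries.coeff_mk]
    split_ifs <;> simp
  simp only [expSeries, PowerSeries.coeff_mk, map_sum, map_smul]
  rw [← h]
  simp only [← map_pow, PowerSeries.coeff_map]
  rfl

theorem map_psiMode (f : A →ₐ[ℂ] B) (q : ℂ) (k : A) (a : ℤ → A) (m : ℤ) :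
    f (psiMode q k a m) = psiMode q (f k) (fun n => f (a n)) m := by
  unfold psiMode
  split_ifs
  · rw [map_mul, map_expSeries_modeSeries]
  · simp

theorem map_phiMode (f : A →ₐ[ℂ] B) (q : ℂ) (k : A) (a : ℤ → A) (m : ℤ) :
    f (phiMode q k a m) = phiMode q (f k) (fun n => f (a n)) m := by
  unfold phiMode
  split_ifs
  · rw [map_mul, map_expSeries_modeSeries]
  · simp

end Series

/-- Drinfeld generators of the quantum loop algebra: `x^±_n`, `a_n`, `h`, and `k = q^h`,
`kinv = q^(-h)`. The relations below set `a_0 = 0`. -/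
inductive LoopGen
  | xp (n : ℤ)
  | xm (n : ℤ)
  | a (n : ℤ)
  | h
  | k
  | kinv

/-- A generator, in the free algebra. -/
def gen (s : LoopGen) : FreeAlgebra ℂ LoopGen := FreeAlgebra.ι ℂ s

/-- The defining relations of the quantum affine algebra of `sl₂` in Drinfeld's realization at `c = 0`
(without `d`), in modes: `x^±(z) = ∑ x^±_n z^(-n)`. -/
inductive LoopRel (q : ℂ) : FreeAlgebra ℂ LoopGen → FreeAlgebra ℂ LoopGen → Prop
  | a_zero : LoopRel q (gen (.a 0)) 0
  | k_kinv : LoopRel q (gen .k * gen .kinv) 1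
  | kinv_k : LoopRel q (gen .kinv * gen .k) 1
  | h_k : LoopRel q (gen .h * gen .k) (gen .k * gen .h)
  | h_a (n : ℤ) : LoopRel q (gen .h * gen (.a n)) (gen (.a n) * gen .h)
  | k_a (n : ℤ) : LoopRel q (gen .k * gen (.a n)) (gen (.a n) * gen .k)
  | h_xp (n : ℤ) : LoopRel q (gen .h * gen (.xp n) - gen (.xp n) * gen .h) ((2 : ℂ) • gen (.xp n))
  | h_xm (n : ℤ) : LoopRel q (gen .h * gen (.xm n) - gen (.xm n) * gen .h) ((-2 : ℂ) • gen (.xm n))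
  | k_xp (n : ℤ) : LoopRel q (gen .k * gen (.xp n)) (q ^ 2 • (gen (.xp n) * gen .k))
  | k_xm (n : ℤ) : LoopRel q (gen .k * gen (.xm n)) (q ^ (-2 : ℤ) • (gen (.xm n) * gen .k))
  | a_a (n m : ℤ) : LoopRel q (gen (.a n) * gen (.a m)) (gen (.a m) * gen (.a n))
  | a_xp (n m : ℤ) (hn : n ≠ 0) :
      LoopRel q (gen (.a n) * gen (.xp m) - gen (.xp m) * gen (.a n))
        ((qNum q (2 * n) / n) • gen (.xp (m + n)))
  | a_xm (n m : ℤ) (hn : n ≠ 0) :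
      LoopRel q (gen (.a n) * gen (.xm m) - gen (.xm m) * gen (.a n))
        (-(qNum q (2 * n) / n) • gen (.xm (m + n)))
  | xp_xp (m n : ℤ) :
      LoopRel q (gen (.xp (m + 1)) * gen (.xp n) - q ^ 2 • (gen (.xp m) * gen (.xp (n + 1))))
        (q ^ 2 • (gen (.xp n) * gen (.xp (m + 1))) - gen (.xp (n + 1)) * gen (.xp m))
  | xm_xm (m n : ℤ) :
      LoopRel q
        (gen (.xm (m + 1)) * gen (.xm n) - q ^ (-2 : ℤ) • (gen (.xm m) * gen (.xm (n + 1))))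
        (q ^ (-2 : ℤ) • (gen (.xm n) * gen (.xm (m + 1))) - gen (.xm (n + 1)) * gen (.xm m))
  | xp_xm (m n : ℤ) :
      LoopRel q (gen (.xp m) * gen (.xm n) - gen (.xm n) * gen (.xp m))
        ((q - q⁻¹)⁻¹ • (psiMode q (gen .k) (fun j => gen (.a j)) (m + n) -
          phiMode q (gen .kinv) (fun j => gen (.a j)) (m + n)))

/-- The quantum loop algebra `U_q(L(sl₂))` over `ℂ`: the quotient by `c` of the quantum affine
algebra without `d`. -/
def LoopAlg (q : ℂ) : Type := RingQuot (LoopRel q)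

instance (q : ℂ) : Ring (LoopAlg q) := inferInstanceAs (Ring (RingQuot (LoopRel q)))
instance (q : ℂ) : Algebra ℂ (LoopAlg q) := inferInstanceAs (Algebra ℂ (RingQuot (LoopRel q)))

/-- The image of a generator in the quantum loop algebra. -/
def LoopAlg.of (q : ℂ) (s : LoopGen) : LoopAlg q := RingQuot.mkAlgHom ℂ (LoopRel q) (gen s)

/-- The algebra of entire functions of the dynamical variable `P`. -/
def Entire : Subalgebra ℂ (ℂ → ℂ) where
  carrier := {f | Differentiable ℂ f}
  mul_mem' hf hg := Differentiable.mul hf hg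
  add_mem' hf hg := Differentiable.add hf hg
  algebraMap_mem' c := differentiable_const c

instance : IsDomain Entire := by
  have : NoZeroDivisors Entire := by
    refine ⟨fun {f g} hfg => ?_⟩
    have hf : AnalyticOnNhd ℂ f.1 Set.univ := fun x _ => f.2.analyticAt x
    have hg : AnalyticOnNhd ℂ g.1 Set.univ := fun x _ => g.2.analyticAt x
    have := AnalyticOnNhd.eq_zero_or_eq_zero_of_mul_eq_zero hf hg
      (fun x _ => congrFun (congrArg Subtype.val hfg) x) isPreconnected_univ
    rcases this with h | h
    · left; ext x; exact h x trivial
    · right; ext x; exact h x trivial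
  exact NoZeroDivisors.to_isDomain _

/-- The field of meromorphic functions `f(P)` on `ℂ` (quotients of entire functions). At `c = 0`
the second dynamical variable `r^* = r - c` is the fixed number `r`. -/
abbrev MeromorphicField : Type := FractionRing Entire

/-- `f(P) ↦ f(P + 1)` on entire functions. -/
def shiftEntire : Entire ≃ₐ[ℂ] Entire where
  toFun f := ⟨fun P => f.1 (P + 1), f.2.comp (differentiable_id.add_const 1)⟩
  invFun f := ⟨fun P => f.1 (P - 1), f.2.comp (differentiable_id.sub_const 1)⟩
  left_inv f := by ext P; simp
  right_inv f := by ext P; simp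
  map_mul' f g := rfl
  map_add' f g := rfl
  commutes' c := rfl

/-- `f(P) ↦ f(P + 1)` on meromorphic functions. -/
def shiftP : MeromorphicField ≃ₐ[ℂ] MeromorphicField := IsFractionRing.algEquivOfAlgEquiv shiftEntire

/-- The quantum loop algebra with coefficients in the field of meromorphic functions of `P`. -/
def CoeffAlg (q : ℂ) : Type := MeromorphicField ⊗[ℂ] LoopAlg q

instance (q : ℂ) : Ring (CoeffAlg q) := inferInstanceAs (Ring (MeromorphicField ⊗[ℂ] LoopAlg q))
instance (q : ℂ) : Algebra ℂ (CoeffAlg q) := inferInstanceAs (Algebra ℂ (MeromorphicField ⊗[ℂ] LoopAlg q))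

/-- `f(P) a ↦ f(P + 1) a`, for `a` in the quantum loop algebra over `ℂ`. -/
def shiftCoeff (q : ℂ) : CoeffAlg q ≃ₐ[ℂ] CoeffAlg q :=
  (Algebra.TensorProduct.congr shiftP AlgEquiv.refl : MeromorphicField ⊗[ℂ] LoopAlg q ≃ₐ[ℂ] MeromorphicField ⊗[ℂ] LoopAlg q)

/-- `ℤ = {n Q}` acts by `f(P) a ↦ f(P + n) a`. -/
instance (q : ℂ) : MulSemiringAction (Multiplicative ℤ) (CoeffAlg q) :=
  MulSemiringAction.compHom (CoeffAlg q) (zpowersHom (CoeffAlg q ≃ₐ[ℂ] CoeffAlg q) (shiftCoeff q))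

theorem smul_coeffAlg (q : ℂ) (n : Multiplicative ℤ) (x : CoeffAlg q) :
    n • x = (shiftCoeff q ^ n.toAdd) x := rfl

instance (q : ℂ) : SMulCommClass (Multiplicative ℤ) ℂ (CoeffAlg q) :=
  ⟨fun n c x => by simp [smul_coeffAlg]⟩

/-- The elliptic loop algebra `U_{q,p}(L(sl₂))`: the semi-direct product of the quantum loop algebra
with meromorphic coefficients and the group algebra of `ℤ Q`, with
`(f(P) a ⊗ e^α) (g(P) b ⊗ e^β) = f(P) g(P + ⟨α, P⟩) a b ⊗ e^(α + β)`. -/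
abbrev EllipticAlg (q : ℂ) : Type := SkewMonoidAlgebra (CoeffAlg q) (Multiplicative ℤ)

/-- The inclusion of the quantum loop algebra. -/
def EllipticAlg.ofLoop (q : ℂ) (x : LoopAlg q) : EllipticAlg q :=
  SkewMonoidAlgebra.single 1 ((1 : MeromorphicField) ⊗ₜ[ℂ] x : MeromorphicField ⊗[ℂ] LoopAlg q)

/-- The element `e^(n Q)`. -/
def EllipticAlg.expQ (q : ℂ) (n : ℤ) : EllipticAlg q :=
  SkewMonoidAlgebra.single (Multiplicative.ofAdd n) 1

/-- The inclusion of the functions `f(P)`. -/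
def EllipticAlg.ofMeromorphic (q : ℂ) (f : MeromorphicField) : EllipticAlg q :=
  SkewMonoidAlgebra.single 1 (f ⊗ₜ[ℂ] (1 : LoopAlg q) : MeromorphicField ⊗[ℂ] LoopAlg q)

section Dyn
variable {q : ℂ} {V : Type*} [AddCommGroup V] [Module ℂ V]

/-- The action of the quantum loop algebra with meromorphic coefficients on `M ⊗ V`, with `M` the
field of meromorphic functions, given a representation `V` of the loop algebra over `ℂ`. -/
def dynCoeff (ρ : LoopAlg q →ₐ[ℂ] Module.End ℂ V) :
    CoeffAlg q →ₐ[ℂ] Module.End ℂ (MeromorphicField ⊗[ℂ] V) :=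
  (Module.endTensorEndAlgHom (R := ℂ) (A := ℂ) (M := MeromorphicField) (N := V)).comp
    (Algebra.TensorProduct.map (Algebra.lmul ℂ MeromorphicField) ρ)

variable (V) in
/-- `e^Q` on `M ⊗ V`: `f(P) v ↦ f(P + 1) v`. -/
def dynShift : (MeromorphicField ⊗[ℂ] V) ≃ₗ[ℂ] (MeromorphicField ⊗[ℂ] V) :=
  TensorProduct.congr shiftP.toLinearEquiv (LinearEquiv.refl ℂ V)

theorem dynShift_comm (ρ : LoopAlg q →ₐ[ℂ] Module.End ℂ V) (x : CoeffAlg q) (y : MeromorphicField ⊗[ℂ] V) :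
    dynShift V (dynCoeff ρ x y) = dynCoeff ρ (shiftCoeff q x) (dynShift V y) := by
  change MeromorphicField ⊗[ℂ] LoopAlg q at x
  induction x using TensorProduct.induction_on with
  | zero =>
    change dynShift V (dynCoeff ρ (0 : CoeffAlg q) y) =
      dynCoeff ρ (shiftCoeff q (0 : CoeffAlg q)) (dynShift V y)
    simp only [map_zero, LinearMap.zero_apply]
  | add a b ha hb =>
    rw [show dynCoeff ρ (a + b : MeromorphicField ⊗[ℂ] LoopAlg q) = dynCoeff ρ a + dynCoeff ρ b from
        map_add (dynCoeff ρ) _ _,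
      show shiftCoeff q (a + b : MeromorphicField ⊗[ℂ] LoopAlg q) = shiftCoeff q a + shiftCoeff q b from
        map_add (shiftCoeff q) _ _, map_add (dynCoeff ρ), LinearMap.add_apply,
        LinearMap.add_apply, map_add, ha, hb]
  | tmul f u =>
    induction y using TensorProduct.induction_on with
    | zero => simp only [map_zero]
    | add a b ha hb => simp only [map_add, ha, hb]
    | tmul g v =>
      change (shiftP (f * g)) ⊗ₜ[ℂ] (ρ u v) = (shiftP f * shiftP g) ⊗ₜ[ℂ] (ρ u v)
      rw [map_mul]

variable (V) in
/-- The action of `e^(n Q)` on `M ⊗ V`: `f(P) v ↦ f(P + n) v`. -/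
def dynShiftHom : Multiplicative ℤ →* Module.End ℂ (MeromorphicField ⊗[ℂ] V) :=
  (LinearEquiv.automorphismGroup.toLinearMapMonoidHom (R := ℂ) (M := MeromorphicField ⊗[ℂ] V)).comp
    (zpowersHom ((MeromorphicField ⊗[ℂ] V) ≃ₗ[ℂ] (MeromorphicField ⊗[ℂ] V)) (dynShift V))

theorem dynShift_zpow_comm (ρ : LoopAlg q →ₐ[ℂ] Module.End ℂ V) (n : ℤ) :
    ∀ (x : CoeffAlg q) (y : MeromorphicField ⊗[ℂ] V),
    (dynShift V ^ n) (dynCoeff ρ x y) =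
      dynCoeff ρ ((shiftCoeff q ^ n) x) ((dynShift V ^ n) y) := by
  induction n using Int.induction_on with
  | zero => intro x y; rfl
  | succ n ih =>
    intro x y
    simp only [zpow_add_one, LinearEquiv.mul_apply, AlgEquiv.mul_apply, dynShift_comm, ih]
  | pred n ih =>
    intro x y
    have h : (dynShift V)⁻¹ (dynCoeff ρ x y) =
        dynCoeff ρ ((shiftCoeff q)⁻¹ x) ((dynShift V)⁻¹ y) := by
      apply (dynShift V).injective
      rw [dynShift_comm]
      change (dynShift V * (dynShift V)⁻¹) _ =
        dynCoeff ρ ((shiftCoeff q * (shiftCoeff q)⁻¹) x) ((dynShift V * (dynShift V)⁻¹) y)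
      rw [mul_inv_cancel, mul_inv_cancel]
      rfl
    simp only [zpow_sub_one, LinearEquiv.mul_apply, AlgEquiv.mul_apply, h, ih]

/-- The dynamical representation of the elliptic loop algebra on `(M ⊗ V) ⊗ ℂ 1`, `M` the field of
meromorphic functions of `P`, defined by a representation `V` of the quantum loop algebra: functions
of `P` act by multiplication, the loop algebra acts on `V`, and `e^Q` by `f(P) v ↦ f(P + 1) v`. -/
def dynRep (ρ : LoopAlg q →ₐ[ℂ] Module.End ℂ V) :
    EllipticAlg q →ₐ[ℂ] Module.End ℂ (MeromorphicField ⊗[ℂ] V) :=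
  SkewMonoidAlgebra.liftNCAlgHom (dynCoeff ρ) (dynShiftHom V) (by
    intro x n
    refine LinearMap.ext fun y => ?_
    exact (dynShift_zpow_comm ρ n.toAdd x y).symm)

theorem dynRep_ofLoop (ρ : LoopAlg q →ₐ[ℂ] Module.End ℂ V) (u : LoopAlg q) (f : MeromorphicField) (v : V) :
    dynRep ρ (EllipticAlg.ofLoop q u) (f ⊗ₜ[ℂ] v) = f ⊗ₜ[ℂ] ρ u v := by
  have h : dynRep ρ (EllipticAlg.ofLoop q u) =
      dynCoeff ρ ((1 : MeromorphicField) ⊗ₜ[ℂ] u : MeromorphicField ⊗[ℂ] LoopAlg q) * dynShiftHom V 1 :=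
    SkewMonoidAlgebra.liftNC_single _ _ _ _
  rw [h, map_one, mul_one]
  change (1 * f) ⊗ₜ[ℂ] ρ u v = _
  rw [one_mul]

theorem dynRep_ofMeromorphic (ρ : LoopAlg q →ₐ[ℂ] Module.End ℂ V) (g : MeromorphicField) (f : MeromorphicField) (v : V) :
    dynRep ρ (EllipticAlg.ofMeromorphic q g) (f ⊗ₜ[ℂ] v) = (g * f) ⊗ₜ[ℂ] v := by
  have h : dynRep ρ (EllipticAlg.ofMeromorphic q g) =
      dynCoeff ρ (g ⊗ₜ[ℂ] (1 : LoopAlg q) : MeromorphicField ⊗[ℂ] LoopAlg q) * dynShiftHom V 1 :=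
    SkewMonoidAlgebra.liftNC_single _ _ _ _
  rw [h, map_one, mul_one]
  change (g * f) ⊗ₜ[ℂ] ρ 1 v = _
  rw [map_one, Module.End.one_apply]

theorem dynRep_expQ (ρ : LoopAlg q →ₐ[ℂ] Module.End ℂ V) (f : MeromorphicField) (v : V) :
    dynRep ρ (EllipticAlg.expQ q 1) (f ⊗ₜ[ℂ] v) = (shiftP f) ⊗ₜ[ℂ] v := by
  have h : dynRep ρ (EllipticAlg.expQ q 1) =
      dynCoeff ρ 1 * dynShiftHom V (Multiplicative.ofAdd 1) :=
    SkewMonoidAlgebra.liftNC_single _ _ _ _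
  rw [h, map_one, one_mul]
  change (dynShift V ^ (1 : ℤ)) _ = _
  rw [zpow_one]
  rfl

end Dyn

section ExpLemma

theorem expSeries_rational (c : ℕ → ℂ) (b : ℕ → ℂ) (y y' A B : ℂ)
    (h : ∀ n : ℕ, n ≠ 0 → n * (c n * b n) = y ^ n + y' ^ n - A ^ n - B ^ n) :
    expSeries (modeSeries c b) * ((1 - PowerSeries.C y * PowerSeries.X) *
      (1 - PowerSeries.C y' * PowerSeries.X)) =
      (1 - PowerSeries.C A * PowerSeries.X) * (1 - PowerSeries.C B * PowerSeries.X) := by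
  set L : PowerSeries ℂ := modeSeries c b with hL
  have hL0 : PowerSeries.constantCoeff L = 0 := by
    rw [← PowerSeries.coeff_zero_eq_constantCoeff_apply]
    simp [hL, modeSeries]
  have hvan : ∀ n k : ℕ, n < k → PowerSeries.coeff n (L ^ k) = 0 := by
    intro n k hk
    exact PowerSeries.coeff_of_lt_order _ (lt_of_lt_of_le (by exact_mod_cast hk)
      (PowerSeries.le_order_pow_of_constantCoeff_eq_zero k hL0))
  set E := expSeries L with hE
  have hE0 : PowerSeries.constantCoeff E = 1 := by
    rw [← PowerSeries.coeff_zero_eq_constantCoeff_apply]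
    simp [hE, expSeries]
  have hcoef : ∀ n N : ℕ, n ≤ N → PowerSeries.coeff n E =
      PowerSeries.coeff n (∑ k ∈ Finset.range (N + 1), ((k.factorial : ℂ)⁻¹) • L ^ k) := by
    intro n N hn
    rw [hE, expSeries, PowerSeries.coeff_mk, map_sum]
    refine Finset.sum_subset (fun k hk => ?_) (fun k _ hk => ?_)
    · simp only [Finset.mem_range] at *; omega
    · simp only [Finset.mem_range] at *
      simp [hvan n k (by omega)]
  have hder : PowerSeries.derivative ℂ E = PowerSeries.derivative ℂ L * E := by
    ext n
    rw [PowerSeries.coeff_derivative, hcoef (n + 1) (n + 1) le_rfl,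
      ← PowerSeries.coeff_derivative]
    have h1 : PowerSeries.coeff n (PowerSeries.derivative ℂ L * E) =
        PowerSeries.coeff n (PowerSeries.derivative ℂ L *
          ∑ k ∈ Finset.range (n + 1), ((k.factorial : ℂ)⁻¹) • L ^ k) := by
      rw [PowerSeries.coeff_mul, PowerSeries.coeff_mul]
      refine Finset.sum_congr rfl fun p hp => ?_
      have hp' : p.1 + p.2 = n := by simpa using hp
      rw [hcoef p.2 n (by omega)]
    rw [h1, Finset.sum_range_succ', map_add, Finset.mul_sum]
    have h0 : PowerSeries.derivative ℂ (((Nat.factorial 0 : ℕ) : ℂ)⁻¹ • L ^ 0) = 0 := by simp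
    rw [h0, add_zero, map_sum]
    congr 1
    refine Finset.sum_congr rfl fun k _ => ?_
    rw [Derivation.map_smul, PowerSeries.derivative_pow, Nat.add_sub_cancel, Nat.factorial_succ]
    simp only [PowerSeries.smul_eq_C_mul]
    have : (PowerSeries.C (((k + 1) * k.factorial : ℕ) : ℂ)⁻¹ : PowerSeries ℂ) *
        ((k + 1 : ℕ) : PowerSeries ℂ) = PowerSeries.C ((k.factorial : ℂ)⁻¹) := by
      rw [← map_natCast (PowerSeries.C (R := ℂ)), ← map_mul]
      congr 1
      have := Nat.factorial_ne_zero k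
      push_cast
      have h2 : ((k : ℂ) + 1) ≠ 0 := by exact_mod_cast Nat.succ_ne_zero k
      field_simp
    rw [← mul_assoc, ← mul_assoc, this]; ring
  have hgeom : ∀ t : ℂ, PowerSeries.mk (fun n => t ^ n) *
      (1 - PowerSeries.C t * PowerSeries.X) = 1 := by
    intro t
    ext n
    rw [mul_sub, mul_one, mul_left_comm, map_sub, PowerSeries.coeff_C_mul]
    cases n with
    | zero => simp
    | succ n => simp [pow_succ, mul_comm, PowerSeries.coeff_one]
  have hL' : PowerSeries.derivative ℂ L = PowerSeries.C y * PowerSeries.mk (fun n => y ^ n) +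
      PowerSeries.C y' * PowerSeries.mk (fun n => y' ^ n) -
      PowerSeries.C A * PowerSeries.mk (fun n => A ^ n) -
      PowerSeries.C B * PowerSeries.mk (fun n => B ^ n) := by
    ext n
    have h1 := h (n + 1) (Nat.succ_ne_zero n)
    rw [PowerSeries.coeff_derivative]
    simp only [map_add, map_sub, PowerSeries.coeff_C_mul, PowerSeries.coeff_mk, hL, modeSeries]
    rw [if_neg (Nat.succ_ne_zero n), smul_eq_mul]
    push_cast at h1
    simp only [pow_succ] at h1
    linear_combination h1
  have hd : ∀ t : ℂ, PowerSeries.derivative ℂ (1 - PowerSeries.C t * PowerSeries.X) =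
      -PowerSeries.C t := by
    intro t; simp [Derivation.leibniz]
  set N : PowerSeries ℂ :=
    (1 - PowerSeries.C A * PowerSeries.X) * (1 - PowerSeries.C B * PowerSeries.X) with hN
  set D : PowerSeries ℂ :=
    (1 - PowerSeries.C y * PowerSeries.X) * (1 - PowerSeries.C y' * PowerSeries.X) with hD
  have hN0 : PowerSeries.constantCoeff N = 1 := by simp [hN]
  have hD0 : PowerSeries.constantCoeff D = 1 := by simp [hD]
  have hN' : PowerSeries.derivative ℂ N = -PowerSeries.C A * (1 - PowerSeries.C B * PowerSeries.X)
      - PowerSeries.C B * (1 - PowerSeries.C A * PowerSeries.X) := by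
    rw [hN, Derivation.leibniz, hd, hd]; simp only [smul_eq_mul]; ring
  have hD' : PowerSeries.derivative ℂ D = -PowerSeries.C y * (1 - PowerSeries.C y' * PowerSeries.X)
      - PowerSeries.C y' * (1 - PowerSeries.C y * PowerSeries.X) := by
    rw [hD, Derivation.leibniz, hd, hd]; simp only [smul_eq_mul]; ring
  have key : PowerSeries.derivative ℂ L * (D * N) =
      D * PowerSeries.derivative ℂ N - PowerSeries.derivative ℂ D * N := by
    rw [hL', hN', hD', hN, hD]
    have g1 := hgeom y
    have g2 := hgeom y'
    have g3 := hgeom A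
    have g4 := hgeom B
    generalize PowerSeries.mk (fun n => y ^ n) = m1 at *
    generalize PowerSeries.mk (fun n => y' ^ n) = m2 at *
    generalize PowerSeries.mk (fun n => A ^ n) = m3 at *
    generalize PowerSeries.mk (fun n => B ^ n) = m4 at *
    generalize PowerSeries.C y = c1 at *
    generalize PowerSeries.C y' = c2 at *
    generalize PowerSeries.C A = c3 at *
    generalize PowerSeries.C B = c4 at *
    generalize (PowerSeries.X : PowerSeries ℂ) = x at *
    linear_combination c1 * (1 - c2 * x) * (1 - c3 * x) * (1 - c4 * x) * g1 +
      c2 * (1 - c1 * x) * (1 - c3 * x) * (1 - c4 * x) * g2 -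
      c3 * (1 - c1 * x) * (1 - c2 * x) * (1 - c4 * x) * g3 -
      c4 * (1 - c1 * x) * (1 - c2 * x) * (1 - c3 * x) * g4
  have hinv : N * N⁻¹ = 1 := PowerSeries.mul_inv_cancel N (by rw [hN0]; exact one_ne_zero)
  have hfin : E * D * N⁻¹ = 1 := by
    apply PowerSeries.derivative.ext
    · rw [Derivation.leibniz (PowerSeries.derivative ℂ) (E * D) N⁻¹, PowerSeries.derivative_inv',
        Derivation.leibniz (PowerSeries.derivative ℂ) E D, hder]
      simp only [smul_eq_mul, Derivation.map_one_eq_zero]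
      linear_combination (E * N⁻¹ ^ 2) * key + (E * D * N⁻¹ * PowerSeries.derivative ℂ L + E * N⁻¹ * PowerSeries.derivative ℂ D) * (-hinv)
    · simp [hE0, hD0, hN0]
  calc E * D = E * D * N⁻¹ * N := by rw [mul_assoc, mul_comm N⁻¹, hinv, mul_one]
    _ = N := by rw [hfin, one_mul]

theorem coeff_expSeries_rational (c : ℕ → ℂ) (b : ℕ → ℂ) (y y' A B : ℂ)
    (hy : y ≠ 0) (hy' : y' ≠ 0) (hyy : y - y' ≠ 0)
    (h : ∀ n : ℕ, n ≠ 0 → n * (c n * b n) = y ^ n + y' ^ n - A ^ n - B ^ n) (n : ℕ) (hn : n ≠ 0) :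
    PowerSeries.coeff n (expSeries (modeSeries c b)) =
      (y - A) * (y - B) / (y * (y - y')) * y ^ n -
        (y' - A) * (y' - B) / (y' * (y - y')) * y' ^ n := by
  have hrat := expSeries_rational c b y y' A B h
  set E := expSeries (modeSeries c b) with hE
  set α : ℂ := (y - A) * (y - B) / (y * (y - y')) with hα
  set β : ℂ := -((y' - A) * (y' - B) / (y' * (y - y'))) with hβ
  set γ : ℂ := A * B / (y * y') with hγ
  have e0 : γ + α + β = 1 := by rw [hα, hβ, hγ]; field_simp; ring
  have e1 : γ * (y + y') + α * y' + β * y = A + B := by rw [hα, hβ, hγ]; field_simp; ring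
  have e2 : γ * (y * y') = A * B := by rw [hγ]; field_simp
  have hgeom : ∀ t : ℂ, PowerSeries.mk (fun n => t ^ n) *
      (1 - PowerSeries.C t * PowerSeries.X) = 1 := by
    intro t
    ext n
    rw [mul_sub, mul_one, mul_left_comm, map_sub, PowerSeries.coeff_C_mul]
    cases n with
    | zero => simp
    | succ n => simp [pow_succ, mul_comm, PowerSeries.coeff_one]
  set G : PowerSeries ℂ := PowerSeries.C γ + PowerSeries.C α * PowerSeries.mk (fun n => y ^ n) +
    PowerSeries.C β * PowerSeries.mk (fun n => y' ^ n) with hG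
  have hGD : G * ((1 - PowerSeries.C y * PowerSeries.X) *
      (1 - PowerSeries.C y' * PowerSeries.X)) =
      (1 - PowerSeries.C A * PowerSeries.X) * (1 - PowerSeries.C B * PowerSeries.X) := by
    have e0' := congrArg (PowerSeries.C (R := ℂ)) e0
    have e1' := congrArg (PowerSeries.C (R := ℂ)) e1
    have e2' := congrArg (PowerSeries.C (R := ℂ)) e2
    simp only [map_add, map_mul, map_one] at e0' e1' e2'
    rw [hG]
    linear_combination PowerSeries.C α * (1 - PowerSeries.C y' * PowerSeries.X) * hgeom y +
      PowerSeries.C β * (1 - PowerSeries.C y * PowerSeries.X) * hgeom y' + e0' -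
      PowerSeries.X * e1' + PowerSeries.X ^ 2 * e2'
  have hD0 : ((1 - PowerSeries.C y * PowerSeries.X) *
      (1 - PowerSeries.C y' * PowerSeries.X) : PowerSeries ℂ) ≠ 0 := by
    intro h0
    have := congrArg (PowerSeries.constantCoeff (R := ℂ)) h0
    simp at this
  have hEG : E = G := mul_right_cancel₀ hD0 (hrat.trans hGD.symm)
  rw [hEG, hG]
  simp only [map_add, PowerSeries.coeff_C_mul, PowerSeries.coeff_mk, PowerSeries.coeff_C,
    if_neg hn, hβ]
  ring

theorem coeff_zero_expSeries {A : Type*} [Ring A] [Algebra ℂ A] (c : ℕ → ℂ) (b : ℕ → A) :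
    PowerSeries.coeff 0 (expSeries (modeSeries c b)) = 1 := by
  simp [expSeries]

end ExpLemma

/-- The eigenvalue `l - 2 m` of `h` on the basis vector `v_m` of the `(l+1)`-dimensional
evaluation representation. -/
def wt (l m : ℕ) : ℤ := (l : ℤ) - 2 * m

/-- `[(h + l + 2)/2]_q (q^(h+1) w)^n` on `v_m`. -/
def evXp (q w : ℂ) (l : ℕ) (n : ℤ) (m : ℕ) : ℂ :=
  qNum q (((wt l m : ℂ) + l + 2) / 2) * (q ^ (wt l m + 1) * w) ^ n

/-- `[(-h + l + 2)/2]_q (q^(h-1) w)^n` on `v_m`. -/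
def evXm (q w : ℂ) (l : ℕ) (n : ℤ) (m : ℕ) : ℂ :=
  qNum q ((-(wt l m : ℂ) + l + 2) / 2) * (q ^ (wt l m - 1) * w) ^ n

/-- `a_n` on `v_m`:
`(w^n / n) (q - q⁻¹)⁻¹ ((q^n + q^(-n)) q^(n h) - (q^((l+1) n) + q^(-(l+1) n)))`. -/
def evA (q w : ℂ) (l : ℕ) (n : ℤ) (m : ℕ) : ℂ :=
  w ^ n / n * (q - q⁻¹)⁻¹ *
    ((q ^ n + q ^ (-n)) * q ^ (n * wt l m) - (q ^ ((l + 1) * n) + q ^ (-((l + 1) * n))))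

section EvLemma
variable {q w : ℂ} {l : ℕ}

theorem q_sub_inv_ne (hq0 : q ≠ 0) (hq1 : ‖q‖ < 1) : q - q⁻¹ ≠ 0 := by
  intro h
  have h2 : q * q = 1 := by
    rw [sub_eq_zero] at h
    nth_rewrite 2 [h]
    exact mul_inv_cancel₀ hq0
  have h3 : ‖q‖ * ‖q‖ = 1 := by rw [← norm_mul, h2, norm_one]
  nlinarith [norm_nonneg q]

theorem qNum_intCast (n : ℤ) : qNum q n = (q ^ n - q ^ (-n)) / (q - q⁻¹) := by
  unfold qNum
  rw [← Int.cast_neg, Complex.cpow_intCast, Complex.cpow_intCast]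

theorem zpow_wt (hq0 : q ≠ 0) (m : ℕ) : q ^ wt l m = q ^ l / (q ^ m) ^ 2 := by
  rw [wt, zpow_sub₀ hq0, zpow_natCast, mul_comm, zpow_mul, zpow_natCast]; norm_cast

theorem evXp_eq (hq0 : q ≠ 0) (n : ℤ) (m : ℕ) :
    evXp q w l n m = (q * q ^ l / q ^ m - q ^ m / (q * q ^ l)) / (q - q⁻¹) *
      (q * (q ^ l / (q ^ m) ^ 2) * w) ^ n := by
  have h1 : (((wt l m : ℂ) + l + 2) / 2) = (((l : ℤ) - m + 1 : ℤ) : ℂ) := by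
    simp only [wt]; push_cast; ring
  rw [evXp, h1, qNum_intCast, zpow_add₀ hq0 (wt l m), zpow_one, zpow_wt hq0, zpow_neg,
    zpow_add₀ hq0, zpow_sub₀ hq0, zpow_one, zpow_natCast, zpow_natCast]
  congr 2
  · congr 1
    field_simp
    try (rw [inv_eq_one_div]; field_simp)
  · ring

theorem evXm_eq (hq0 : q ≠ 0) (n : ℤ) (m : ℕ) :
    evXm q w l n m = (q * q ^ m - (q * q ^ m)⁻¹) / (q - q⁻¹) *
      (q⁻¹ * (q ^ l / (q ^ m) ^ 2) * w) ^ n := by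
  have h1 : ((-(wt l m : ℂ) + l + 2) / 2) = ((m + 1 : ℤ) : ℂ) := by
    simp only [wt]; push_cast; ring
  rw [evXm, h1, qNum_intCast, zpow_sub₀ hq0, zpow_one, zpow_wt hq0, zpow_neg, zpow_add₀ hq0,
    zpow_one, zpow_natCast]
  congr 2
  · rw [mul_comm]
  · field_simp

theorem scalar_psi_sub_phi (hq0 : q ≠ 0) (hq1 : ‖q‖ < 1) (hw : w ≠ 0) (m : ℕ) (N : ℤ) :
    psiMode q (q ^ wt l m) (fun j => evA q w l j m) N -
      phiMode q (q ^ (-wt l m)) (fun j => evA q w l j m) N =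
    ((q * q ^ m - (q * q ^ m)⁻¹) * (q ^ l / q ^ m - q ^ m / q ^ l) *
      (q⁻¹ * (q ^ l / (q ^ m) ^ 2) * w) ^ N -
     (q ^ m - (q ^ m)⁻¹) * (q * q ^ l / q ^ m - q ^ m / (q * q ^ l)) *
      (q * (q ^ l / (q ^ m) ^ 2) * w) ^ N) / (q - q⁻¹) := by
  have hqq := q_sub_inv_ne hq0 hq1
  have hq2 : q ^ 2 - 1 ≠ 0 := by
    intro h; apply hqq
    rw [show q - q⁻¹ = (q ^ 2 - 1) / q by field_simp, h, zero_div]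
  set y : ℂ := q * (q ^ l / (q ^ m) ^ 2) * w with hy
  set y' : ℂ := q⁻¹ * (q ^ l / (q ^ m) ^ 2) * w with hy'
  set a : ℂ := q * q ^ l * w with ha
  set b : ℂ := w / (q * q ^ l) with hb
  have hM : q ^ m ≠ 0 := pow_ne_zero _ hq0
  have hL : q ^ l ≠ 0 := pow_ne_zero _ hq0
  have hy0 : y ≠ 0 := by simp [hy, hq0, hw]
  have hy0' : y' ≠ 0 := by simp [hy', hq0, hw]
  have hyy : y - y' ≠ 0 := by
    have : y - y' = (q - q⁻¹) * (q ^ l / (q ^ m) ^ 2) * w := by rw [hy, hy']; ring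
    rw [this]; simp [hqq, hq0, hw]
  have hA : ∀ j : ℤ, j ≠ 0 → j * ((q - q⁻¹) * evA q w l j m) = y ^ j + y' ^ j - a ^ j - b ^ j := by
    intro j hj
    have hj' : (j : ℂ) ≠ 0 := by exact_mod_cast hj
    have hab : y ^ j + y' ^ j - a ^ j - b ^ j =
        w ^ j * ((q ^ j + q ^ (-j)) * q ^ (j * wt l m) -
          (q ^ ((l + 1) * j) + q ^ (-((l + 1) * j)))) := by
      have hL1 : q * q ^ l = q ^ ((l : ℤ) + 1) := by rw [zpow_add₀ hq0]; simp [mul_comm]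
      rw [hy, hy', ha, hb, ← zpow_wt hq0, hL1]
      simp only [mul_zpow, div_zpow, ← zpow_mul, inv_zpow', zpow_neg]
      rw [mul_comm j (wt l m)]
      ring
    rw [hab, evA]
    field_simp
  have hqe : q - q⁻¹ = (q ^ 2 - 1) / q := by field_simp
  have key : q ^ wt l m * ((y - a) * (y - b) / (y * (y - y'))) =
      -((q ^ m - (q ^ m)⁻¹) * (q * q ^ l / q ^ m - q ^ m / (q * q ^ l)) / (q - q⁻¹)) := by
    rw [show y - y' = (q ^ 2 - 1) * q ^ l * w / (q * (q ^ m) ^ 2) by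
      rw [hy, hy']; field_simp, zpow_wt hq0, hy, ha, hb, hqe]
    clear_value y y' a b
    generalize q ^ l = L at *
    generalize q ^ m = M at *
    field_simp
    ring
  have key' : q ^ wt l m * ((y' - a) * (y' - b) / (y' * (y - y'))) =
      -((q * q ^ m - (q * q ^ m)⁻¹) * (q ^ l / q ^ m - q ^ m / q ^ l) / (q - q⁻¹)) := by
    rw [show y - y' = (q ^ 2 - 1) * q ^ l * w / (q * (q ^ m) ^ 2) by
      rw [hy, hy']; field_simp, zpow_wt hq0, hy', ha, hb, hqe]
    clear_value y y' a b
    generalize q ^ l = L at *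
    generalize q ^ m = M at *
    field_simp
    ring
  have hab : a ≠ 0 ∧ b ≠ 0 := by constructor <;> simp [ha, hb, hq0, hw]
  have hprod : (q ^ wt l m) ^ 2 * (a * b) = y * y' := by
    rw [zpow_wt hq0, hy, hy', ha, hb]; field_simp
  have hwt0 : q ^ wt l m ≠ 0 := zpow_ne_zero _ hq0
  rcases lt_trichotomy N 0 with hN | hN | hN
  · obtain ⟨n, rfl⟩ : ∃ n : ℕ, N = -(n : ℤ) := ⟨N.natAbs, by omega⟩
    have hn : n ≠ 0 := by omega
    have hyy2 : y⁻¹ - y'⁻¹ ≠ 0 := by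
      rw [inv_sub_inv hy0 hy0']
      exact div_ne_zero (by rw [← neg_sub]; exact neg_ne_zero.2 hyy) (mul_ne_zero hy0 hy0')
    have := coeff_expSeries_rational (fun _ => -(q - q⁻¹))
      (fun n : ℕ => evA q w l (-(n : ℤ)) m) y⁻¹ y'⁻¹ a⁻¹ b⁻¹ (inv_ne_zero hy0) (inv_ne_zero hy0')
      hyy2 (by
        intro j hj
        have := hA (-(j : ℤ)) (by omega)
        simp only [zpow_neg, zpow_natCast, ← inv_pow] at this
        rw [← this]; push_cast; ring) n hn
    rw [psiMode, if_neg (by omega), phiMode, if_pos (by omega)]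
    simp only [neg_neg, Int.toNat_natCast]
    rw [this]
    have inv_key : ∀ s t : ℂ, s ≠ 0 → t ≠ 0 → s - t ≠ 0 → (q ^ wt l m) ^ 2 * (a * b) = s * t →
        (q ^ wt l m)⁻¹ * ((s⁻¹ - a⁻¹) * (s⁻¹ - b⁻¹) / (s⁻¹ * (s⁻¹ - t⁻¹))) =
          -(q ^ wt l m * ((s - a) * (s - b) / (s * (s - t)))) := by
      intro s t hs ht hst hp
      obtain ⟨ha0, hb0⟩ := hab
      rw [show s⁻¹ - t⁻¹ = -(s - t) / (s * t) by field_simp; ring]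
      field_simp
      linear_combination (s - a) * (s - b) * hp
    have k1 := inv_key y y' hy0 hy0' hyy hprod
    have k2 := inv_key y' y hy0' hy0 (by rw [← neg_sub]; exact neg_ne_zero.2 hyy)
      (by rw [hprod, mul_comm])
    rw [key] at k1
    rw [show (y' - a) * (y' - b) / (y' * (y' - y)) = -((y' - a) * (y' - b) / (y' * (y - y'))) by
      rw [← neg_sub y y', mul_neg, div_neg], mul_neg, key',
      show (y'⁻¹ - a⁻¹) * (y'⁻¹ - b⁻¹) / (y'⁻¹ * (y'⁻¹ - y⁻¹)) =
        -((y'⁻¹ - a⁻¹) * (y'⁻¹ - b⁻¹) / (y'⁻¹ * (y⁻¹ - y'⁻¹))) by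
      rw [← neg_sub y⁻¹ y'⁻¹, mul_neg, div_neg]] at k2
    simp only [zpow_neg, zpow_natCast, inv_pow] at k1 k2 ⊢
    linear_combination -(y ^ n)⁻¹ * k1 - (y' ^ n)⁻¹ * k2
  · subst hN
    simp only [psiMode, phiMode, le_refl, if_true, neg_zero, Int.toNat_zero, coeff_zero_expSeries,
      mul_one, zpow_zero]
    rw [zpow_neg, zpow_wt hq0]
    rw [hqe]
    clear_value y y' a b
    generalize q ^ l = L at *
    generalize q ^ m = M at *
    field_simp
    ring
  · obtain ⟨n, rfl⟩ : ∃ n : ℕ, N = (n : ℤ) := ⟨N.natAbs, by omega⟩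
    have hn : n ≠ 0 := by omega
    have := coeff_expSeries_rational (fun _ => q - q⁻¹)
      (fun n : ℕ => evA q w l (n : ℤ) m) y y' a b hy0 hy0' hyy (by
        intro j hj
        exact hA (j : ℤ) (by omega)) n hn
    rw [psiMode, if_pos (by omega), phiMode, if_neg (by omega)]
    simp only [Int.toNat_natCast]
    rw [this, zpow_natCast, zpow_natCast]
    linear_combination y ^ n * key - y' ^ n * key'

end EvLemma

/-- `S⁺ v_m = v_{m-1}`, with `v_{-1} = 0`. -/
def Splus (l : ℕ) : Matrix (Fin (l + 1)) (Fin (l + 1)) ℂ :=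
  Matrix.of fun i j => if (i : ℕ) + 1 = j then 1 else 0

/-- `S⁻ v_m = v_{m+1}`, with `v_{l+1} = 0`. -/
def Sminus (l : ℕ) : Matrix (Fin (l + 1)) (Fin (l + 1)) ℂ :=
  Matrix.of fun i j => if (j : ℕ) + 1 = i then 1 else 0

/-- The action of the generators in the evaluation representation, in the basis `v_0, …, v_l`:
`x^±(z) = S^± [(±h + l + 2)/2]_q δ(q^(h±1) w / z)`. -/
def evGen (q w : ℂ) (l : ℕ) : LoopGen → Matrix (Fin (l + 1)) (Fin (l + 1)) ℂ
  | .xp n => Splus l * Matrix.diagonal fun m : Fin (l + 1) => evXp q w l n m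
  | .xm n => Sminus l * Matrix.diagonal fun m : Fin (l + 1) => evXm q w l n m
  | .a n => Matrix.diagonal fun m : Fin (l + 1) => evA q w l n m
  | .h => Matrix.diagonal fun m : Fin (l + 1) => (wt l m : ℂ)
  | .k => Matrix.diagonal fun m : Fin (l + 1) => q ^ wt l m
  | .kinv => Matrix.diagonal fun m : Fin (l + 1) => q ^ (-wt l m)

section EvRel
variable {q w : ℂ} {l : ℕ}

theorem evGen_xp_apply (n : ℤ) (i j : Fin (l + 1)) :
    evGen q w l (.xp n) i j = if (i : ℕ) + 1 = j then evXp q w l n j else 0 := by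
  simp [evGen, Matrix.mul_diagonal, Splus]

theorem evGen_xm_apply (n : ℤ) (i j : Fin (l + 1)) :
    evGen q w l (.xm n) i j = if (j : ℕ) + 1 = i then evXm q w l n j else 0 := by
  simp [evGen, Matrix.mul_diagonal, Sminus]

theorem wt_succ (m : ℕ) : wt l (m + 1) = wt l m - 2 := by simp only [wt]; push_cast; ring

theorem evGen_xp_mul_xp (m n : ℤ) (i j : Fin (l + 1)) :
    (evGen q w l (.xp m) * evGen q w l (.xp n)) i j =
      if (i : ℕ) + 2 = j then evXp q w l m (i + 1) * evXp q w l n j else 0 := by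
  rw [Matrix.mul_apply]
  simp only [evGen_xp_apply]
  split_ifs with h
  · rw [Finset.sum_eq_single (⟨i + 1, by omega⟩ : Fin (l + 1))]
    · simp [← h]
    · intro k _ hk
      rw [if_neg (fun h' => hk (Fin.ext h'.symm)), zero_mul]
    · simp
  · refine Finset.sum_eq_zero fun k _ => ?_
    split_ifs <;> first | omega | simp

theorem evGen_xm_mul_xm (m n : ℤ) (i j : Fin (l + 1)) :
    (evGen q w l (.xm m) * evGen q w l (.xm n)) i j =
      if (j : ℕ) + 2 = i then evXm q w l m (j + 1) * evXm q w l n j else 0 := by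
  rw [Matrix.mul_apply]
  simp only [evGen_xm_apply]
  split_ifs with h
  · rw [Finset.sum_eq_single (⟨j + 1, by omega⟩ : Fin (l + 1))]
    · simp [← h]
    · intro k _ hk
      rw [if_neg (c := (j : ℕ) + 1 = k) (fun h' => hk (Fin.ext h'.symm)), mul_zero]
    · simp
  · refine Finset.sum_eq_zero fun k _ => ?_
    split_ifs <;> first | omega | simp

theorem evGen_xp_mul_xm (hq0 : q ≠ 0) (m n : ℤ) :
    evGen q w l (.xp m) * evGen q w l (.xm n) =
      Matrix.diagonal fun i : Fin (l + 1) => evXp q w l m (i + 1) * evXm q w l n i := by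
  ext i j
  rw [Matrix.mul_apply, Matrix.diagonal_apply]
  simp only [evGen_xp_apply, evGen_xm_apply]
  split_ifs with h
  · subst h
    by_cases hi : (i : ℕ) + 1 < l + 1
    · rw [Finset.sum_eq_single (⟨i + 1, hi⟩ : Fin (l + 1))]
      · simp
      · intro k _ hk
        rw [if_neg (fun h' => hk (Fin.ext h'.symm)), zero_mul]
      · simp
    · have hil : (i : ℕ) = l := by omega
      rw [Finset.sum_eq_zero, hil, evXp_eq hq0]
      · rw [show q * q ^ l / q ^ (l + 1) - q ^ (l + 1) / (q * q ^ l) = 0 by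
          rw [pow_succ, mul_comm (q ^ l) q, sub_self]]
        simp
      · intro k _
        rw [if_neg (by omega), zero_mul]
  · refine Finset.sum_eq_zero fun k _ => ?_
    split_ifs with h1 h2
    · exact absurd (Fin.ext (by omega)) h
    all_goals simp

theorem evGen_xm_mul_xp (hq0 : q ≠ 0) (m n : ℤ) :
    evGen q w l (.xm n) * evGen q w l (.xp m) =
      Matrix.diagonal fun i : Fin (l + 1) => evXm q w l n (i - 1 : ℕ) * evXp q w l m i *
        (if (i : ℕ) = 0 then 0 else 1) := by
  ext i j
  rw [Matrix.mul_apply, Matrix.diagonal_apply]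
  simp only [evGen_xp_apply, evGen_xm_apply]
  split_ifs with h hi
  · rw [mul_zero]
    refine Finset.sum_eq_zero fun k _ => ?_
    rw [if_neg (by omega), zero_mul]
  · subst h
    rw [Finset.sum_eq_single (⟨i - 1, by omega⟩ : Fin (l + 1))]
    · simp [show (i : ℕ) - 1 + 1 = i by omega]
    · intro k _ hk
      rw [if_neg (fun h' => hk (Fin.ext (by simp; omega))), zero_mul]
    · simp
  · refine Finset.sum_eq_zero fun k _ => ?_
    split_ifs with h1 h2
    · exact absurd (Fin.ext (by omega)) h
    all_goals simp

theorem diagonal_psiMode {N : ℕ} (k : Fin N → ℂ) (a : ℤ → Fin N → ℂ) (m : ℤ) :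
    psiMode q (Matrix.diagonal k) (fun j => Matrix.diagonal (a j)) m =
      Matrix.diagonal fun i => psiMode q (k i) (fun j => a j i) m := by
  have h1 := map_psiMode (Matrix.diagonalAlgHom (n := Fin N) (α := ℂ) ℂ) q k a m
  refine h1.symm.trans (congrArg (Matrix.diagonal (n := Fin N) (α := ℂ)) (funext fun i => ?_))
  exact map_psiMode (Pi.evalAlgHom ℂ (fun _ : Fin N => ℂ) i) q k a m

theorem diagonal_phiMode {N : ℕ} (k : Fin N → ℂ) (a : ℤ → Fin N → ℂ) (m : ℤ) :
    phiMode q (Matrix.diagonal k) (fun j => Matrix.diagonal (a j)) m =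
      Matrix.diagonal fun i => phiMode q (k i) (fun j => a j i) m := by
  have h1 := map_phiMode (Matrix.diagonalAlgHom (n := Fin N) (α := ℂ) ℂ) q k a m
  refine h1.symm.trans (congrArg (Matrix.diagonal (n := Fin N) (α := ℂ)) (funext fun i => ?_))
  exact map_phiMode (Pi.evalAlgHom ℂ (fun _ : Fin N => ℂ) i) q k a m

theorem evXp_add (hq0 : q ≠ 0) (hw : w ≠ 0) (m n : ℤ) (i : ℕ) :
    evXp q w l (m + n) i = evXp q w l m i * (q ^ (wt l i + 1) * w) ^ n := by
  rw [evXp, evXp, zpow_add₀ (mul_ne_zero (zpow_ne_zero _ hq0) hw), mul_assoc]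

theorem evXm_add (hq0 : q ≠ 0) (hw : w ≠ 0) (m n : ℤ) (i : ℕ) :
    evXm q w l (m + n) i = evXm q w l m i * (q ^ (wt l i - 1) * w) ^ n := by
  rw [evXm, evXm, zpow_add₀ (mul_ne_zero (zpow_ne_zero _ hq0) hw), mul_assoc]

theorem evA_sub_evA (hq0 : q ≠ 0) (n : ℤ) (i : ℕ) :
    evA q w l n i - evA q w l n (i + 1) =
      qNum q (2 * n) / n * (q ^ (wt l i - 1) * w) ^ n := by
  rw [show (2 * (n : ℂ)) = ((2 * n : ℤ) : ℂ) by push_cast; rfl, qNum_intCast, evA, evA, wt_succ,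
    mul_zpow, ← zpow_mul]
  have e1 : q ^ (n * wt l i) = q ^ ((wt l i - 1) * n) * q ^ n := by
    rw [← zpow_add₀ hq0]; congr 1; ring
  have e2 : q ^ (n * (wt l i - 2)) = q ^ ((wt l i - 1) * n) * q ^ (-n) := by
    rw [← zpow_add₀ hq0]; congr 1; ring
  have e3 : q ^ (2 * n) = q ^ n * q ^ n := by rw [← zpow_add₀ hq0]; congr 1; ring
  have e4 : q ^ (-(2 * n)) = q ^ (-n) * q ^ (-n) := by rw [← zpow_add₀ hq0]; congr 1; ring
  rw [e1, e2, e3, e4]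
  ring

theorem evGen_rel (hq0 : q ≠ 0) (hq1 : ‖q‖ < 1) (hw : w ≠ 0)
    ⦃s t : FreeAlgebra ℂ LoopGen⦄ (h : LoopRel q s t) :
    FreeAlgebra.lift ℂ (evGen q w l) s = FreeAlgebra.lift ℂ (evGen q w l) t := by
  have hqq := q_sub_inv_ne hq0 hq1
  have hg : ∀ g : LoopGen, FreeAlgebra.lift ℂ (evGen q w l) (gen g) = evGen q w l g :=
    fun g => FreeAlgebra.lift_ι_apply _ _
  cases h with
  | a_zero =>
    rw [hg, map_zero]
    ext i j
    simp [evGen, evA]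
  | k_kinv =>
    rw [map_mul, hg, hg, map_one]
    simp only [evGen, Matrix.diagonal_mul_diagonal, ← zpow_add₀ hq0, add_neg_cancel, zpow_zero,
      Matrix.diagonal_one]
  | kinv_k =>
    rw [map_mul, hg, hg, map_one]
    simp only [evGen, Matrix.diagonal_mul_diagonal, ← zpow_add₀ hq0, neg_add_cancel, zpow_zero,
      Matrix.diagonal_one]
  | h_k => 
    rw [map_mul, map_mul, hg, hg]
    simp only [evGen, Matrix.diagonal_mul_diagonal, mul_comm]
  | h_a n =>
    rw [map_mul, map_mul, hg, hg]
    simp only [evGen, Matrix.diagonal_mul_diagonal, mul_comm]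
  | k_a n =>
    rw [map_mul, map_mul, hg, hg]
    simp only [evGen, Matrix.diagonal_mul_diagonal, mul_comm]
  | a_a n m =>
    rw [map_mul, map_mul, hg, hg]
    simp only [evGen, Matrix.diagonal_mul_diagonal, mul_comm]
  | h_xp n =>
    rw [map_sub, map_mul, map_mul, map_smul, hg, hg]
    ext i j
    rw [Matrix.sub_apply, Matrix.smul_apply]
    rw [show evGen q w l .h = Matrix.diagonal fun m : Fin (l + 1) => (wt l m : ℂ) from rfl]
    rw [Matrix.diagonal_mul, Matrix.mul_diagonal, evGen_xp_apply]
    split_ifs with hij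
    · rw [← hij, wt_succ]; push_cast; simp only [smul_eq_mul]; ring
    · simp
  | h_xm n =>
    rw [map_sub, map_mul, map_mul, map_smul, hg, hg]
    ext i j
    rw [Matrix.sub_apply, Matrix.smul_apply]
    rw [show evGen q w l .h = Matrix.diagonal fun m : Fin (l + 1) => (wt l m : ℂ) from rfl]
    rw [Matrix.diagonal_mul, Matrix.mul_diagonal, evGen_xm_apply]
    split_ifs with hij
    · rw [← hij, wt_succ]; push_cast; simp only [smul_eq_mul]; ring
    · simp
  | k_xp n =>
    rw [map_mul, map_smul, map_mul, hg, hg]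
    ext i j
    rw [Matrix.smul_apply]
    rw [show evGen q w l .k = Matrix.diagonal fun m : Fin (l + 1) => q ^ wt l m from rfl]
    rw [Matrix.diagonal_mul, Matrix.mul_diagonal, evGen_xp_apply]
    split_ifs with hij
    · rw [← hij, wt_succ, zpow_sub₀ hq0, smul_eq_mul]
      norm_cast
      field_simp
    · simp
  | k_xm n =>
    rw [map_mul, map_smul, map_mul, hg, hg]
    ext i j
    rw [Matrix.smul_apply]
    rw [show evGen q w l .k = Matrix.diagonal fun m : Fin (l + 1) => q ^ wt l m from rfl]
    rw [Matrix.diagonal_mul, Matrix.mul_diagonal, evGen_xm_apply]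
    split_ifs with hij
    · rw [← hij, wt_succ, zpow_sub₀ hq0, smul_eq_mul, zpow_neg]
      norm_cast
      field_simp
    · simp
  | a_xp n m hn =>
    rw [map_sub, map_mul, map_mul, map_smul, hg, hg, hg]
    ext i j
    rw [Matrix.sub_apply, Matrix.smul_apply]
    rw [show evGen q w l (.a n) = Matrix.diagonal fun m : Fin (l + 1) => evA q w l n m from rfl]
    rw [Matrix.diagonal_mul, Matrix.mul_diagonal, evGen_xp_apply, evGen_xp_apply]
    split_ifs with hij
    · have e := evA_sub_evA (w := w) (l := l) hq0 n i
      have e5 : wt l (j : ℕ) + 1 = wt l i - 1 := by rw [← hij, wt_succ]; ring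
      rw [hij] at e
      rw [evXp_add hq0 hw, smul_eq_mul, e5]
      linear_combination evXp q w l m j * e
    · simp
  | a_xm n m hn =>
    rw [map_sub, map_mul, map_mul, map_smul, hg, hg, hg]
    ext i j
    rw [Matrix.sub_apply, Matrix.smul_apply]
    rw [show evGen q w l (.a n) = Matrix.diagonal fun m : Fin (l + 1) => evA q w l n m from rfl]
    rw [Matrix.diagonal_mul, Matrix.mul_diagonal, evGen_xm_apply, evGen_xm_apply]
    split_ifs with hij
    · have e := evA_sub_evA (w := w) (l := l) hq0 n j
      rw [hij] at e
      rw [evXm_add hq0 hw, smul_eq_mul]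
      linear_combination -evXm q w l m j * e
    · simp
  | xp_xp m n =>
    simp only [map_sub, map_mul, map_smul, hg]
    ext i j
    simp only [Matrix.sub_apply, Matrix.smul_apply, evGen_xp_mul_xp]
    split_ifs with hij
    · have e5 : q ^ (wt l (i + 1 : ℕ) + 1) * w = q ^ 2 * (q ^ (wt l (j : ℕ) + 1) * w) := by
        rw [← hij, show (i : ℕ) + 2 = (i + 1) + 1 from rfl, wt_succ (i + 1), ← mul_assoc,
          ← zpow_natCast, ← zpow_add₀ hq0]
        congr 2; push_cast; ring
      simp only [evXp_add hq0 hw _ 1, zpow_one, smul_eq_mul]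
      rw [e5]; ring
    · simp
  | xm_xm m n =>
    simp only [map_sub, map_mul, map_smul, hg]
    ext i j
    simp only [Matrix.sub_apply, Matrix.smul_apply, evGen_xm_mul_xm]
    split_ifs with hij
    · have e5 : q ^ (wt l (j + 1 : ℕ) - 1) * w =
          q ^ (-2 : ℤ) * (q ^ (wt l (j : ℕ) - 1) * w) := by
        rw [wt_succ, ← mul_assoc, ← zpow_add₀ hq0]
        congr 2; ring
      simp only [evXm_add hq0 hw _ 1, zpow_one, smul_eq_mul]
      rw [e5]; ring
    · simp
  | xp_xm m n =>
    rw [map_sub, map_mul, map_mul, map_smul, map_sub, map_psiMode, map_phiMode]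
    simp only [hg]
    rw [evGen_xp_mul_xm hq0, evGen_xm_mul_xp hq0]
    simp only [evGen]
    rw [diagonal_psiMode, diagonal_phiMode, Matrix.diagonal_sub, Matrix.diagonal_sub,
      ← Matrix.diagonal_smul]
    congr 1
    funext i
    rw [Pi.smul_apply, scalar_psi_sub_phi hq0 hq1 hw]
    rw [evXp_eq hq0, evXm_eq hq0, evXp_eq hq0, evXm_eq hq0]
    have hb : ∀ j : ℕ, q * (q ^ l / (q ^ (j + 1)) ^ 2) * w = q⁻¹ * (q ^ l / (q ^ j) ^ 2) * w := by
      intro j; rw [pow_succ q j]; field_simp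
    have hm0 : ∀ j : ℕ, q⁻¹ * (q ^ l / (q ^ j) ^ 2) * w ≠ 0 := by
      intro j; simp [hq0, hw]
    have hqe : q * q ^ l / q ^ ((i : ℕ) + 1) - q ^ ((i : ℕ) + 1) / (q * q ^ l) =
        q ^ l / q ^ (i : ℕ) - q ^ (i : ℕ) / q ^ l := by
      rw [pow_succ]; field_simp
    rw [hb, hqe, zpow_add₀ (hm0 i)]
    rcases Nat.eq_zero_or_pos (i : ℕ) with hi | hi
    · rw [hi]
      simp only [if_true, pow_zero, inv_one, sub_self, smul_eq_mul]
      ring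
    · obtain ⟨j, hj⟩ : ∃ j : ℕ, (i : ℕ) = j + 1 := ⟨i - 1, by omega⟩
      rw [if_neg (by omega), hj, Nat.add_sub_cancel, hb j, zpow_add₀ (hm0 j), ← pow_succ' q j,
        smul_eq_mul]
      ring

end EvRel

/-- The `(l+1)`-dimensional evaluation representation of the quantum loop algebra, with evaluation
parameter `w`. -/
def evalRep (q : ℂ) (hq0 : q ≠ 0) (hq1 : ‖q‖ < 1) (w : ℂ) (hw : w ≠ 0) (l : ℕ) :
    LoopAlg q →ₐ[ℂ] Module.End ℂ (Fin (l + 1) → ℂ) :=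
  (Matrix.toLinAlgEquiv' : Matrix (Fin (l + 1)) (Fin (l + 1)) ℂ ≃ₐ[ℂ] _).toAlgHom.comp
    (RingQuot.liftAlgHom ℂ ⟨FreeAlgebra.lift ℂ (evGen q w l), evGen_rel hq0 hq1 hw⟩)

theorem evalRep_of (q : ℂ) (hq0 : q ≠ 0) (hq1 : ‖q‖ < 1) (w : ℂ) (hw : w ≠ 0) (l : ℕ)
    (s : LoopGen) (f : Fin (l + 1) → ℂ) :
    evalRep q hq0 hq1 w hw l (LoopAlg.of q s) f = (evGen q w l s).mulVec f := by
  have h : RingQuot.liftAlgHom ℂ ⟨FreeAlgebra.lift ℂ (evGen q w l), evGen_rel hq0 hq1 hw⟩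
      (RingQuot.mkAlgHom ℂ (LoopRel q) (gen s)) = evGen q w l s := by
    rw [RingQuot.liftAlgHom_mkAlgHom_apply]
    exact FreeAlgebra.lift_ι_apply _ _
  change Matrix.toLinAlgEquiv' (RingQuot.liftAlgHom ℂ
    ⟨FreeAlgebra.lift ℂ (evGen q w l), evGen_rel hq0 hq1 hw⟩
      (RingQuot.mkAlgHom ℂ (LoopRel q) (gen s))) f = _
  rw [h, Matrix.toLinAlgEquiv'_apply]


/-- The `(l+1)`-dimensional evaluation representation of the elliptic loop algebra, with
evaluation parameter `q^(2v)`. -/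
def evalDynRep (q : ℂ) (hq0 : q ≠ 0) (hq1 : ‖q‖ < 1) (l : ℕ) (v : ℂ) :
    EllipticAlg q →ₐ[ℂ] Module.End ℂ (MeromorphicField ⊗[ℂ] (Fin (l + 1) → ℂ)) :=
  dynRep (evalRep q hq0 hq1 (q ^ (2 * v)) (fun h => hq0 (Complex.cpow_eq_zero_iff _ _ |>.1 h).1) l)

/-- A generator of the loop algebra, in the elliptic loop algebra. -/
def EllipticAlg.of (q : ℂ) (s : LoopGen) : EllipticAlg q :=
  EllipticAlg.ofLoop q (LoopAlg.of q s)

/-- The factor `exp(∑_{n>0} [n]_q / ([2n]_q [rn]_q) a_{-n} z^n)` of the elliptic current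
`K(u)`, `z = q^(2u)`, as a power series in `z`. At `c = 0`,
`K(u) = kCreation(z) kAnnihilation(z⁻¹) e^Q z^(h/(2r))`. -/
def kCreation (q r : ℂ) : PowerSeries (EllipticAlg q) :=
  expSeries (modeSeries (fun n => qNum q n / (qNum q (2 * n) * qNum q (r * n)))
    fun n => EllipticAlg.of q (.a (-(n : ℤ))))

/-- The factor `exp(-∑_{n>0} [n]_q / ([2n]_q [rn]_q) a_n z^(-n))` of the elliptic current
`K(u)`, as a power series in `z⁻¹`. -/
def kAnnihilation (q r : ℂ) : PowerSeries (EllipticAlg q) :=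
  expSeries (modeSeries (fun n => -(qNum q n / (qNum q (2 * n) * qNum q (r * n))))
    fun n => EllipticAlg.of q (.a (n : ℤ)))

/-- The currents `H^±(u) = κ K(u + σ + 1/2) K(u + σ - 1/2)`, where `σ = ± r/2`, and `κ = 1` at
`c = 0`. As the `a_n` commute with each other, with `h` and with `e^Q` at `c = 0`,
`H^±(u) = hCreation(z) hAnnihilation(z⁻¹) e^(2Q) q^(2 (u + σ) h / r)`, `z = q^(2u)`.
This is the first factor, a power series in `z`. -/
def hCreation (q r σ : ℂ) : PowerSeries (EllipticAlg q) :=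
  rescaleSeries (q ^ (2 * (σ + 1 / 2))) (kCreation q r) *
    rescaleSeries (q ^ (2 * (σ - 1 / 2))) (kCreation q r)

/-- The second factor of `H^±(u)`, a power series in `z⁻¹`. -/
def hAnnihilation (q r σ : ℂ) : PowerSeries (EllipticAlg q) :=
  rescaleSeries (q ^ (-(2 * (σ + 1 / 2)))) (kAnnihilation q r) *
    rescaleSeries (q ^ (-(2 * (σ - 1 / 2)))) (kAnnihilation q r)

section Predicates
variable {q : ℂ} {M : Type*} [AddCommGroup M] [Module ℂ M]

/-- `Ω` is a pseudo-highest weight vector of the representation `π`. -/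
structure IsPseudoHighestWeightVector (π : EllipticAlg q →ₐ[ℂ] Module.End ℂ M) (Ω : M) : Prop where
  ne_zero : Ω ≠ 0
  expQ : π (EllipticAlg.expQ q 1) Ω = Ω
  xp : ∀ n : ℤ, π (EllipticAlg.of q (.xp n)) Ω = 0
  weight : ∃ dp dm : ℕ → ℂ, dp 0 * dm 0 = 1 ∧
    (∀ n : ℕ, π (EllipticAlg.ofLoop q
      (psiMode q (LoopAlg.of q .k) (fun j => LoopAlg.of q (.a j)) n)) Ω = dp n • Ω) ∧
    (∀ n : ℕ, π (EllipticAlg.ofLoop q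
      (phiMode q (LoopAlg.of q .kinv) (fun j => LoopAlg.of q (.a j)) (-(n : ℤ)))) Ω = dm n • Ω)
  cyclic : ∀ x : M, ∃ y : EllipticAlg q, π y Ω = x

/-- `H^±(u) Ω = η(u) Ω` for all `u` with `s < |q^(2u)| < t`: the coefficients of both factors of
`H^±(u)` act on `Ω` by complex numbers, the two series of these numbers converge at `z = q^(2u)`, and
`η(u)` is the value of the product. Here `σ = ± r/2`, and `wght` is the weight of `Ω`. -/
def HasHEigenvalue (r σ : ℂ) (π : EllipticAlg q →ₐ[ℂ] Module.End ℂ M) (Ω : M)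
    (s t : ℝ) (η : ℂ → ℂ) : Prop :=
  ∃ (wght : ℂ) (x y : ℕ → ℂ),
    π (EllipticAlg.of q .h) Ω = wght • Ω ∧
    π (EllipticAlg.of q .k) Ω = q ^ wght • Ω ∧
    (∀ n, π (PowerSeries.coeff n (hCreation q r σ)) Ω = x n • Ω) ∧
    (∀ n, π (PowerSeries.coeff n (hAnnihilation q r σ) * EllipticAlg.expQ q 2) Ω = y n • Ω) ∧
    ∀ u : ℂ, s < ‖q ^ (2 * u)‖ → ‖q ^ (2 * u)‖ < t →
      ∃ X Y : ℂ, HasSum (fun n => x n * (q ^ (2 * u)) ^ n) X ∧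
        HasSum (fun n => y n * ((q ^ (2 * u))⁻¹) ^ n) Y ∧
        η u = X * Y * q ^ (2 * (u + σ) * wght / r)

/-- `τ = -2πi / log p`, where `p = q^(2r)` and `log p = 2 r log q`. -/
def tau (q r : ℂ) : ℂ := -(2 * Real.pi * Complex.I) / (2 * r * Complex.log q)

/-- `P` is an elliptic Drinfeld polynomial, with constant `c`, of the representation `π`: an
entire function whose zeros, counted with multiplicity, are `α_1, …, α_d` modulo `r ℤ + r τ ℤ`, which
has the quasi-periods `r` and `r τ` of a product of `d` theta functions `[u - α_j]`, and with
`H^±(u) Ω = c P(u+1)/P(u) Ω` for a pseudo-highest weight vector `Ω`, as meromorphic functions of `u`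
(that is, on a non-empty strip where the action of `H^±(u)` on `Ω` converges). -/
structure IsEllipticDrinfeldPolynomial (r : ℂ) (π : EllipticAlg q →ₐ[ℂ] Module.End ℂ M)
    (c : ℂ) (P : ℂ → ℂ) : Prop where
  entire : Differentiable ℂ P
  quasiPeriodic : ∃ (d : ℕ) (α : Fin d → ℂ),
    (∀ u : ℂ, analyticOrderAt P u =
      ((Set.ncard {j : Fin d | ∃ m n : ℤ, u - α j = m * r + n * (r * tau q r)} : ℕ) : ℕ∞)) ∧
    (∀ u : ℂ, P (u + r) = (-1) ^ d * P u) ∧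
    (∀ u : ℂ, P (u + r * tau q r) = (-1) ^ d *
      Complex.exp (-(Real.pi * Complex.I) * ∑ j, (2 * (u - α j) / r + tau q r)) * P u) ∧
    c = q ^ (-(d : ℂ) / r) * ∏ j, q ^ (2 * α j / r)
  action : ∃ Ω : M, IsPseudoHighestWeightVector π Ω ∧
    ∀ σ : ℂ, σ = r / 2 ∨ σ = -(r / 2) →
      ∃ (s t : ℝ) (η : ℂ → ℂ), 0 ≤ s ∧ s < t ∧ HasHEigenvalue r σ π Ω s t η ∧
        ∀ u : ℂ, s < ‖q ^ (2 * u)‖ → ‖q ^ (2 * u)‖ < t → η u * P u = c * P (u + 1)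

end Predicates

/-- The infinite product `(z; p)_∞`. -/
def qPochhammer (z p : ℂ) : ℂ := ∏' n : ℕ, (1 - z * p ^ n)

/-- `Θ_p(z) = (z; p)_∞ (p/z; p)_∞ (p; p)_∞`. -/
def bigTheta (p z : ℂ) : ℂ := qPochhammer z p * qPochhammer (p / z) p * qPochhammer p p

/-- The theta function `[u] = q^(u²/r - u) Θ_p(q^(2u)) / (p; p)_∞³`, with `p = q^(2r)`. -/
def theta (q r u : ℂ) : ℂ :=
  q ^ (u ^ 2 / r - u) / qPochhammer (q ^ (2 * r)) (q ^ (2 * r)) ^ 3 *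
    bigTheta (q ^ (2 * r)) (q ^ (2 * u))

end

end EllipticSl2

/-! Existence is a computation on the vector `v_0`. There the eigenvalue of `n a_n` is, up to fixed
powers, a difference `q^(ln) - q^(-ln)`, and in `H^±(u)` the factor `q^n + q^(-n)` coming from the
two shifts by `±1/2` cancels `[2n]_q / [n]_q`. What remains is divided by `[rn]_q`, that is,
essentially by `1 - p^n`. Each of the two series of `H^±(u)` is therefore the exponential of `∑ (B^n
- A^n) X^n / (n (1 - p^n))`. It solves the first order `q`-difference equation `(1 - B X) e(X) = (1
- A X) e(pX)`, so it converges for `|Bz| < 1` to `(Az; p)_∞ / (Bz; p)_∞` (`summable_qDifference`,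
`hasSum_qDifference`). For the creation and annihilation series the two numbers `B` multiply to `p`,
so `|p| < 1` gives a common annulus. The four products combine into a quotient of two theta
functions, `c [u-v+(l+1)/2] / [u-v-(l-1)/2]`, for both signs (`IsTopVector.eigenvalue_mul_theta`),
and this is the telescoped quotient `c P(u+1)/P(u)` of the string `P` of `l` theta functions.

For uniqueness, any pseudo-highest weight vector is `f ⊗ v_0`, because `x^+_0` is injective on the
span of the other basis vectors; hence the eigenvalue does not depend on the choice
(`isTopVector_of_isPseudoHighestWeightVector`). A second Drinfeld polynomial `f` with the same
constant then satisfies `f(u) P(u+1) = f(u+1) P(u)`, at first on a strip and by the identity theorem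
everywhere. So the difference of the divisors of `f` and `P` is invariant under `u ↦ u + 1`. Modulo
the period lattice both divisors are finite, whereas translation by `1` has infinite order there by
genericity; the difference is zero (`ncard_eq_of_shift`).

Thus `f = G P` with `G` entire, nowhere zero, of period `1`, and multiplied by a sign under `r` and
by an exponential of a linear function under `rτ`. The derivative of `G'/G` is doubly periodic and
entire, hence constant; period `1` makes `G'/G` itself constant, so `G` is an exponential `G(0)
e^(λu)`. Its behaviour under `1` and `r`, with genericity once more, forces `λ = 0`
(`eq_of_quasiPeriodic`). -/

namespace EllipticSl2

noncomputable section

/-! ### Formal exponentials and first order `q`-difference equations. -/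

section FormalExponential

open Filter Topology

theorem coeff_pow_eq_zero {L : PowerSeries ℂ} (hL : PowerSeries.constantCoeff L = 0) {n k : ℕ}
    (hk : n < k) : PowerSeries.coeff n (L ^ k) = 0 :=
  PowerSeries.coeff_of_lt_order _ (lt_of_lt_of_le (by exact_mod_cast hk)
    (PowerSeries.le_order_pow_of_constantCoeff_eq_zero k hL))

theorem constantCoeff_expSeries (L : PowerSeries ℂ) :
    PowerSeries.constantCoeff (expSeries L) = 1 := by
  rw [← PowerSeries.coeff_zero_eq_constantCoeff_apply]
  simp [expSeries]

/-- Up to a given degree `expSeries L` is a finite partial sum of `∑ L^k / k!`, since `L^k` starts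
in degree `k`; differentiating the partial sum shifts it by one term. -/
theorem derivative_expSeries {L : PowerSeries ℂ} (hL : PowerSeries.constantCoeff L = 0) :
    PowerSeries.derivative ℂ (expSeries L) = PowerSeries.derivative ℂ L * expSeries L := by
  have hcoef : ∀ n N : ℕ, n ≤ N → PowerSeries.coeff n (expSeries L) =
      PowerSeries.coeff n (∑ k ∈ Finset.range (N + 1), ((k.factorial : ℂ)⁻¹) • L ^ k) := by
    intro n N hn
    rw [expSeries, PowerSeries.coeff_mk, map_sum]
    refine Finset.sum_subset (fun k hk => ?_) (fun k _ hk => ?_)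
    · simp only [Finset.mem_range] at *; omega
    · simp only [Finset.mem_range] at *
      simp [coeff_pow_eq_zero hL (show n < k by omega)]
  ext n
  rw [PowerSeries.coeff_derivative, hcoef (n + 1) (n + 1) le_rfl, ← PowerSeries.coeff_derivative]
  have h1 : PowerSeries.coeff n (PowerSeries.derivative ℂ L * expSeries L) =
      PowerSeries.coeff n (PowerSeries.derivative ℂ L *
        ∑ k ∈ Finset.range (n + 1), ((k.factorial : ℂ)⁻¹) • L ^ k) := by
    rw [PowerSeries.coeff_mul, PowerSeries.coeff_mul]
    refine Finset.sum_congr rfl fun p hp => ?_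
    have hp' : p.1 + p.2 = n := by simpa using hp
    rw [hcoef p.2 n (by omega)]
  rw [h1, Finset.sum_range_succ', map_add, Finset.mul_sum]
  have h0 : PowerSeries.derivative ℂ (((Nat.factorial 0 : ℕ) : ℂ)⁻¹ • L ^ 0) = 0 := by simp
  rw [h0, add_zero, map_sum]
  congr 1
  refine Finset.sum_congr rfl fun k _ => ?_
  rw [Derivation.map_smul, PowerSeries.derivative_pow, Nat.add_sub_cancel, Nat.factorial_succ]
  simp only [PowerSeries.smul_eq_C_mul]
  have : (PowerSeries.C (((k + 1) * k.factorial : ℕ) : ℂ)⁻¹ : PowerSeries ℂ) *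
      ((k + 1 : ℕ) : PowerSeries ℂ) = PowerSeries.C ((k.factorial : ℂ)⁻¹) := by
    rw [← map_natCast (PowerSeries.C (R := ℂ)), ← map_mul]
    congr 1
    have := Nat.factorial_ne_zero k
    push_cast
    have h2 : ((k : ℂ) + 1) ≠ 0 := by exact_mod_cast Nat.succ_ne_zero k
    field_simp
  rw [← mul_assoc, ← mul_assoc, this]; ring

/-- The quotient of two solutions of `F' = L' F` has derivative zero, so the equation and the
constant term determine the solution. This gives the addition formula without comparing
coefficients. -/
theorem eq_expSeries {L F : PowerSeries ℂ} (hL : PowerSeries.constantCoeff L = 0)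
    (hF : PowerSeries.constantCoeff F = 1)
    (hd : PowerSeries.derivative ℂ F = PowerSeries.derivative ℂ L * F) : F = expSeries L := by
  have hE := constantCoeff_expSeries L
  have hE' := derivative_expSeries hL
  set E := expSeries L
  have hinv : E * E⁻¹ = 1 := PowerSeries.mul_inv_cancel E (by rw [hE]; exact one_ne_zero)
  have hone : F * E⁻¹ = 1 := by
    apply PowerSeries.derivative.ext
    · rw [Derivation.leibniz (PowerSeries.derivative ℂ) F E⁻¹, PowerSeries.derivative_inv', hE', hd]
      simp only [smul_eq_mul, Derivation.map_one_eq_zero]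
      linear_combination (-F * E⁻¹ * PowerSeries.derivative ℂ L) * hinv
    · simp [hE, hF]
  calc F = F * E⁻¹ * E := by rw [mul_assoc, mul_comm E⁻¹, hinv, mul_one]
    _ = E := by rw [hone, one_mul]

theorem expSeries_add {L M : PowerSeries ℂ} (hL : PowerSeries.constantCoeff L = 0)
    (hM : PowerSeries.constantCoeff M = 0) :
    expSeries (L + M) = expSeries L * expSeries M := by
  refine (eq_expSeries (by simp [hL, hM]) (by simp [constantCoeff_expSeries]) ?_).symm
  rw [Derivation.leibniz (PowerSeries.derivative ℂ) (expSeries L), derivative_expSeries hL,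
    derivative_expSeries hM, map_add]
  simp only [smul_eq_mul]
  ring

theorem expSeries_rescale (s : ℂ) (L : PowerSeries ℂ) :
    expSeries (PowerSeries.rescale s L) = PowerSeries.rescale s (expSeries L) := by
  ext n
  simp only [expSeries, PowerSeries.coeff_mk, PowerSeries.coeff_rescale, ← map_pow, Finset.mul_sum,
    smul_eq_mul]
  exact Finset.sum_congr rfl fun k _ => by ring

theorem constantCoeff_modeSeries (c b : ℕ → ℂ) :
    PowerSeries.constantCoeff (modeSeries c b) = 0 := by
  rw [← PowerSeries.coeff_zero_eq_constantCoeff_apply]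
  simp [modeSeries]

/-- If `n g_n (1 - p^n) = B^n - A^n`, then `e(X) = exp (∑ g_n X^n)` satisfies
`(1 - B X) e(X) = (1 - A X) e(p X)`. -/
theorem expSeries_qDifference {p A B : ℂ} (g : ℕ → ℂ)
    (hg : ∀ n : ℕ, n ≠ 0 → n * g n * (1 - p ^ n) = B ^ n - A ^ n) :
    expSeries (modeSeries g fun _ => (1 : ℂ)) * (1 - PowerSeries.C B * PowerSeries.X) =
      PowerSeries.rescale p (expSeries (modeSeries g fun _ => (1 : ℂ))) *
        (1 - PowerSeries.C A * PowerSeries.X) := by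
  -- The exponential of `∑ (B^n - A^n) X^n / n` is `(1 - A X)/(1 - B X)`; the lemma is stated for
  -- two pairs of parameters, and the second pair is taken to be `0, 0`.
  have h1 := expSeries_rational (fun n => g n * (1 - p ^ n)) (fun _ => (1 : ℂ)) B 0 A 0 (by
    intro n hn
    linear_combination hg n hn)
  -- Splitting `g_n = p^n g_n + g_n (1 - p^n)` turns the exponential into `e(pX)` times this
  -- rational factor.
  have h2 : modeSeries g (fun _ => (1 : ℂ)) =
      PowerSeries.rescale p (modeSeries g fun _ => (1 : ℂ)) +
        modeSeries (fun n => g n * (1 - p ^ n)) fun _ => (1 : ℂ) := by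
    ext n
    simp only [modeSeries, map_add, PowerSeries.coeff_rescale, PowerSeries.coeff_mk, smul_eq_mul]
    split_ifs <;> ring
  simp only [map_zero, zero_mul, sub_zero, mul_one] at h1
  rw [← h1, ← mul_assoc, ← expSeries_rescale, ← expSeries_add _ (constantCoeff_modeSeries _ _),
    ← h2]
  rw [← PowerSeries.coeff_zero_eq_constantCoeff_apply]
  simp [modeSeries]

theorem coeff_succ_qDifference {p A B : ℂ} {e : PowerSeries ℂ}
    (he : e * (1 - PowerSeries.C B * PowerSeries.X) =
      PowerSeries.rescale p e * (1 - PowerSeries.C A * PowerSeries.X)) (n : ℕ) :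
    PowerSeries.coeff (n + 1) e * (1 - p ^ (n + 1)) =
      (B - A * p ^ n) * PowerSeries.coeff n e := by
  have h := congrArg (PowerSeries.coeff (n + 1)) he
  simp only [mul_sub, mul_one, map_sub, ← mul_assoc, PowerSeries.coeff_succ_mul_X,
    PowerSeries.coeff_rescale, PowerSeries.coeff_mul_C] at h
  linear_combination h

/-- A solution of the `q`-difference equation converges for `|B z| < 1`. -/
theorem summable_qDifference {p A B z : ℂ} (hp : ‖p‖ < 1) {e : PowerSeries ℂ}
    (he : e * (1 - PowerSeries.C B * PowerSeries.X) =
      PowerSeries.rescale p e * (1 - PowerSeries.C A * PowerSeries.X)) (hz : ‖B * z‖ < 1) :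
    Summable fun n => PowerSeries.coeff n e * z ^ n := by
  obtain ⟨ρ, hρ, hρ1⟩ := exists_between hz
  have hne : ∀ n : ℕ, 1 - p ^ (n + 1) ≠ 0 := fun n h => by
    have : ‖p ^ (n + 1)‖ < 1 := by
      rw [norm_pow]; exact pow_lt_one₀ (norm_nonneg _) hp (Nat.succ_ne_zero n)
    rw [← sub_eq_zero.1 h, norm_one] at this
    exact lt_irrefl _ this
  -- Ratio test: the recursion for the coefficients makes this the quotient of consecutive terms,
  -- with limit `B z`.
  have hlim : Tendsto (fun n : ℕ => (B - A * p ^ n) * z / (1 - p ^ (n + 1))) atTop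
      (𝓝 ((B - A * 0) * z / (1 - 0))) := by
    have h0 := tendsto_pow_atTop_nhds_zero_of_norm_lt_one hp
    exact ((tendsto_const_nhds.sub (h0.const_mul A)).mul_const z).div
      (tendsto_const_nhds.sub (h0.comp (tendsto_add_atTop_nat 1))) (by simp)
  simp only [mul_zero, sub_zero, div_one] at hlim
  refine summable_of_ratio_norm_eventually_le hρ1 ?_
  filter_upwards [hlim.norm.eventually_lt_const hρ] with n hn
  have h := coeff_succ_qDifference he n
  have h' : PowerSeries.coeff (n + 1) e * z ^ (n + 1) =
      (B - A * p ^ n) * z / (1 - p ^ (n + 1)) * (PowerSeries.coeff n e * z ^ n) := by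
    have := hne n
    field_simp
    rw [pow_succ]
    linear_combination z ^ n * z * h
  rw [h', norm_mul]
  exact mul_le_mul_of_nonneg_right hn.le (norm_nonneg _)

end FormalExponential

/-! ### Infinite products and the summation of solutions of the `q`-difference equation. -/

section Pochhammer

open Filter Topology

variable {p z : ℂ}

theorem summable_norm_mul_pow (hp : ‖p‖ < 1) (z : ℂ) : Summable fun n : ℕ => ‖-(z * p ^ n)‖ := by
  simp only [norm_neg, norm_mul, norm_pow]
  exact (summable_geometric_of_lt_one (norm_nonneg _) hp).mul_left _

theorem multipliable_qPochhammer (hp : ‖p‖ < 1) (z : ℂ) :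
    Multipliable fun n : ℕ => 1 - z * p ^ n := by
  simpa only [sub_eq_add_neg] using multipliable_one_add_of_summable (summable_norm_mul_pow hp z)

theorem qPochhammer_eq_mul (hp : ‖p‖ < 1) (z : ℂ) :
    qPochhammer z p = (1 - z) * qPochhammer (z * p) p := by
  have h := multipliable_qPochhammer hp (z * p)
  have e : (fun k : ℕ => 1 - z * p * p ^ k) = fun k : ℕ => 1 - z * p ^ (k + 1) := by
    funext k; rw [pow_succ]; ring
  rw [e] at h
  rw [qPochhammer, qPochhammer, e, tprod_eq_zero_mul' (f := fun k : ℕ => 1 - z * p ^ k) h,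
    pow_zero, mul_one]

theorem qPochhammer_ne_zero (hp : ‖p‖ < 1) (hz : ∀ n : ℕ, z * p ^ n ≠ 1) :
    qPochhammer z p ≠ 0 := by
  have := tprod_one_add_ne_zero_of_summable (f := fun n : ℕ => -(z * p ^ n))
    (fun n => by rw [← sub_eq_add_neg]; exact sub_ne_zero.2 (hz n).symm) (summable_norm_mul_pow hp z)
  simp only [← sub_eq_add_neg] at this
  exact this

theorem qPochhammer_ne_zero_of_norm_lt_one (hp : ‖p‖ < 1) (hz : ‖z‖ < 1) :
    qPochhammer z p ≠ 0 := by
  refine qPochhammer_ne_zero hp fun n h => ?_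
  have h1 : ‖z‖ * ‖p‖ ^ n = 1 := by rw [← norm_pow, ← norm_mul, h, norm_one]
  exact (mul_lt_one_of_nonneg_of_lt_one_left (norm_nonneg _) hz
    (pow_le_one₀ (norm_nonneg _) hp.le)).ne h1

theorem qPochhammer_self_ne_zero (hp : ‖p‖ < 1) : qPochhammer p p ≠ 0 :=
  qPochhammer_ne_zero_of_norm_lt_one hp hp

/-- On a ball of radius `R` the factors differ from `1` by at most `R |p|^n`, so the product
converges locally uniformly there and its limit is holomorphic. -/
theorem differentiable_qPochhammer (hp : ‖p‖ < 1) : Differentiable ℂ fun z => qPochhammer z p := by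
  intro z
  set R := ‖z‖ + 1
  have hu : Summable fun n : ℕ => R * ‖p‖ ^ n :=
    (summable_geometric_of_lt_one (norm_nonneg _) hp).mul_left _
  have h := Summable.hasProdLocallyUniformlyOn_nat_one_add (f := fun (n : ℕ) (x : ℂ) => -(x * p ^ n))
    (Metric.isOpen_ball (x := (0 : ℂ)) (ε := R)) hu (Eventually.of_forall fun n x hx => by
      rw [norm_neg, norm_mul, norm_pow]
      exact mul_le_mul_of_nonneg_right (by simpa using (mem_ball_zero_iff.1 hx).le) (by positivity))
    (fun n => by fun_prop)
  have hd := h.differentiableOn (.of_forall fun s => by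
    simpa [Finset.prod_fn] using DifferentiableOn.finsetProd (fun _ _ ↦ by fun_prop))
    Metric.isOpen_ball
  have := hd.differentiableAt (Metric.isOpen_ball.mem_nhds (x := z) (by simp [R]))
  simp only [← sub_eq_add_neg] at this
  exact this

theorem tendsto_qPochhammer_mul_pow (hp : ‖p‖ < 1) (z : ℂ) :
    Tendsto (fun n : ℕ => ∏ k ∈ Finset.range n, (1 - z * p ^ k)) atTop (𝓝 (qPochhammer z p)) :=
  (multipliable_qPochhammer hp z).hasProd.tendsto_prod_nat

/-- The sum of a solution of the `q`-difference equation is `(A z; p)_∞ / (B z; p)_∞`. -/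
theorem hasSum_qDifference {A B S : ℂ} (hp : ‖p‖ < 1) {e : PowerSeries ℂ}
    (he0 : PowerSeries.constantCoeff e = 1)
    (he : e * (1 - PowerSeries.C B * PowerSeries.X) =
      PowerSeries.rescale p e * (1 - PowerSeries.C A * PowerSeries.X))
    (hS : HasSum (fun n => PowerSeries.coeff n e * z ^ n) S) :
    S * qPochhammer (B * z) p = qPochhammer (A * z) p := by
  have hsum : Summable fun n => ‖PowerSeries.coeff n e * z ^ n‖ := hS.summable.norm
  have hle : ∀ t : ℂ, ‖t‖ ≤ 1 → ∀ n, ‖PowerSeries.coeff n e * (z * t) ^ n‖ ≤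
      ‖PowerSeries.coeff n e * z ^ n‖ := by
    intro t ht n
    rw [mul_pow, ← mul_assoc, norm_mul _ (t ^ n), norm_pow]
    exact mul_le_of_le_one_right (norm_nonneg _) (pow_le_one₀ (norm_nonneg _) ht)
  have hsm : ∀ t : ℂ, ‖t‖ ≤ 1 → Summable fun n => PowerSeries.coeff n e * (z * t) ^ n :=
    fun t ht => Summable.of_norm_bounded hsum (hle t ht)
  -- The sum at the point `z t`. Since `|t| ≤ 1` is preserved by `t ↦ t p`, the functional equation
  -- can be iterated from `t = 1` down to `t = p^n → 0`, where `F` tends to the constant term `1`.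
  set F : ℂ → ℂ := fun t => ∑' n, PowerSeries.coeff n e * (z * t) ^ n with hF
  have hF1 : F 1 = S := by simp only [hF, mul_one]; exact hS.tsum_eq
  have hstep : ∀ t : ℂ, ‖t‖ ≤ 1 →
      F t * (1 - B * z * t) = (1 - A * z * t) * F (t * p) := by
    intro t ht
    have ht' : ‖t * p‖ ≤ 1 := by
      rw [norm_mul]; exact mul_le_one₀ ht (norm_nonneg _) hp.le
    have s1 := hsm t ht
    have s2 := hsm (t * p) ht'
    have e1 : F t = 1 + ∑' n, PowerSeries.coeff (n + 1) e * (z * t) ^ (n + 1) := by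
      simp only [hF]
      rw [s1.tsum_eq_zero_add]
      simp [he0]
    have e2 : F (t * p) = 1 + ∑' n, PowerSeries.coeff (n + 1) e * (z * (t * p)) ^ (n + 1) := by
      simp only [hF]
      rw [s2.tsum_eq_zero_add]
      simp [he0]
    have s1' := (summable_nat_add_iff 1).2 s1
    have s2' := (summable_nat_add_iff 1).2 s2
    have e3 : (∑' n, PowerSeries.coeff (n + 1) e * (z * t) ^ (n + 1)) -
        ∑' n, PowerSeries.coeff (n + 1) e * (z * (t * p)) ^ (n + 1) =
        B * z * t * F t - A * z * t * F (t * p) := by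
      rw [← s1'.tsum_sub s2']
      simp only [hF]
      rw [← tsum_mul_left, ← tsum_mul_left, ← (s1.mul_left _).tsum_sub (s2.mul_left _)]
      refine tsum_congr fun n => ?_
      have h := coeff_succ_qDifference he n
      simp only [mul_pow, pow_succ] at h ⊢
      linear_combination (z * t * z ^ n * t ^ n) * h
    linear_combination e1 - e2 + e3
  have hiter : ∀ n : ℕ, S * ∏ k ∈ Finset.range n, (1 - B * z * p ^ k) =
      (∏ k ∈ Finset.range n, (1 - A * z * p ^ k)) * F (p ^ n) := by
    intro n
    induction n with
    | zero => simp [hF1]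
    | succ n ih =>
      rw [Finset.prod_range_succ, Finset.prod_range_succ, ← mul_assoc, ih, mul_assoc _ (F _),
        hstep _ (by rw [norm_pow]; exact pow_le_one₀ (norm_nonneg _) hp.le), pow_succ]
      ring
  have hlim : Tendsto (fun n : ℕ => F (p ^ n)) atTop (𝓝 1) := by
    have h0 := tendsto_pow_atTop_nhds_zero_of_norm_lt_one hp
    have := tendsto_tsum_of_dominated_convergence (𝓕 := atTop)
      (f := fun (k : ℕ) n => PowerSeries.coeff n e * (z * p ^ k) ^ n)
      (g := fun n => PowerSeries.coeff n e * (z * 0) ^ n) hsum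
      (fun n => ((h0.const_mul z).pow n).const_mul _)
      (Eventually.of_forall fun k n =>
        hle _ (by rw [norm_pow]; exact pow_le_one₀ (norm_nonneg _) hp.le) n)
    refine (this.congr fun _ => rfl).trans (le_of_eq ?_)
    -- The limit series is the one at `z * 0`, in which only the term `n = 0` survives because `0 ^
    -- 0 = 1`.
    rw [tsum_eq_single 0 (fun n hn => by simp [hn])]
    simp [he0]
  have l1 := (tendsto_qPochhammer_mul_pow hp (B * z)).const_mul S
  have l2 := (tendsto_qPochhammer_mul_pow hp (A * z)).mul hlim
  rw [mul_one] at l2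
  exact tendsto_nhds_unique l1 (l2.congr fun n => (hiter n).symm)

end Pochhammer

/-! ### Theta functions: multipliers and divisor. -/

section ThetaFunction

variable {p z : ℂ}

theorem bigTheta_mul_left (hp : ‖p‖ < 1) (hz : z ≠ 0) (hp0 : p ≠ 0) :
    bigTheta p (p * z) = -z⁻¹ * bigTheta p z := by
  rw [bigTheta, bigTheta, qPochhammer_eq_mul hp z, show p / (p * z) = z⁻¹ by field_simp,
    qPochhammer_eq_mul hp z⁻¹, mul_comm z p, show z⁻¹ * p = p / z by ring]
  field_simp
  ring

theorem bigTheta_inv (hp : ‖p‖ < 1) (hz : z ≠ 0) : bigTheta p z⁻¹ = -z⁻¹ * bigTheta p z := by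
  rw [bigTheta, bigTheta, qPochhammer_eq_mul hp z, qPochhammer_eq_mul hp z⁻¹, div_inv_eq_mul,
    mul_comm z p, show z⁻¹ * p = p / z by ring]
  field_simp
  ring

/-- A convergent product `(z; p)_∞` vanishes only if one of its factors does: factors of `(z; p)_∞`
give the powers `p^(-n)`, those of `(p/z; p)_∞` the powers `p^(n+1)`. -/
theorem exists_zpow_of_bigTheta_eq_zero (hp : ‖p‖ < 1) (hp0 : p ≠ 0) (hz : z ≠ 0)
    (h : bigTheta p z = 0) : ∃ n : ℤ, z = p ^ n := by
  by_contra! hne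
  refine mul_ne_zero (mul_ne_zero ?_ ?_) (qPochhammer_self_ne_zero hp) h
  · refine qPochhammer_ne_zero hp fun n hn => hne (-(n : ℤ)) ?_
    rw [zpow_neg, zpow_natCast]
    exact eq_inv_of_mul_eq_one_left hn
  · refine qPochhammer_ne_zero hp fun n hn => hne ((n : ℤ) + 1) ?_
    rw [zpow_add₀ hp0, zpow_natCast, zpow_one]
    field_simp at hn
    rw [← hn]
    ring

variable {q r : ℂ}

theorem log_ne_zero (hq0 : q ≠ 0) (hq1 : ‖q‖ < 1) : Complex.log q ≠ 0 := by
  intro h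
  have := Complex.exp_log hq0
  rw [h, Complex.exp_zero] at this
  rw [← this, norm_one] at hq1
  exact lt_irrefl _ hq1

theorem ne_zero_of_norm_cpow_lt_one (hp : ‖q ^ (2 * r)‖ < 1) : r ≠ 0 := by
  rintro rfl
  simp at hp

theorem cpow_ne_zero (hq0 : q ≠ 0) (x : ℂ) : q ^ x ≠ 0 := by
  simp [Complex.cpow_eq_zero_iff, hq0]

theorem log_mul_tau (hq0 : q ≠ 0) (hq1 : ‖q‖ < 1) (hr : r ≠ 0) :
    Complex.log q * (r * tau q r) = -(Real.pi * Complex.I) := by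
  have := log_ne_zero hq0 hq1
  rw [tau]
  field_simp

theorem differentiable_cpow_comp (hq0 : q ≠ 0) {g : ℂ → ℂ} (hg : Differentiable ℂ g) :
    Differentiable ℂ fun u => q ^ g u := by
  simp only [Complex.cpow_def_of_ne_zero hq0]
  fun_prop

theorem differentiable_theta (hq0 : q ≠ 0) (hp : ‖q ^ (2 * r)‖ < 1) :
    Differentiable ℂ (theta q r) := by
  have h1 : Differentiable ℂ fun u : ℂ => q ^ (u ^ 2 / r - u) :=
    differentiable_cpow_comp hq0 (by fun_prop)
  have h2 : Differentiable ℂ fun u : ℂ => q ^ (2 * u) :=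
    differentiable_cpow_comp hq0 (by fun_prop)
  have h3 : Differentiable ℂ fun u : ℂ => q ^ (2 * r) / q ^ (2 * u) :=
    fun u => (differentiableAt_const _).div (h2 u) (cpow_ne_zero hq0 _)
  have hP := differentiable_qPochhammer hp
  unfold theta bigTheta
  exact (h1.div_const _).mul (((hP.comp h2).mul (hP.comp h3)).mul_const _)

/-- The quadratic prefactor contributes `z = q^(2u)` and `Θ_p(pz)` contributes `-z⁻¹`. -/
theorem theta_add_self (hq0 : q ≠ 0) (hp : ‖q ^ (2 * r)‖ < 1) (u : ℂ) :
    theta q r (u + r) = -theta q r u := by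
  have hr := ne_zero_of_norm_cpow_lt_one hp
  have h1 : q ^ (2 * (u + r)) = q ^ (2 * r) * q ^ (2 * u) := by
    rw [← Complex.cpow_add _ _ hq0]; congr 1; ring
  have h2 : q ^ ((u + r) ^ 2 / r - (u + r)) = q ^ (u ^ 2 / r - u) * q ^ (2 * u) := by
    rw [← Complex.cpow_add _ _ hq0]; congr 1; field_simp; ring
  have h3 := cpow_ne_zero hq0 (2 * u)
  rw [theta, theta, h1, h2, bigTheta_mul_left hp h3 (cpow_ne_zero hq0 _)]
  generalize q ^ (2 * u) = z at *
  field_simp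

theorem cpow_two_mul_add_tau (hq0 : q ≠ 0) (hq1 : ‖q‖ < 1) (hr : r ≠ 0) (u : ℂ) :
    q ^ (2 * (u + r * tau q r)) = q ^ (2 * u) := by
  rw [Complex.cpow_def_of_ne_zero hq0, Complex.cpow_def_of_ne_zero hq0, Complex.exp_eq_exp_iff_exists_int]
  refine ⟨-1, ?_⟩
  push_cast
  linear_combination 2 * log_mul_tau hq0 hq1 hr

/-- The shift by `rτ` adds `-2πi` to `2u log q` and so does not change `z = q^(2u)`; the whole
multiplier comes from the quadratic prefactor. -/
theorem theta_add_tau (hq0 : q ≠ 0) (hq1 : ‖q‖ < 1) (hp : ‖q ^ (2 * r)‖ < 1) (u : ℂ) :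
    theta q r (u + r * tau q r) =
      -Complex.exp (-(Real.pi * Complex.I) * (2 * u / r + tau q r)) * theta q r u := by
  have hr := ne_zero_of_norm_cpow_lt_one hp
  have h2 : q ^ ((u + r * tau q r) ^ 2 / r - (u + r * tau q r)) =
      q ^ (u ^ 2 / r - u) * -Complex.exp (-(Real.pi * Complex.I) * (2 * u / r + tau q r)) := by
    rw [← neg_one_mul, ← Complex.exp_pi_mul_I, Complex.cpow_def_of_ne_zero hq0,
      Complex.cpow_def_of_ne_zero hq0, ← Complex.exp_add, ← Complex.exp_add]
    congr 1
    have h := log_mul_tau hq0 hq1 hr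
    field_simp
    linear_combination (2 * u + r * tau q r - r) * h
  rw [theta, theta, cpow_two_mul_add_tau hq0 hq1 hr, h2]
  ring

/-- In the annulus `|p| < |z| < 1`, with `z = q^(2u)`, no factor of the products vanishes. -/
theorem theta_ne_zero (hq0 : q ≠ 0) (hp : ‖q ^ (2 * r)‖ < 1) {u : ℂ} (h1 : ‖q ^ (2 * u)‖ < 1)
    (h2 : ‖q ^ (2 * r - 2 * u)‖ < 1) : theta q r u ≠ 0 := by
  have h0 := qPochhammer_self_ne_zero hp
  rw [theta, bigTheta, ← Complex.cpow_sub _ _ hq0]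
  exact mul_ne_zero (div_ne_zero (cpow_ne_zero hq0 _) (pow_ne_zero _ h0))
    (mul_ne_zero (mul_ne_zero (qPochhammer_ne_zero_of_norm_lt_one hp h1)
      (qPochhammer_ne_zero_of_norm_lt_one hp h2)) h0)

/-- The period lattice `r ℤ + r τ ℤ`. -/
def IsPeriod (q r x : ℂ) : Prop := ∃ m n : ℤ, x = m * r + n * (r * tau q r)

theorem isPeriod_of_theta_eq_zero (hq0 : q ≠ 0) (hq1 : ‖q‖ < 1) (hp : ‖q ^ (2 * r)‖ < 1) {u : ℂ}
    (h : theta q r u = 0) : IsPeriod q r u := by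
  have hr := ne_zero_of_norm_cpow_lt_one hp
  have h0 : bigTheta (q ^ (2 * r)) (q ^ (2 * u)) = 0 := by
    rw [theta] at h
    refine (mul_eq_zero.1 h).resolve_left (div_ne_zero (cpow_ne_zero hq0 _) ?_)
    exact pow_ne_zero _ (qPochhammer_self_ne_zero hp)
  obtain ⟨n, hn⟩ :=
    exists_zpow_of_bigTheta_eq_zero hp (cpow_ne_zero hq0 _) (cpow_ne_zero hq0 _) h0
  rw [Complex.cpow_def_of_ne_zero hq0, Complex.cpow_def_of_ne_zero hq0, ← Complex.exp_int_mul,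
    Complex.exp_eq_exp_iff_exists_int] at hn
  obtain ⟨k, hk⟩ := hn
  refine ⟨n, -k, ?_⟩
  have hl := log_ne_zero hq0 hq1
  refine mul_left_cancel₀ hl ?_
  push_cast
  linear_combination (1 / 2 : ℂ) * hk + k * log_mul_tau hq0 hq1 hr

theorem analyticOrderAt_comp_add (f : ℂ → ℂ) (a u : ℂ) :
    analyticOrderAt (fun x => f (x + a)) u = analyticOrderAt f (u + a) := by
  have hd : HasDerivAt (fun x : ℂ => x + a) 1 u := (hasDerivAt_id u).add_const a
  exact analyticOrderAt_comp_of_deriv_ne_zero (f := f) (g := fun x : ℂ => x + a)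
    (by fun_prop) (by rw [hd.deriv]; exact one_ne_zero)

theorem analyticOrderAt_eq_zero_of_ne {f : ℂ → ℂ} {u : ℂ} (h : f u ≠ 0) :
    analyticOrderAt f u = 0 := by
  rw [analyticOrderAt_eq_zero]; exact Or.inr h

/-- A nowhere vanishing multiplier does not change orders, so the divisor of a quasi-periodic
function is periodic. -/
theorem periodic_analyticOrderAt {f h : ℂ → ℂ} {a : ℂ} (hf : Differentiable ℂ f)
    (hh : Differentiable ℂ h) (h0 : ∀ u, h u ≠ 0) (hfa : ∀ u, f (u + a) = h u * f u) :
    Function.Periodic (analyticOrderAt f) a := by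
  intro u
  rw [← analyticOrderAt_comp_add, show (fun x => f (x + a)) = h * f from funext hfa,
    analyticOrderAt_mul (hh.analyticAt u) (hf.analyticAt u), analyticOrderAt_eq_zero_of_ne (h0 u),
    zero_add]

theorem analyticOrderAt_theta_zero (hq0 : q ≠ 0) (hq1 : ‖q‖ < 1) (hp : ‖q ^ (2 * r)‖ < 1) :
    analyticOrderAt (theta q r) 0 = 1 := by
  have hP := differentiable_qPochhammer hp
  have h1 : Differentiable ℂ fun u : ℂ => q ^ (u ^ 2 / r - u) :=
    differentiable_cpow_comp hq0 (by fun_prop)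
  have h2 : Differentiable ℂ fun u : ℂ => q ^ (2 * u) :=
    differentiable_cpow_comp hq0 (by fun_prop)
  have h3 : Differentiable ℂ fun u : ℂ => q ^ (2 * r) / q ^ (2 * u) :=
    fun u => (differentiableAt_const _).div (h2 u) (cpow_ne_zero hq0 _)
  set p := q ^ (2 * r)
  -- Splitting the first factor `1 - z` off `(z; p)_∞` isolates the simple zero at `u = 0`; the
  -- cofactor `E` equals `(p; p)_∞³ / (p; p)_∞³ = 1` there.
  let E : ℂ → ℂ := fun u => q ^ (u ^ 2 / r - u) / qPochhammer p p ^ 3 *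
    (qPochhammer (q ^ (2 * u) * p) p * qPochhammer (p / q ^ (2 * u)) p * qPochhammer p p)
  have hE : Differentiable ℂ E :=
    (h1.div_const _).mul (((hP.comp (h2.mul_const p)).mul (hP.comp h3)).mul_const _)
  have hE0 : E 0 ≠ 0 := by
    have := qPochhammer_self_ne_zero hp
    simp [E, this]
  let F : ℂ → ℂ := fun u => 1 - q ^ (2 * u)
  have hF : Differentiable ℂ F := h2.const_sub 1
  have e : theta q r = F * E := by
    funext u
    rw [theta, bigTheta, qPochhammer_eq_mul hp (q ^ (2 * u))]
    simp only [Pi.mul_apply, F, E]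
    ring
  have hd : HasDerivAt F (-(Complex.log q * 2)) 0 := by
    have hid : HasDerivAt (fun u : ℂ => Complex.log q * (2 * u)) (Complex.log q * 2) 0 := by
      simpa using ((hasDerivAt_id (0 : ℂ)).const_mul 2).const_mul (Complex.log q)
    have := (hid.cexp).const_sub 1
    simp only [F, Complex.cpow_def_of_ne_zero hq0]
    simpa using this
  rw [e, analyticOrderAt_mul (hF.analyticAt 0) (hE.analyticAt 0),
    analyticOrderAt_eq_zero_of_ne hE0, add_zero]
  refine (hF.analyticAt 0).analyticOrderAt_eq_one_of_zero_deriv_ne_zero (by simp [F]) ?_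
  rw [hd.deriv]
  simp [log_ne_zero hq0 hq1]

open Classical in
theorem analyticOrderAt_theta (hq0 : q ≠ 0) (hq1 : ‖q‖ < 1) (hp : ‖q ^ (2 * r)‖ < 1) (u : ℂ) :
    analyticOrderAt (theta q r) u = if IsPeriod q r u then 1 else 0 := by
  have hd := differentiable_theta hq0 hp
  have p1 : Function.Periodic (analyticOrderAt (theta q r)) r :=
    periodic_analyticOrderAt (h := fun _ => -1) hd (by fun_prop) (by simp)
      (fun u => by rw [theta_add_self hq0 hp]; ring)
  have p2 : Function.Periodic (analyticOrderAt (theta q r)) (r * tau q r) :=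
    periodic_analyticOrderAt
      (h := fun u => -Complex.exp (-(Real.pi * Complex.I) * (2 * u / r + tau q r))) hd
      (by fun_prop) (by simp) (theta_add_tau hq0 hq1 hp)
  split_ifs with h
  · obtain ⟨m, n, rfl⟩ := h
    rw [(p2.int_mul n) _, ← zero_add ((m : ℂ) * r), (p1.int_mul m) _,
      analyticOrderAt_theta_zero hq0 hq1 hp]
  · exact analyticOrderAt_eq_zero_of_ne fun h0 => h (isPeriod_of_theta_eq_zero hq0 hq1 hp h0)

theorem analyticOrderAt_finset_prod {ι : Type*} (s : Finset ι) (F : ι → ℂ → ℂ)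
    (hF : ∀ i, Differentiable ℂ (F i)) (u : ℂ) :
    analyticOrderAt (fun x => ∏ i ∈ s, F i x) u = ∑ i ∈ s, analyticOrderAt (F i) u := by
  classical
  induction s using Finset.induction_on with
  | empty => simpa using analyticOrderAt_eq_zero_of_ne (f := fun _ : ℂ => (1 : ℂ)) one_ne_zero
  | insert a s ha ih =>
    rw [Finset.sum_insert ha, ← ih]
    simp only [Finset.prod_insert ha]
    exact analyticOrderAt_mul ((hF a).analyticAt u)
      ((Differentiable.fun_finsetProd fun i _ => hF i).analyticAt u)

/-! ### The string of theta functions. -/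

/-- `[u - v - (l-1)/2] [u - v - (l-1)/2 + 1] ⋯ [u - v + (l-1)/2]`. -/
def thetaString (q r : ℂ) (l : ℕ) (v u : ℂ) : ℂ :=
  ∏ j ∈ Finset.range l, theta q r (u - v - (l - 1) / 2 + j)

/-- The zeros of `thetaString`. -/
def stringZero (l : ℕ) (v : ℂ) (j : Fin l) : ℂ := v + ((l : ℂ) - 1) / 2 - (j : ℕ)

theorem thetaString_eq_prod (l : ℕ) (v u : ℂ) :
    thetaString q r l v u = ∏ j : Fin l, theta q r (u + -stringZero l v j) := by
  rw [thetaString, ← Fin.prod_univ_eq_prod_range (fun j : ℕ => theta q r (u - v - (l - 1) / 2 + j))]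
  refine Finset.prod_congr rfl fun j _ => ?_
  rw [stringZero]
  congr 1
  ring

theorem differentiable_thetaString (hq0 : q ≠ 0) (hp : ‖q ^ (2 * r)‖ < 1) (l : ℕ) (v : ℂ) :
    Differentiable ℂ (thetaString q r l v) := by
  have h := differentiable_theta hq0 hp
  exact Differentiable.fun_finsetProd fun i _ => h.comp (by fun_prop)

/-- Every factor has simple zeros along one lattice coset; counting indices `j` instead of points
records multiplicities when cosets coincide. -/
theorem analyticOrderAt_thetaString (hq0 : q ≠ 0) (hq1 : ‖q‖ < 1) (hp : ‖q ^ (2 * r)‖ < 1)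
    (l : ℕ) (v u : ℂ) :
    analyticOrderAt (thetaString q r l v) u =
      ((Set.ncard {j : Fin l | IsPeriod q r (u - stringZero l v j)} : ℕ) : ℕ∞) := by
  classical
  have h := differentiable_theta hq0 hp
  rw [show thetaString q r l v = fun u => ∏ j : Fin l, theta q r (u + -stringZero l v j) from
    funext (thetaString_eq_prod l v),
    analyticOrderAt_finset_prod _ (fun j u => theta q r (u + -stringZero l v j))
      (fun j => h.comp (by fun_prop))]
  have e : ∀ j : Fin l, analyticOrderAt (fun u => theta q r (u + -stringZero l v j)) u =
      if IsPeriod q r (u - stringZero l v j) then 1 else 0 := fun j => by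
    rw [analyticOrderAt_comp_add (theta q r), analyticOrderAt_theta hq0 hq1 hp, ← sub_eq_add_neg]
  simp only [e]
  rw [Finset.sum_boole, Set.ncard_eq_toFinset_card']
  simp

theorem thetaString_add_self (hq0 : q ≠ 0) (hp : ‖q ^ (2 * r)‖ < 1) (l : ℕ) (v u : ℂ) :
    thetaString q r l v (u + r) = (-1) ^ l * thetaString q r l v u := by
  have e : ∀ j, u + r + -stringZero l v j = u + -stringZero l v j + r := fun j => by ring
  simp only [thetaString_eq_prod, e, theta_add_self hq0 hp, Finset.prod_neg, Finset.card_univ,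
    Fintype.card_fin]

theorem thetaString_add_tau (hq0 : q ≠ 0) (hq1 : ‖q‖ < 1) (hp : ‖q ^ (2 * r)‖ < 1) (l : ℕ)
    (v u : ℂ) :
    thetaString q r l v (u + r * tau q r) = (-1) ^ l *
      Complex.exp (-(Real.pi * Complex.I) * ∑ j, (2 * (u - stringZero l v j) / r + tau q r)) *
        thetaString q r l v u := by
  have e : ∀ j, u + r * tau q r + -stringZero l v j = u + -stringZero l v j + r * tau q r :=
    fun j => by ring
  simp only [thetaString_eq_prod, e, theta_add_tau hq0 hq1 hp, Finset.prod_mul_distrib,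
    Finset.prod_neg, Finset.card_univ, Fintype.card_fin, Finset.mul_sum, Complex.exp_sum,
    ← sub_eq_add_neg]

theorem sum_stringZero (l : ℕ) (v : ℂ) : ∑ j, stringZero l v j = l * v := by
  have h2 : ∀ n : ℕ, ∑ j ∈ Finset.range n, (j : ℂ) = n * (n - 1) / 2 := by
    intro n
    induction n with
    | zero => simp
    | succ n ih => rw [Finset.sum_range_succ, ih]; push_cast; ring
  simp only [stringZero, Finset.sum_sub_distrib, Finset.sum_const, Finset.card_univ,
    Fintype.card_fin, Fin.sum_univ_eq_sum_range (fun j : ℕ => (j : ℂ)) l, h2, nsmul_eq_mul]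
  ring

/-- The zeros are symmetric about `v`, so they sum to `l v` and the product of exponentials is
`q^(2lv/r)`. -/
theorem constant_thetaString (hq0 : q ≠ 0) (l : ℕ) (v : ℂ) :
    q ^ (l * (2 * v - 1) / r) = q ^ (-(l : ℂ) / r) * ∏ j, q ^ (2 * stringZero l v j / r) := by
  simp only [Complex.cpow_def_of_ne_zero hq0, ← Complex.exp_sum, ← Complex.exp_add,
    ← Finset.mul_sum, ← Finset.sum_div, sum_stringZero]
  congr 1
  ring

/-- Both sides are the product of the same `l + 1` consecutive theta factors, split off at opposite
ends. This is the telescoping of `P(u+1)/P(u)` without denominators. -/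
theorem thetaString_mul_theta (l : ℕ) (v u : ℂ) :
    thetaString q r l v (u + 1) * theta q r (u - v - (l - 1) / 2) =
      thetaString q r l v u * theta q r (u - v + (l + 1) / 2) := by
  have h1 := Finset.prod_range_succ (fun j : ℕ => theta q r (u - v - (l - 1) / 2 + j)) l
  rw [Finset.prod_range_succ'] at h1
  rw [thetaString, thetaString]
  convert h1 using 2
  · refine Finset.prod_congr rfl fun j _ => ?_
    congr 1; push_cast; ring
  · simp
  · congr 1; ring

end ThetaFunction

/-! ### Operator-valued series acting on a common eigenvector. -/

section ActsBy

variable {A : Type*} [Ring A] [Algebra ℂ A] {M : Type*} [AddCommGroup M] [Module ℂ M]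

/-- The coefficients of `X` act on `Ω` by the coefficients of the scalar series `x`. -/
def ActsBy (π : A →ₐ[ℂ] Module.End ℂ M) (Ω : M) (X : PowerSeries A) (x : PowerSeries ℂ) : Prop :=
  ∀ n, π (PowerSeries.coeff n X) Ω = PowerSeries.coeff n x • Ω

variable {π : A →ₐ[ℂ] Module.End ℂ M} {Ω : M} {X Y : PowerSeries A} {x y : PowerSeries ℂ}

/-- On a common eigenvector the scalar produced by `Y` can be pulled out before `X` acts, so series
over a non-commutative algebra multiply as scalar series do. -/
theorem ActsBy.mul (hX : ActsBy π Ω X x) (hY : ActsBy π Ω Y y) : ActsBy π Ω (X * Y) (x * y) := by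
  intro n
  rw [PowerSeries.coeff_mul, PowerSeries.coeff_mul, map_sum, LinearMap.sum_apply, Finset.sum_smul]
  refine Finset.sum_congr rfl fun k _ => ?_
  rw [map_mul, Module.End.mul_apply, hY, map_smul, hX, smul_smul, mul_comm]

theorem ActsBy.one : ActsBy π Ω 1 1 := by
  intro n
  rw [PowerSeries.coeff_one, PowerSeries.coeff_one]
  split_ifs <;> simp

theorem ActsBy.pow (hX : ActsBy π Ω X x) (k : ℕ) : ActsBy π Ω (X ^ k) (x ^ k) := by
  induction k with
  | zero => simpa using ActsBy.one
  | succ k ih => rw [pow_succ, pow_succ]; exact ih.mul hX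

theorem ActsBy.rescaleSeries (hX : ActsBy π Ω X x) (s : ℂ) :
    ActsBy π Ω (rescaleSeries s X) (PowerSeries.rescale s x) := by
  intro n
  rw [EllipticSl2.rescaleSeries, PowerSeries.coeff_mk, PowerSeries.coeff_rescale, map_smul,
    LinearMap.smul_apply, hX, smul_smul]

theorem ActsBy.expSeries (hX : ActsBy π Ω X x) : ActsBy π Ω (expSeries X) (expSeries x) := by
  intro n
  simp only [EllipticSl2.expSeries, PowerSeries.coeff_mk, map_sum, map_smul, LinearMap.sum_apply,
    LinearMap.smul_apply, (hX.pow _) n, Finset.sum_smul, smul_smul, smul_eq_mul]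

theorem actsBy_modeSeries {c : ℕ → ℂ} {b : ℕ → A} {β : ℕ → ℂ} (hb : ∀ n, π (b n) Ω = β n • Ω) :
    ActsBy π Ω (modeSeries c b) (modeSeries c β) := by
  intro n
  simp only [modeSeries, PowerSeries.coeff_mk]
  split_ifs
  · simp
  · rw [map_smul, LinearMap.smul_apply, hb, smul_smul, smul_eq_mul]

end ActsBy

/-! ### The scalar series of `H^±(u)` on the top vector. -/

section CurrentSeries

variable {q r : ℂ}

/-- `[n]_q / ([2n]_q [rn]_q)`. -/
def kCoeff (q r : ℂ) (n : ℕ) : ℂ := qNum q n / (qNum q (2 * n) * qNum q (r * n))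

/-- The series by which `hCreation` acts on a vector on which `a_n` acts by `α n`. -/
def hCreationSeries (q r σ : ℂ) (α : ℤ → ℂ) : PowerSeries ℂ :=
  PowerSeries.rescale (q ^ (2 * (σ + 1 / 2))) (expSeries (modeSeries (kCoeff q r) fun n => α (-n))) *
    PowerSeries.rescale (q ^ (2 * (σ - 1 / 2))) (expSeries (modeSeries (kCoeff q r) fun n => α (-n)))

/-- The series by which `hAnnihilation` acts on a vector on which `a_n` acts by `α n`. -/
def hAnnihilationSeries (q r σ : ℂ) (α : ℤ → ℂ) : PowerSeries ℂ :=
  PowerSeries.rescale (q ^ (-(2 * (σ + 1 / 2))))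
      (expSeries (modeSeries (fun n => -kCoeff q r n) fun n => α n)) *
    PowerSeries.rescale (q ^ (-(2 * (σ - 1 / 2))))
      (expSeries (modeSeries (fun n => -kCoeff q r n) fun n => α n))

theorem constantCoeff_rescale (s : ℂ) (x : PowerSeries ℂ) :
    PowerSeries.constantCoeff (PowerSeries.rescale s x) = PowerSeries.constantCoeff x := by
  simp only [← PowerSeries.coeff_zero_eq_constantCoeff_apply, PowerSeries.coeff_rescale, pow_zero,
    one_mul]

theorem constantCoeff_hCreationSeries (σ : ℂ) (α : ℤ → ℂ) :
    PowerSeries.constantCoeff (hCreationSeries q r σ α) = 1 := by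
  simp only [hCreationSeries, map_mul, constantCoeff_rescale, constantCoeff_expSeries,
    mul_one]

theorem constantCoeff_hAnnihilationSeries (σ : ℂ) (α : ℤ → ℂ) :
    PowerSeries.constantCoeff (hAnnihilationSeries q r σ α) = 1 := by
  simp only [hAnnihilationSeries, map_mul, constantCoeff_rescale,
    constantCoeff_expSeries, mul_one]

/-- The factors from `K(u + σ + 1/2)` and `K(u + σ - 1/2)` combine into one exponential. All data
are moved into the first sequence, which is the form required by `expSeries_qDifference`. -/
theorem rescale_mul_rescale_expSeries (s t : ℂ) (c b : ℕ → ℂ) :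
    PowerSeries.rescale s (expSeries (modeSeries c b)) *
        PowerSeries.rescale t (expSeries (modeSeries c b)) =
      expSeries (modeSeries (fun n => (s ^ n + t ^ n) * (c n * b n)) fun _ => (1 : ℂ)) := by
  have h0 : ∀ s : ℂ,
      PowerSeries.constantCoeff (PowerSeries.rescale s (modeSeries c b)) = 0 := fun s => by
    rw [constantCoeff_rescale, constantCoeff_modeSeries]
  rw [← expSeries_rescale, ← expSeries_rescale, ← expSeries_add (h0 s) (h0 t)]
  congr 1
  ext n
  simp only [modeSeries, map_add, PowerSeries.coeff_rescale, PowerSeries.coeff_mk, smul_eq_mul]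
  split_ifs <;> ring

theorem pow_ne_one_of_norm_lt_one {x : ℂ} (hx : ‖x‖ < 1) {n : ℕ} (hn : n ≠ 0) : x ^ n ≠ 1 := by
  intro h
  have : ‖x ^ n‖ < 1 := by rw [norm_pow]; exact pow_lt_one₀ (norm_nonneg _) hx hn
  rw [h, norm_one] at this
  exact lt_irrefl _ this

/-- With `a = q ^ n` and `b = q ^ (r n)`. -/
theorem kCoeff_eq (hq0 : q ≠ 0) (hq1 : ‖q‖ < 1) (hp : ‖q ^ (2 * r)‖ < 1) {n : ℕ} (hn : n ≠ 0) :
    ((q ^ n) + (q ^ n)⁻¹) * kCoeff q r n * (1 - (q ^ (2 * r)) ^ n) =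
      -((q ^ r) ^ n * (q - q⁻¹)) := by
  have hqq := q_sub_inv_ne hq0 hq1
  have e1 : qNum q n = (q ^ n - (q ^ n)⁻¹) / (q - q⁻¹) := by
    rw [qNum, Complex.cpow_neg, Complex.cpow_natCast]
  have e2 : qNum q (2 * n) = ((q ^ n) ^ 2 - ((q ^ n) ^ 2)⁻¹) / (q - q⁻¹) := by
    rw [qNum, Complex.cpow_neg, ← pow_mul, ← Complex.cpow_natCast q (n * 2)]
    push_cast
    rw [mul_comm]
  have e3 : qNum q (r * n) = ((q ^ r) ^ n - ((q ^ r) ^ n)⁻¹) / (q - q⁻¹) := by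
    rw [qNum, Complex.cpow_neg, mul_comm, Complex.cpow_nat_mul]
  have e4 : (q ^ (2 * r)) ^ n = ((q ^ r) ^ n) ^ 2 := by
    rw [show 2 * r = ((2 : ℕ) : ℂ) * r by norm_num, Complex.cpow_nat_mul, ← pow_mul, ← pow_mul,
      mul_comm]
  have ha : q ^ n ≠ 0 := pow_ne_zero _ hq0
  have hb : (q ^ r) ^ n ≠ 0 := pow_ne_zero _ (cpow_ne_zero hq0 _)
  -- Non-vanishing of `[2n]_q`, and next of `[rn]_q`. The identity itself is `[2n]_q = (q^n +
  -- q^(-n)) [n]_q`, with `1 - p^n` cancelling `[rn]_q` up to `-q^(rn) (q - q⁻¹)`.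
  have ha4 : (q ^ n) ^ 4 - 1 ≠ 0 := by
    rw [← pow_mul]; exact sub_ne_zero.2 (pow_ne_one_of_norm_lt_one hq1 (by omega))
  have hb2 : ((q ^ r) ^ n) ^ 2 - 1 ≠ 0 := by
    rw [← e4]; exact sub_ne_zero.2 (pow_ne_one_of_norm_lt_one hp hn)
  rw [kCoeff, e1, e2, e3, e4]
  clear e1 e2 e3 e4
  generalize q ^ n = a at *
  generalize (q ^ r) ^ n = b at *
  generalize q - q⁻¹ = d at *
  have h2 : a ^ 2 - (a ^ 2)⁻¹ = (a ^ 4 - 1) / a ^ 2 := by field_simp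
  have h3 : b - b⁻¹ = (b ^ 2 - 1) / b := by field_simp
  rw [h2, h3]
  field_simp
  ring

/-- On `v_0` one half of `(q^n + q^(-n)) q^(nl)` cancels `q^((l+1)n)`, which leaves `q^((l-1)n) -
q^(-(l+1)n)`. Two geometric terms remain, hence one factor above and one below in the `q`-difference
equation. -/
theorem evA_zero_pos (hq0 : q ≠ 0) {w : ℂ} {l n : ℕ} (hn : n ≠ 0) :
    n * evA q w l n 0 * (q - q⁻¹) =
      (q - q⁻¹) * (q - q⁻¹)⁻¹ * (w ^ n * (q ^ n)⁻¹ * ((q ^ l) ^ n - ((q ^ l) ^ n)⁻¹)) := by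
  have h0 : (n : ℂ) ≠ 0 := by exact_mod_cast hn
  have e1 : q ^ ((n : ℤ) * wt l 0) = (q ^ l) ^ n := by
    rw [wt, mul_comm, zpow_mul, zpow_natCast]; simp
  have e2 : q ^ (((l : ℤ) + 1) * n) = (q ^ l) ^ n * q ^ n := by
    rw [zpow_mul, zpow_natCast, ← mul_pow]; congr 1
  rw [evA, zpow_neg, zpow_neg, e1, e2]
  simp only [Int.cast_natCast, zpow_natCast, mul_inv]
  have ha : q ^ n ≠ 0 := pow_ne_zero _ hq0
  generalize (q - q⁻¹)⁻¹ = d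
  field_simp
  ring

theorem evA_zero_neg (hq0 : q ≠ 0) {w : ℂ} {l n : ℕ} (hn : n ≠ 0) :
    n * evA q w l (-n) 0 * (q - q⁻¹) =
      (q - q⁻¹) * (q - q⁻¹)⁻¹ * ((w ^ n)⁻¹ * q ^ n * ((q ^ l) ^ n - ((q ^ l) ^ n)⁻¹)) := by
  have h0 : (n : ℂ) ≠ 0 := by exact_mod_cast hn
  have e1 : q ^ (-(n : ℤ) * wt l 0) = ((q ^ l) ^ n)⁻¹ := by
    rw [wt, mul_comm, mul_neg, zpow_neg, zpow_mul, zpow_natCast]; simp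
  have e2 : q ^ (((l : ℤ) + 1) * -n) = ((q ^ l) ^ n * q ^ n)⁻¹ := by
    rw [mul_neg, zpow_neg, zpow_mul, zpow_natCast, ← mul_pow]; congr 2
  rw [evA, e1, zpow_neg, zpow_neg q (((l : ℤ) + 1) * -n), e2]
  simp only [Int.cast_natCast, zpow_neg, zpow_natCast, mul_inv, inv_inv, Int.cast_neg]
  have ha : q ^ n ≠ 0 := pow_ne_zero _ hq0
  generalize (q - q⁻¹)⁻¹ = d
  field_simp
  ring

variable {l : ℕ} {v : ℂ}

/-- The two shifts give `q^(2σn) (q^n + q^(-n))`. By `kCoeff_eq` and the eigenvalue of `a_{-n}`, the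
product with `n (1 - p^n)` is `-q^((2σ+1+r-2v)n) (q^(ln) - q^(-ln))`, from which `A` and `B` are
read off. -/
theorem hCreationSeries_qDifference (hq0 : q ≠ 0) (hq1 : ‖q‖ < 1) (hp : ‖q ^ (2 * r)‖ < 1) (σ : ℂ) :
    hCreationSeries q r σ (fun n => evA q (q ^ (2 * v)) l n 0) *
        (1 - PowerSeries.C (q ^ (2 * σ + 1 + r - l - 2 * v)) * PowerSeries.X) =
      PowerSeries.rescale (q ^ (2 * r))
          (hCreationSeries q r σ fun n => evA q (q ^ (2 * v)) l n 0) *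
        (1 - PowerSeries.C (q ^ (2 * σ + 1 + r + l - 2 * v)) * PowerSeries.X) := by
  have hqq := q_sub_inv_ne hq0 hq1
  rw [hCreationSeries, rescale_mul_rescale_expSeries]
  refine expSeries_qDifference _ fun n hn => ?_
  have h1 := kCoeff_eq hq0 hq1 hp hn
  have h2 := evA_zero_neg (w := q ^ (2 * v)) (l := l) hq0 hn
  rw [mul_inv_cancel₀ hqq, one_mul] at h2
  have es : q ^ (2 * (σ + 1 / 2)) = q ^ (2 * σ) * q := by
    rw [show 2 * (σ + 1 / 2) = 2 * σ + 1 by ring, Complex.cpow_add _ _ hq0, Complex.cpow_one]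
  have et : q ^ (2 * (σ - 1 / 2)) = q ^ (2 * σ) * q⁻¹ := by
    rw [show 2 * (σ - 1 / 2) = 2 * σ - 1 by ring, Complex.cpow_sub _ _ hq0, Complex.cpow_one]; rfl
  have eB : q ^ (2 * σ + 1 + r - l - 2 * v) =
      q ^ (2 * σ) * q * q ^ r * (q ^ l)⁻¹ * (q ^ (2 * v))⁻¹ := by
    rw [Complex.cpow_sub _ _ hq0, Complex.cpow_sub _ _ hq0, Complex.cpow_add _ _ hq0,
      Complex.cpow_add _ _ hq0, Complex.cpow_one, Complex.cpow_natCast]; rfl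
  have eA : q ^ (2 * σ + 1 + r + l - 2 * v) =
      q ^ (2 * σ) * q * q ^ r * q ^ l * (q ^ (2 * v))⁻¹ := by
    rw [Complex.cpow_sub _ _ hq0, Complex.cpow_add _ _ hq0, Complex.cpow_add _ _ hq0,
      Complex.cpow_add _ _ hq0, Complex.cpow_one, Complex.cpow_natCast]; rfl
  rw [es, et, eB, eA]
  simp only [mul_pow, inv_pow] at h1 h2 ⊢
  refine mul_right_cancel₀ hqq ?_
  linear_combination ((q ^ (2 * σ)) ^ n * n * evA q (q ^ (2 * v)) l (-n) 0 * (q - q⁻¹)) * h1 -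
    (q ^ (2 * σ)) ^ n * (q ^ r) ^ n * (q - q⁻¹) * h2

/-- As for the creation series, but the minus sign in the exponent of the annihilation factor
exchanges the roles of `q^l` and `q^(-l)`: here the denominator carries `+l`. -/
theorem hAnnihilationSeries_qDifference (hq0 : q ≠ 0) (hq1 : ‖q‖ < 1) (hp : ‖q ^ (2 * r)‖ < 1)
    (σ : ℂ) :
    hAnnihilationSeries q r σ (fun n => evA q (q ^ (2 * v)) l n 0) *
        (1 - PowerSeries.C (q ^ (r - 2 * σ - 1 + l + 2 * v)) * PowerSeries.X) =
      PowerSeries.rescale (q ^ (2 * r))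
          (hAnnihilationSeries q r σ fun n => evA q (q ^ (2 * v)) l n 0) *
        (1 - PowerSeries.C (q ^ (r - 2 * σ - 1 - l + 2 * v)) * PowerSeries.X) := by
  have hqq := q_sub_inv_ne hq0 hq1
  rw [hAnnihilationSeries, rescale_mul_rescale_expSeries]
  refine expSeries_qDifference _ fun n hn => ?_
  have h1 := kCoeff_eq hq0 hq1 hp hn
  have h2 := evA_zero_pos (w := q ^ (2 * v)) (l := l) hq0 hn
  rw [mul_inv_cancel₀ hqq, one_mul] at h2
  have es : q ^ (-(2 * (σ + 1 / 2))) = (q ^ (2 * σ))⁻¹ * q⁻¹ := by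
    rw [show -(2 * (σ + 1 / 2)) = -(2 * σ) - 1 by ring, Complex.cpow_sub _ _ hq0,
      Complex.cpow_one, Complex.cpow_neg]; rfl
  have et : q ^ (-(2 * (σ - 1 / 2))) = (q ^ (2 * σ))⁻¹ * q := by
    rw [show -(2 * (σ - 1 / 2)) = -(2 * σ) + 1 by ring, Complex.cpow_add _ _ hq0,
      Complex.cpow_one, Complex.cpow_neg]
  have eB : q ^ (r - 2 * σ - 1 + l + 2 * v) =
      q ^ r * (q ^ (2 * σ))⁻¹ * q⁻¹ * q ^ l * q ^ (2 * v) := by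
    rw [Complex.cpow_add _ _ hq0, Complex.cpow_add _ _ hq0, Complex.cpow_sub _ _ hq0,
      Complex.cpow_sub _ _ hq0, Complex.cpow_one, Complex.cpow_natCast]; rfl
  have eA : q ^ (r - 2 * σ - 1 - l + 2 * v) =
      q ^ r * (q ^ (2 * σ))⁻¹ * q⁻¹ * (q ^ l)⁻¹ * q ^ (2 * v) := by
    rw [Complex.cpow_add _ _ hq0, Complex.cpow_sub _ _ hq0, Complex.cpow_sub _ _ hq0,
      Complex.cpow_sub _ _ hq0, Complex.cpow_one, Complex.cpow_natCast]; rfl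
  rw [es, et, eB, eA]
  simp only [mul_pow, inv_pow] at h1 h2 ⊢
  refine mul_right_cancel₀ hqq ?_
  linear_combination (-((q ^ (2 * σ)) ^ n)⁻¹ * n * evA q (q ^ (2 * v)) l n 0 * (q - q⁻¹)) * h1 +
    ((q ^ (2 * σ)) ^ n)⁻¹ * (q ^ r) ^ n * (q - q⁻¹) * h2

end CurrentSeries

/-! ### The eigenvalue of `H^±(u)` as a quotient of theta functions. -/

section TopVector

variable {q r : ℂ} {l : ℕ} {v : ℂ} {M : Type*} [AddCommGroup M] [Module ℂ M]

/-- `h`, `q^h`, the `a_n` and `e^Q` act on `Ω` as on the vector `v_0` of the evaluation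
representation. -/
structure IsTopVector (l : ℕ) (v : ℂ) (π : EllipticAlg q →ₐ[ℂ] Module.End ℂ M) (Ω : M) : Prop where
  ne_zero : Ω ≠ 0
  expQ : π (EllipticAlg.expQ q 1) Ω = Ω
  h : π (EllipticAlg.of q .h) Ω = (l : ℂ) • Ω
  k : π (EllipticAlg.of q .k) Ω = q ^ (l : ℂ) • Ω
  a : ∀ n : ℤ, π (EllipticAlg.of q (.a n)) Ω = evA q (q ^ (2 * v)) l n 0 • Ω

variable {π : EllipticAlg q →ₐ[ℂ] Module.End ℂ M} {Ω : M}

theorem expQ_two (q : ℂ) : EllipticAlg.expQ q 2 = EllipticAlg.expQ q 1 * EllipticAlg.expQ q 1 := by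
  simp only [EllipticAlg.expQ]
  rw [SkewMonoidAlgebra.single_mul_single, smul_one, mul_one]
  rfl

theorem IsTopVector.hCreation (hΩ : IsTopVector l v π Ω) (σ : ℂ) :
    ActsBy π Ω (hCreation q r σ) (hCreationSeries q r σ fun n => evA q (q ^ (2 * v)) l n 0) := by
  have h : ActsBy π Ω (kCreation q r)
      (expSeries (modeSeries (kCoeff q r) fun n => evA q (q ^ (2 * v)) l (-n) 0)) :=
    (actsBy_modeSeries fun n => hΩ.a _).expSeries
  exact (h.rescaleSeries _).mul (h.rescaleSeries _)

theorem IsTopVector.hAnnihilation (hΩ : IsTopVector l v π Ω) (σ : ℂ) (n : ℕ) :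
    π (PowerSeries.coeff n (hAnnihilation q r σ) * EllipticAlg.expQ q 2) Ω =
      PowerSeries.coeff n (hAnnihilationSeries q r σ fun n => evA q (q ^ (2 * v)) l n 0) • Ω := by
  have h : ActsBy π Ω (kAnnihilation q r)
      (expSeries (modeSeries (fun n => -kCoeff q r n) fun n => evA q (q ^ (2 * v)) l n 0)) :=
    (actsBy_modeSeries fun n => hΩ.a _).expSeries
  rw [expQ_two, map_mul, map_mul, Module.End.mul_apply, Module.End.mul_apply, hΩ.expQ, hΩ.expQ]
  exact (h.rescaleSeries _).mul (h.rescaleSeries _) n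

/-- The annulus is `|B'| < |z| < |B|⁻¹`, where `B` and `B'` come from the creation and annihilation
`q`-difference equations. The final bounds are kept because they make the denominator theta function
non-zero on the annulus. -/
theorem IsTopVector.exists_hasHEigenvalue (hq0 : q ≠ 0) (hq1 : ‖q‖ < 1) (hp : ‖q ^ (2 * r)‖ < 1)
    (hΩ : IsTopVector l v π Ω) (σ : ℂ) :
    ∃ (s t : ℝ) (η : ℂ → ℂ), 0 ≤ s ∧ s < t ∧ HasHEigenvalue r σ π Ω s t η ∧
      ∀ u, s < ‖q ^ (2 * u)‖ → ‖q ^ (2 * u)‖ < t →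
        ‖q ^ (2 * σ + 1 + r - l + 2 * (u - v))‖ < 1 ∧
          ‖q ^ (r - 2 * σ - 1 + l - 2 * (u - v))‖ < 1 := by
  set x := hCreationSeries q r σ fun n => evA q (q ^ (2 * v)) l n 0
  set y := hAnnihilationSeries q r σ fun n => evA q (q ^ (2 * v)) l n 0
  set B := q ^ (2 * σ + 1 + r - l - 2 * v) with hB
  set B' := q ^ (r - 2 * σ - 1 + l + 2 * v) with hB'
  have hB0 : 0 < ‖B‖ := norm_pos_iff.2 (cpow_ne_zero hq0 _)
  -- The exponents of `B` and `B'` add up to `2r`, so `B B' = p`; this is why the annulus is not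
  -- empty.
  have hBB : ‖B'‖ * ‖B‖ < 1 := by
    rw [← norm_mul, hB, hB', ← Complex.cpow_add _ _ hq0]
    convert hp using 3
    ring
  have hnB : ∀ u : ℂ, ‖q ^ (2 * u)‖ < ‖B‖⁻¹ → ‖B * q ^ (2 * u)‖ < 1 := fun u ht => by
    rw [norm_mul, mul_comm]
    rwa [← one_div, lt_div_iff₀ hB0] at ht
  have hnB' : ∀ u : ℂ, ‖B'‖ < ‖q ^ (2 * u)‖ → ‖B' * (q ^ (2 * u))⁻¹‖ < 1 := fun u hs => by
    rw [norm_mul, norm_inv, ← div_eq_mul_inv]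
    exact (div_lt_one (norm_pos_iff.2 (cpow_ne_zero hq0 _))).2 hs
  refine ⟨‖B'‖, ‖B‖⁻¹, fun u => (∑' n, PowerSeries.coeff n x * (q ^ (2 * u)) ^ n) *
    (∑' n, PowerSeries.coeff n y * ((q ^ (2 * u))⁻¹) ^ n) * q ^ (2 * (u + σ) * l / r),
    norm_nonneg _, ?_, ⟨l, fun n => PowerSeries.coeff n x, fun n => PowerSeries.coeff n y, hΩ.h,
    hΩ.k, hΩ.hCreation σ, hΩ.hAnnihilation σ, fun u hs ht => ⟨_, _, Summable.hasSum ?_,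
      Summable.hasSum ?_, rfl⟩⟩, fun u hs ht => ⟨?_, ?_⟩⟩
  · rwa [← one_div, lt_div_iff₀ hB0]
  · exact summable_qDifference hp (hCreationSeries_qDifference hq0 hq1 hp σ) (hnB u ht)
  · exact summable_qDifference hp (hAnnihilationSeries_qDifference hq0 hq1 hp σ) (hnB' u hs)
  · convert hnB u ht using 2
    rw [hB, ← Complex.cpow_add _ _ hq0]
    congr 1
    ring
  · convert hnB' u hs using 2
    rw [hB', ← Complex.cpow_neg, ← Complex.cpow_add _ _ hq0]
    congr 1
    ring

theorem IsTopVector.hasHEigenvalue_mul (hq0 : q ≠ 0) (hq1 : ‖q‖ < 1) (hp : ‖q ^ (2 * r)‖ < 1)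
    (hΩ : IsTopVector l v π Ω) {σ : ℂ} {s t : ℝ} {η : ℂ → ℂ}
    (h : HasHEigenvalue r σ π Ω s t η) {u : ℂ} (hs : s < ‖q ^ (2 * u)‖) (ht : ‖q ^ (2 * u)‖ < t) :
    η u * (qPochhammer (q ^ (2 * σ + 1 + r - l + 2 * (u - v))) (q ^ (2 * r)) *
        qPochhammer (q ^ (r - 2 * σ - 1 + l - 2 * (u - v))) (q ^ (2 * r))) =
      qPochhammer (q ^ (2 * σ + 1 + r + l + 2 * (u - v))) (q ^ (2 * r)) *
        qPochhammer (q ^ (r - 2 * σ - 1 - l - 2 * (u - v))) (q ^ (2 * r)) *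
        q ^ (2 * (u + σ) * l / r) := by
  obtain ⟨wght, x, y, hh, -, hx, hy, hsum⟩ := h
  obtain ⟨X, Y, hX, hY, hη⟩ := hsum u hs ht
  -- Since `Ω ≠ 0`, the weight and the two scalar sequences in `HasHEigenvalue` are unique, so every
  -- admissible `η` is given by the series computed above.
  have hinj := smul_left_injective ℂ hΩ.ne_zero
  obtain rfl : wght = l := hinj (hh.symm.trans hΩ.h)
  obtain rfl : x = fun n => PowerSeries.coeff n _ :=
    funext fun n => hinj ((hx n).symm.trans (hΩ.hCreation σ n))
  obtain rfl : y = fun n => PowerSeries.coeff n _ :=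
    funext fun n => hinj ((hy n).symm.trans (hΩ.hAnnihilation σ n))
  have h1 := hasSum_qDifference hp (constantCoeff_hCreationSeries _ _)
    (hCreationSeries_qDifference hq0 hq1 hp σ) hX
  have h2 := hasSum_qDifference hp (constantCoeff_hAnnihilationSeries _ _)
    (hAnnihilationSeries_qDifference hq0 hq1 hp σ) hY
  rw [← Complex.cpow_add _ _ hq0, ← Complex.cpow_add _ _ hq0] at h1
  rw [← Complex.cpow_neg, ← Complex.cpow_add _ _ hq0, ← Complex.cpow_add _ _ hq0] at h2
  rw [show 2 * σ + 1 + r - l - 2 * v + 2 * u = 2 * σ + 1 + r - l + 2 * (u - v) by ring,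
    show 2 * σ + 1 + r + l - 2 * v + 2 * u = 2 * σ + 1 + r + l + 2 * (u - v) by ring] at h1
  rw [show r - 2 * σ - 1 + l + 2 * v + -(2 * u) = r - 2 * σ - 1 + l - 2 * (u - v) by ring,
    show r - 2 * σ - 1 - l + 2 * v + -(2 * u) = r - 2 * σ - 1 - l - 2 * (u - v) by ring] at h2
  rw [hη, ← h1, ← h2]
  ring

theorem IsTopVector.eigenvalue_mul_theta (hq0 : q ≠ 0) (hq1 : ‖q‖ < 1) (hp : ‖q ^ (2 * r)‖ < 1)
    (hΩ : IsTopVector l v π Ω) {σ : ℂ} (hσ : σ = r / 2 ∨ σ = -(r / 2)) {s t : ℝ} {η : ℂ → ℂ}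
    (h : HasHEigenvalue r σ π Ω s t η) {u : ℂ} (hs : s < ‖q ^ (2 * u)‖) (ht : ‖q ^ (2 * u)‖ < t) :
    η u * theta q r (u - v - (l - 1) / 2) =
      q ^ (l * (2 * v - 1) / r) * theta q r (u - v + (l + 1) / 2) := by
  have hr := ne_zero_of_norm_cpow_lt_one hp
  have h := hΩ.hasHEigenvalue_mul hq0 hq1 hp h hs ht
  set a : ℂ := u - v + (l + 1) / 2 with ha
  set b : ℂ := u - v - (l - 1) / 2 with hb
  have hc := qPochhammer_self_ne_zero hp
  -- Here `a = b + l`. For `σ = -r/2` the products are literally `Θ_p(q^(2a))` and `Θ_p(q^(2b))`.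
  -- For `σ = r/2` they are `Θ_p` at the inverse arguments; inversion contributes `q^(2b) / q^(2a) =
  -- q^(-2l)`, which turns the factor `q^l` of that case into the same `q^(-l)`.
  have key : η u * bigTheta (q ^ (2 * r)) (q ^ (2 * b)) =
      bigTheta (q ^ (2 * r)) (q ^ (2 * a)) * q ^ (2 * u * l / r - l) := by
    rcases hσ with rfl | rfl
    · have t1 : η u * bigTheta (q ^ (2 * r)) (q ^ (2 * b))⁻¹ =
          bigTheta (q ^ (2 * r)) (q ^ (2 * a))⁻¹ * q ^ (2 * u * l / r + l) := by
        rw [bigTheta, bigTheta, div_inv_eq_mul, div_inv_eq_mul, ← Complex.cpow_neg,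
          ← Complex.cpow_neg, ← Complex.cpow_add _ _ hq0, ← Complex.cpow_add _ _ hq0]
        rw [show 2 * (r / 2) + 1 + r - l + 2 * (u - v) = 2 * r + 2 * b by rw [hb]; ring,
          show r - 2 * (r / 2) - 1 + l - 2 * (u - v) = -(2 * b) by rw [hb]; ring,
          show 2 * (r / 2) + 1 + r + l + 2 * (u - v) = 2 * r + 2 * a by rw [ha]; ring,
          show r - 2 * (r / 2) - 1 - l - 2 * (u - v) = -(2 * a) by rw [ha]; ring,
          show 2 * (u + r / 2) * l / r = 2 * u * l / r + l by field_simp] at h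
        linear_combination qPochhammer (q ^ (2 * r)) (q ^ (2 * r)) * h
      rw [bigTheta_inv hp (cpow_ne_zero hq0 _), bigTheta_inv hp (cpow_ne_zero hq0 _)] at t1
      have e1 : q ^ (2 * a) = q ^ (2 * b) * q ^ (l : ℂ) * q ^ (l : ℂ) := by
        rw [← Complex.cpow_add _ _ hq0, ← Complex.cpow_add _ _ hq0, ha, hb]
        congr 1; ring
      rw [Complex.cpow_sub _ _ hq0]
      rw [Complex.cpow_add _ _ hq0, e1] at t1
      rw [e1]
      have n1 := cpow_ne_zero hq0 (2 * b)
      have n2 := cpow_ne_zero hq0 (l : ℂ)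
      generalize q ^ (2 * b) = z at *
      generalize q ^ (l : ℂ) = L at *
      field_simp at t1 ⊢
      linear_combination -t1
    · rw [bigTheta, bigTheta, ← Complex.cpow_sub _ _ hq0, ← Complex.cpow_sub _ _ hq0]
      rw [show 2 * -(r / 2) + 1 + r - l + 2 * (u - v) = 2 * b by rw [hb]; ring,
        show r - 2 * -(r / 2) - 1 + l - 2 * (u - v) = 2 * r - 2 * b by rw [hb]; ring,
        show 2 * -(r / 2) + 1 + r + l + 2 * (u - v) = 2 * a by rw [ha]; ring,
        show r - 2 * -(r / 2) - 1 - l - 2 * (u - v) = 2 * r - 2 * a by rw [ha]; ring,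
        show 2 * (u + -(r / 2)) * l / r = 2 * u * l / r - l by field_simp; ring] at h
      linear_combination qPochhammer (q ^ (2 * r)) (q ^ (2 * r)) * h
  -- Comparison of the quadratic prefactors of the two theta functions; this is where the constant
  -- `q^(l(2v-1)/r)` appears.
  have hexp : q ^ (b ^ 2 / r - b) * q ^ (2 * u * l / r - l) =
      q ^ (l * (2 * v - 1) / r) * q ^ (a ^ 2 / r - a) := by
    rw [← Complex.cpow_add _ _ hq0, ← Complex.cpow_add _ _ hq0]
    congr 1
    rw [ha, hb]
    field_simp
    ring
  rw [theta, theta]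
  linear_combination (q ^ (b ^ 2 / r - b) / qPochhammer (q ^ (2 * r)) (q ^ (2 * r)) ^ 3) * key +
    bigTheta (q ^ (2 * r)) (q ^ (2 * a)) / qPochhammer (q ^ (2 * r)) (q ^ (2 * r)) ^ 3 * hexp

theorem IsTopVector.exists_thetaString (hq0 : q ≠ 0) (hq1 : ‖q‖ < 1) (hp : ‖q ^ (2 * r)‖ < 1)
    (hΩ : IsTopVector l v π Ω) {σ : ℂ} (hσ : σ = r / 2 ∨ σ = -(r / 2)) :
    ∃ (s t : ℝ) (η : ℂ → ℂ), 0 ≤ s ∧ s < t ∧ HasHEigenvalue r σ π Ω s t η ∧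
      ∀ u : ℂ, s < ‖q ^ (2 * u)‖ → ‖q ^ (2 * u)‖ < t →
        η u * thetaString q r l v u = q ^ (l * (2 * v - 1) / r) * thetaString q r l v (u + 1) := by
  obtain ⟨s, t, η, hs, hst, h, hnorm⟩ := hΩ.exists_hasHEigenvalue hq0 hq1 hp σ
  refine ⟨s, t, η, hs, hst, h, fun u hsu hut => ?_⟩
  have h1 := hΩ.eigenvalue_mul_theta hq0 hq1 hp hσ h hsu hut
  have h2 := thetaString_mul_theta (q := q) (r := r) l v u
  obtain ⟨n1, n2⟩ := hnorm u hsu hut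
  have h0 : theta q r (u - v - (l - 1) / 2) ≠ 0 := by
    rcases hσ with rfl | rfl
    -- For `σ = r/2` the annulus is the one on which `u - v - (l-1)/2 + r`, not `u - v - (l-1)/2`,
    -- satisfies the hypotheses of `theta_ne_zero`.
    · rw [← neg_ne_zero, ← theta_add_self hq0 hp]
      refine theta_ne_zero hq0 hp ?_ ?_
      · convert n1 using 3; ring
      · convert n2 using 3; ring
    · refine theta_ne_zero hq0 hp ?_ ?_
      · convert n1 using 3; ring
      · convert n2 using 3; ring
  refine mul_right_cancel₀ h0 ?_
  linear_combination thetaString q r l v u * h1 - q ^ (l * (2 * v - 1) / r) * h2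

end TopVector

/-! ### Pseudo-highest weight vectors of the evaluation representation. -/

section EvaluationRepresentation

variable {q : ℂ} {l : ℕ} {v : ℂ}

/-- The basis vector `v_m`. -/
def basisVector (l : ℕ) (m : Fin (l + 1)) : Fin (l + 1) → ℂ := Pi.single m 1

theorem evalDynRep_of (hq0 : q ≠ 0) (hq1 : ‖q‖ < 1) (s : LoopGen) (f : MeromorphicField)
    (x : Fin (l + 1) → ℂ) :
    evalDynRep q hq0 hq1 l v (EllipticAlg.of q s) (f ⊗ₜ[ℂ] x) =
      f ⊗ₜ[ℂ] (evGen q (q ^ (2 * v)) l s).mulVec x := by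
  rw [evalDynRep, EllipticAlg.of, dynRep_ofLoop, evalRep_of]

theorem diagonal_mulVec_basisVector (d : Fin (l + 1) → ℂ) (m : Fin (l + 1)) :
    (Matrix.diagonal d).mulVec (basisVector l m) = d m • basisVector l m := by
  ext i
  rw [Matrix.mulVec_diagonal, Pi.smul_apply, smul_eq_mul]
  rcases eq_or_ne i m with rfl | h
  · rfl
  · simp [basisVector, Pi.single_eq_of_ne h]

theorem evGen_xp_mulVec_zero (w : ℂ) (n : ℤ) :
    (evGen q w l (.xp n)).mulVec (basisVector l 0) = 0 := by
  ext i
  rw [basisVector, Matrix.mulVec_single_one, Matrix.col_apply, evGen_xp_apply]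
  simp

theorem evGen_xm_mulVec (w : ℂ) (n : ℤ) (m : ℕ) (hm : m + 1 < l + 1) :
    (evGen q w l (.xm n)).mulVec (basisVector l ⟨m, by omega⟩) =
      evXm q w l n m • basisVector l ⟨m + 1, hm⟩ := by
  ext i
  rw [basisVector, Matrix.mulVec_single_one, Matrix.col_apply, evGen_xm_apply, Pi.smul_apply,
    basisVector, Pi.single_apply]
  simp only [Fin.ext_iff, smul_eq_mul, eq_comm (a := m + 1)]
  split_ifs <;> simp

theorem evXm_ne_zero (hq0 : q ≠ 0) (hq1 : ‖q‖ < 1) {w : ℂ} (m : ℕ) : evXm q w l 0 m ≠ 0 := by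
  rw [evXm_eq hq0, zpow_zero, mul_one, ← pow_succ']
  refine div_ne_zero (q_sub_inv_ne (pow_ne_zero _ hq0) ?_) (q_sub_inv_ne hq0 hq1)
  rw [norm_pow]
  exact pow_lt_one₀ (norm_nonneg _) hq1 (Nat.succ_ne_zero m)

/-- The coefficient is `[l - m + 1]_q`, and `q` is not a root of unity because `|q| < 1`. -/
theorem evXp_ne_zero (hq0 : q ≠ 0) (hq1 : ‖q‖ < 1) {w : ℂ} {m : ℕ} (hm : m ≤ l) :
    evXp q w l 0 m ≠ 0 := by
  obtain ⟨k, rfl⟩ := Nat.exists_eq_add_of_le hm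
  have hm0 : q ^ m ≠ 0 := pow_ne_zero _ hq0
  rw [evXp_eq hq0, zpow_zero, mul_one,
    show q * q ^ (m + k) / q ^ m - q ^ m / (q * q ^ (m + k)) = q ^ (k + 1) - (q ^ (k + 1))⁻¹ by
      rw [pow_add q m k, pow_succ q k]; field_simp]
  refine div_ne_zero (q_sub_inv_ne (pow_ne_zero _ hq0) ?_) (q_sub_inv_ne hq0 hq1)
  rw [norm_pow]
  exact pow_lt_one₀ (norm_nonneg _) hq1 (Nat.succ_ne_zero k)

theorem wt_zero (l : ℕ) : wt l 0 = l := by simp [wt]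

/-- `f ⊗ v_0` is a common eigenvector, if `f` is `1`-periodic. -/
theorem isTopVector_tmul (hq0 : q ≠ 0) (hq1 : ‖q‖ < 1) {f : MeromorphicField}
    (hf : f ⊗ₜ[ℂ] basisVector l 0 ≠ 0)
    (hQ : evalDynRep q hq0 hq1 l v (EllipticAlg.expQ q 1) (f ⊗ₜ[ℂ] basisVector l 0) =
      f ⊗ₜ[ℂ] basisVector l 0) :
    IsTopVector l v (evalDynRep q hq0 hq1 l v) (f ⊗ₜ[ℂ] basisVector l 0) where
  ne_zero := hf
  expQ := hQ
  h := by
    rw [evalDynRep_of, evGen, diagonal_mulVec_basisVector, ← TensorProduct.tmul_smul]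
    simp [wt_zero]
  k := by
    rw [evalDynRep_of, evGen, diagonal_mulVec_basisVector, ← TensorProduct.tmul_smul]
    simp [wt_zero]
  a n := by
    rw [evalDynRep_of, evGen, diagonal_mulVec_basisVector, ← TensorProduct.tmul_smul]
    rfl

theorem exists_eq_sum_tmul_single {N : Type*} [AddCommGroup N] [Module ℂ N] {n : ℕ}
    (x : N ⊗[ℂ] (Fin n → ℂ)) : ∃ F : Fin n → N, x = ∑ j, F j ⊗ₜ[ℂ] (Pi.single j 1 : Fin n → ℂ) := by
  let e := TensorProduct.piScalarRight ℂ ℂ N (Fin n)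
  refine ⟨e x, e.injective ?_⟩
  rw [map_sum]
  ext i
  rw [Finset.sum_apply, Finset.sum_eq_single i]
  · simp [e]
  · intro j _ hj
    simp [e, Pi.single_eq_of_ne hj.symm]
  · simp

/-- Reads off the `i`-th coordinate under the identification of the tensor product with `N^n`. -/
theorem sum_smul_eq_zero_of_sum_tmul {N : Type*} [AddCommGroup N] [Module ℂ N] {n : ℕ}
    {G : Matrix (Fin n) (Fin n) ℂ} {F : Fin n → N}
    (h : ∑ j, F j ⊗ₜ[ℂ] G.mulVec (Pi.single j 1) = 0) (i : Fin n) : ∑ j, G i j • F j = 0 := by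
  have h' := congrFun (congrArg (TensorProduct.piScalarRight ℂ ℂ N (Fin n)) h) i
  rw [map_sum, Finset.sum_apply] at h'
  simpa using h'

/-- The operator `x^+_0` sends `v_m` to a non-zero multiple of `v_{m-1}` for `m ≥ 1`, so its kernel
consists of the `f ⊗ v_0`. The loop generators act only on `v_0`, which makes the eigenvalues
independent of `f`; invariance under `e^Q` is part of the hypothesis. -/
theorem isTopVector_of_isPseudoHighestWeightVector (hq0 : q ≠ 0) (hq1 : ‖q‖ < 1)
    {Ω : MeromorphicField ⊗[ℂ] (Fin (l + 1) → ℂ)}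
    (hΩ : IsPseudoHighestWeightVector (evalDynRep q hq0 hq1 l v) Ω) :
    IsTopVector l v (evalDynRep q hq0 hq1 l v) Ω := by
  obtain ⟨F, rfl⟩ := exists_eq_sum_tmul_single Ω
  have hzero : ∀ j : Fin (l + 1), j ≠ 0 → F j = 0 := by
    intro j hj
    have h := hΩ.xp 0
    rw [map_sum] at h
    have hj' : (j : ℕ) ≠ 0 := fun h => hj (Fin.ext h)
    -- The row `j - 1` of `x^+_0` has its only non-zero entry in column `j`, so this coordinate
    -- isolates `F j`.
    have h' := sum_smul_eq_zero_of_sum_tmul (G := evGen q (q ^ (2 * v)) l (.xp 0)) (F := F)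
      (Eq.trans (Finset.sum_congr rfl fun j _ => (evalDynRep_of hq0 hq1 _ _ _).symm) h)
      ⟨j - 1, by omega⟩
    rw [Finset.sum_eq_single j, evGen_xp_apply, if_pos (show (j : ℕ) - 1 + 1 = j by omega)] at h'
    · exact (smul_eq_zero.1 h').resolve_left (evXp_ne_zero hq0 hq1 (by omega))
    · intro k _ hk
      rw [evGen_xp_apply, if_neg (fun h => hk (Fin.ext (by simp at h; omega))), zero_smul]
    · simp
  have hΩ0 : ∑ j, F j ⊗ₜ[ℂ] (Pi.single j 1 : Fin (l + 1) → ℂ) = F 0 ⊗ₜ[ℂ] basisVector l 0 := by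
    rw [Finset.sum_eq_single 0]
    · rfl
    · intro j _ hj
      rw [hzero j hj, TensorProduct.zero_tmul]
    · simp
  have h1 := hΩ.ne_zero
  have h2 := hΩ.expQ
  rw [hΩ0] at h1 h2 ⊢
  exact isTopVector_tmul hq0 hq1 h1 h2

/-- Repeated application of `x^-_0`, divided by its non-zero coefficient, reaches every basis vector
from `v_0`; with multiplication by functions of `P` this gives cyclicity. -/
theorem exists_evalDynRep_eq (hq0 : q ≠ 0) (hq1 : ‖q‖ < 1) (m : ℕ) (hm : m < l + 1) :
    ∃ y : EllipticAlg q, evalDynRep q hq0 hq1 l v y (1 ⊗ₜ[ℂ] basisVector l 0) =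
      1 ⊗ₜ[ℂ] basisVector l ⟨m, hm⟩ := by
  induction m with
  | zero => exact ⟨1, by simp⟩
  | succ m ih =>
    obtain ⟨y, hy⟩ := ih (by omega)
    refine ⟨(evXm q (q ^ (2 * v)) l 0 m)⁻¹ • (EllipticAlg.of q (.xm 0) * y), ?_⟩
    rw [map_smul, LinearMap.smul_apply, map_mul, Module.End.mul_apply, hy, evalDynRep_of,
      evGen_xm_mulVec, TensorProduct.tmul_smul, smul_smul,
      inv_mul_cancel₀ (evXm_ne_zero hq0 hq1 m), one_smul]

theorem isPseudoHighestWeightVector_one_tmul (hq0 : q ≠ 0) (hq1 : ‖q‖ < 1) :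
    IsPseudoHighestWeightVector (evalDynRep q hq0 hq1 l v)
      ((1 : MeromorphicField) ⊗ₜ[ℂ] basisVector l 0) where
  ne_zero h := by
    have := congrFun (congrArg (TensorProduct.piScalarRight ℂ ℂ MeromorphicField (Fin (l + 1))) h) 0
    simp [basisVector] at this
  expQ := by rw [evalDynRep, dynRep_expQ, map_one]
  xp n := by rw [evalDynRep_of, evGen_xp_mulVec_zero, TensorProduct.tmul_zero]
  weight := by
    have hw : q ^ (2 * v) ≠ 0 := cpow_ne_zero hq0 _
    have ha : ∀ n : ℤ, evalRep q hq0 hq1 _ hw l (LoopAlg.of q (.a n)) (basisVector l 0) =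
        evA q (q ^ (2 * v)) l n 0 • basisVector l 0 := fun n => by
      rw [evalRep_of, evGen, diagonal_mulVec_basisVector]; rfl
    have hk : evalRep q hq0 hq1 _ hw l (LoopAlg.of q .k) (basisVector l 0) =
        q ^ (l : ℤ) • basisVector l 0 := by
      rw [evalRep_of, evGen, diagonal_mulVec_basisVector, Fin.val_zero, wt_zero]
    have hkinv : evalRep q hq0 hq1 _ hw l (LoopAlg.of q .kinv) (basisVector l 0) =
        q ^ (-(l : ℤ)) • basisVector l 0 := by
      rw [evalRep_of, evGen, diagonal_mulVec_basisVector, Fin.val_zero, wt_zero]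
    refine ⟨fun n => PowerSeries.coeff n (expSeries (modeSeries (fun _ => q - q⁻¹)
        fun n => evA q (q ^ (2 * v)) l n 0)) * q ^ (l : ℤ),
      fun n => PowerSeries.coeff n (expSeries (modeSeries (fun _ => -(q - q⁻¹))
        fun n => evA q (q ^ (2 * v)) l (-n) 0)) * q ^ (-(l : ℤ)), ?_, fun n => ?_, fun n => ?_⟩
    · beta_reduce
      rw [coeff_zero_expSeries, coeff_zero_expSeries, one_mul, one_mul, ← zpow_add₀ hq0,
        add_neg_cancel, zpow_zero]
    · have h : ActsBy (evalRep q hq0 hq1 _ hw l) (basisVector l 0) _ _ :=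
        (actsBy_modeSeries (c := fun _ => q - q⁻¹) fun n : ℕ => ha n).expSeries
      rw [evalDynRep, dynRep_ofLoop, psiMode, if_pos (by omega), Int.toNat_natCast, map_mul,
        Module.End.mul_apply, h, map_smul, hk, smul_smul, TensorProduct.tmul_smul]
    · have h : ActsBy (evalRep q hq0 hq1 _ hw l) (basisVector l 0) _ _ :=
        (actsBy_modeSeries (c := fun _ => -(q - q⁻¹)) fun n : ℕ => ha (-n)).expSeries
      rw [evalDynRep, dynRep_ofLoop, phiMode, if_pos (by omega), neg_neg, Int.toNat_natCast,
        map_mul, Module.End.mul_apply, h, map_smul, hkinv, smul_smul, TensorProduct.tmul_smul]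
  cyclic x := by
    induction x using TensorProduct.induction_on with
    | zero => exact ⟨0, by simp⟩
    | add a b ha hb =>
      obtain ⟨y, rfl⟩ := ha
      obtain ⟨z, rfl⟩ := hb
      exact ⟨y + z, by rw [map_add, LinearMap.add_apply]⟩
    | tmul f x =>
      choose y hy using fun m : Fin (l + 1) => exists_evalDynRep_eq (v := v) hq0 hq1 m m.2
      refine ⟨EllipticAlg.ofMeromorphic q f * ∑ m, x m • y m, ?_⟩
      have hx : x = ∑ m, x m • basisVector l m := by
        ext i
        simp [basisVector, Finset.sum_apply, Pi.single_apply]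
      rw [map_mul, Module.End.mul_apply, map_sum, LinearMap.sum_apply]
      simp only [map_smul, LinearMap.smul_apply, hy, ← TensorProduct.tmul_smul]
      rw [← TensorProduct.tmul_sum, ← hx, evalDynRep, dynRep_ofMeromorphic, mul_one]

theorem isEllipticDrinfeldPolynomial_thetaString (hq0 : q ≠ 0) (hq1 : ‖q‖ < 1) {r : ℂ}
    (hp : ‖q ^ (2 * r)‖ < 1) :
    IsEllipticDrinfeldPolynomial r (evalDynRep q hq0 hq1 l v) (q ^ (l * (2 * v - 1) / r))
      (thetaString q r l v) where
  entire := differentiable_thetaString hq0 hp l v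
  quasiPeriodic := ⟨l, stringZero l v, analyticOrderAt_thetaString hq0 hq1 hp l v,
    thetaString_add_self hq0 hp l v, thetaString_add_tau hq0 hq1 hp l v,
    constant_thetaString hq0 l v⟩
  action := by
    have hΩ := isPseudoHighestWeightVector_one_tmul (l := l) (v := v) hq0 hq1
    refine ⟨_, hΩ, fun σ hσ => ?_⟩
    have htop := isTopVector_of_isPseudoHighestWeightVector hq0 hq1 hΩ
    exact htop.exists_thetaString hq0 hq1 hp hσ

end EvaluationRepresentation

/-! ### Divisors, doubly periodic and quasi-periodic entire functions. -/

section EntireFunctions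

open Filter Topology

theorem eq_zero_of_mul_eq_zero {f g : ℂ → ℂ} (hf : Differentiable ℂ f) (hg : Differentiable ℂ g)
    {x : ℂ} (hx : g x ≠ 0) (h : ∀ u, f u * g u = 0) (u : ℂ) : f u = 0 :=
  (AnalyticOnNhd.eq_zero_or_eq_zero_of_mul_eq_zero (fun x _ => hf.analyticAt x)
    (fun x _ => hg.analyticAt x) (fun z _ => h z) isPreconnected_univ).elim
    (fun h => h u trivial) fun h => absurd (h x trivial) hx

theorem exists_ne_zero_of_analyticOrderAt_ne_top {f : ℂ → ℂ} {x : ℂ}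
    (h : analyticOrderAt f x ≠ ⊤) : ∃ u, f u ≠ 0 := by
  by_contra! h0
  exact h (analyticOrderAt_eq_top.2 (Eventually.of_forall h0))

/-- The meromorphic function `f / g` has order zero everywhere. Its normal form replaces the junk
values at the zeros of `g` and is therefore analytic and nowhere zero. -/
theorem exists_entire_quotient {f g : ℂ → ℂ} (hf : Differentiable ℂ f) (hg : Differentiable ℂ g)
    (ho : ∀ u, analyticOrderAt f u = analyticOrderAt g u) (ht : ∀ u, analyticOrderAt g u ≠ ⊤) :
    ∃ G : ℂ → ℂ, Differentiable ℂ G ∧ (∀ u, G u ≠ 0) ∧ ∀ u, f u = G u * g u := by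
  have hm : MeromorphicOn (f / g) Set.univ := fun u _ =>
    (hf.analyticAt u).meromorphicAt.div (hg.analyticAt u).meromorphicAt
  set G := toMeromorphicNFOn (f / g) Set.univ with hG
  have hN : ∀ u, MeromorphicNFAt G u := fun u =>
    meromorphicNFOn_toMeromorphicNFOn (f / g) Set.univ (Set.mem_univ u)
  have hord : ∀ u, meromorphicOrderAt G u = 0 := fun u => by
    rw [hG, meromorphicOrderAt_toMeromorphicNFOn hm (Set.mem_univ u),
      meromorphicOrderAt_div (hf.analyticAt u).meromorphicAt (hg.analyticAt u).meromorphicAt,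
      (hf.analyticAt u).meromorphicOrderAt_eq, (hg.analyticAt u).meromorphicOrderAt_eq, ho u]
    obtain ⟨n, hn⟩ := ENat.ne_top_iff_exists.1 (ht u)
    rw [← hn]
    exact LinearOrderedAddCommGroupWithTop.sub_self_eq_zero_of_ne_top (by simp)
  have hA : ∀ u, AnalyticAt ℂ G u := fun u =>
    (hN u).meromorphicOrderAt_nonneg_iff_analyticAt.1 (hord u).ge
  refine ⟨G, fun u => (hA u).differentiableAt,
    fun u => (hN u).meromorphicOrderAt_eq_zero_iff.1 (hord u), fun u => ?_⟩
  -- The zeros of `g` are isolated, so `f = G g` holds on a punctured neighbourhood of `u`;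
  -- continuity then gives it at `u`.
  have h1 : ∀ᶠ z in 𝓝[≠] u, g z ≠ 0 :=
    (hg.analyticAt u).eventually_eq_zero_or_eventually_ne_zero.resolve_left fun h =>
      ht u (analyticOrderAt_eq_top.2 h)
  have h2 : f =ᶠ[𝓝[≠] u] fun z => G z * g z := by
    filter_upwards [h1, hm.toMeromorphicNFOn_eq_self_on_nhdsNE (Set.mem_univ u)] with z hz hz'
    rw [← hG] at hz'
    rw [hz', Pi.div_apply, div_mul_cancel₀ _ hz]
  exact tendsto_nhds_unique_of_eventuallyEq
    (hf.continuous.continuousAt.tendsto.mono_left nhdsWithin_le_nhds)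
    (((hA u).continuousAt.mul hg.continuous.continuousAt).tendsto.mono_left nhdsWithin_le_nhds) h2

/-- Liouville's theorem for doubly periodic entire functions. -/
theorem apply_eq_of_doublyPeriodic {f : ℂ → ℂ} (hf : Differentiable ℂ f) {a b : ℂ}
    (ha0 : a ≠ 0) (hab : (b / a).im ≠ 0) (ha : Function.Periodic f a) (hb : Function.Periodic f b)
    (x y : ℂ) : f x = f y := by
  refine hf.apply_eq_apply_of_bounded ?_ x y
  let K : Set ℂ := (fun s : ℝ × ℝ => (s.1 : ℂ) * a + s.2 * b) '' (Set.Icc 0 1 ×ˢ Set.Icc 0 1)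
  have hK : IsCompact K := (isCompact_Icc.prod isCompact_Icc).image (by fun_prop)
  refine (hK.image hf.continuous).isBounded.subset ?_
  rintro _ ⟨u, rfl⟩
  -- Real coordinates of `u` in the basis `a, b`; their fractional parts move `u` into the compact
  -- period parallelogram, where `f` is bounded.
  set t : ℝ := (u / a).im / (b / a).im
  set s : ℝ := (u / a).re - t * (b / a).re
  have hu : u = s * a + t * b := by
    have h : u / a = s + t * (b / a) := by
      apply Complex.ext
      · simp [s]
      · simp [t, div_mul_cancel₀ _ hab]
    field_simp at h
    rw [h]; ring
  refine ⟨Int.fract s * a + Int.fract t * b, ⟨(Int.fract s, Int.fract t),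
    ⟨⟨Int.fract_nonneg _, (Int.fract_lt_one _).le⟩, ⟨Int.fract_nonneg _, (Int.fract_lt_one _).le⟩⟩,
    rfl⟩, ?_⟩
  rw [← (ha.int_mul ⌊s⌋) _, ← (hb.int_mul ⌊t⌋) _]
  congr 1
  rw [hu]
  simp only [Int.fract, Complex.ofReal_sub, Complex.ofReal_intCast]
  ring

/-- The logarithmic derivative of the multiplier `κ e^(bu)` is `b`. -/
theorem logDeriv_add_of_quasiPeriodic {G : ℂ → ℂ} (hG : Differentiable ℂ G) (h0 : ∀ u, G u ≠ 0)
    {a κ b : ℂ} (hκ : κ ≠ 0) (h : ∀ u, G (u + a) = κ * Complex.exp (b * u) * G u) (u : ℂ) :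
    deriv G (u + a) / G (u + a) = deriv G u / G u + b := by
  have h1 : HasDerivAt (fun u => G (u + a)) (deriv G (u + a)) u :=
    HasDerivAt.comp_add_const u a (hG (u + a)).hasDerivAt
  have h2 : HasDerivAt (fun u => κ * Complex.exp (b * u) * G u)
      (κ * (Complex.exp (b * u) * b) * G u + κ * Complex.exp (b * u) * deriv G u) u := by
    have hid : HasDerivAt (fun u : ℂ => b * u) b u := by
      simpa using (hasDerivAt_id u).const_mul b
    exact (hid.cexp.const_mul κ).mul (hG u).hasDerivAt
  rw [funext h] at h1
  rw [h1.unique h2, h u]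
  have := h0 u
  have := Complex.exp_ne_zero (b * u)
  field_simp
  ring

/-- A nowhere vanishing entire function with period `1` and the multipliers of a quotient of theta
functions is constant, if `1`, `r` and `2 π i / log q` are independent. -/
theorem eq_of_quasiPeriodic {G : ℂ → ℂ} (hG : Differentiable ℂ G) (h0 : ∀ u, G u ≠ 0)
    {r ρ ε κ b : ℂ} (hr : r ≠ 0) (hρ : (ρ / r).im ≠ 0) (hε : ε ^ 2 = 1) (hκ : κ ≠ 0)
    (h1 : ∀ u, G (u + 1) = G u) (h2 : ∀ u, G (u + r) = ε * G u)
    (h3 : ∀ u, G (u + ρ) = κ * Complex.exp (b * u) * G u)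
    (hgen : ∀ m n : ℤ, 2 * n * r = m → n = 0) (u : ℂ) : G u = G 0 := by
  set L : ℂ → ℂ := fun u => deriv G u / G u with hL
  have hGd : Differentiable ℂ (deriv G) := fun u => (hG.analyticAt u).deriv.differentiableAt
  have hLd : Differentiable ℂ L := fun u => (hGd u).div (hG u) (h0 u)
  have hLd' : Differentiable ℂ (deriv L) := fun u => (hLd.analyticAt u).deriv.differentiableAt
  have hε0 : ε ≠ 0 := by rintro rfl; simp at hε
  have l1 : ∀ u, L (u + 1) = L u := fun u => by
    simpa using logDeriv_add_of_quasiPeriodic hG h0 (b := 0) one_ne_zero (by simpa using h1) u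
  have l2 : ∀ u, L (u + r) = L u := fun u => by
    simpa using logDeriv_add_of_quasiPeriodic hG h0 (b := 0) hε0 (by simpa using h2) u
  have l3 : ∀ u, L (u + ρ) = L u + b := logDeriv_add_of_quasiPeriodic hG h0 hκ h3
  have p2 : Function.Periodic (deriv L) r := fun u => by
    rw [← deriv_comp_add_const, funext l2]
  have p3 : Function.Periodic (deriv L) ρ := fun u => by
    rw [← deriv_comp_add_const, funext l3, deriv_add_const]
  have hconst := fun x => apply_eq_of_doublyPeriodic hLd' hr hρ p2 p3 x 0
  set μ := deriv L 0
  have hlin : ∀ u, L u - μ * u = L 0 := by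
    intro u
    have hd : ∀ u, HasDerivAt (fun u => L u - μ * u) (deriv L u - μ) u := fun u => by
      have hid : HasDerivAt (fun u : ℂ => μ * u) μ u := by
        simpa using (hasDerivAt_id u).const_mul μ
      exact (hLd u).hasDerivAt.sub hid
    have := is_const_of_deriv_eq_zero (fun u => (hd u).differentiableAt)
      (fun u => by rw [(hd u).deriv, hconst u, sub_self]) u 0
    simpa using this
  -- A linear function `μ u + L(0)` with period `1` is constant.
  have hμ : μ = 0 := by
    have e1 := hlin 1
    have e2 := l1 0
    rw [zero_add] at e2
    linear_combination e2 - e1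
  set lam := L 0
  have hlam : ∀ u, L u = lam := fun u => by
    have := hlin u
    rw [hμ] at this
    linear_combination this
  have hexp : ∀ u, G u = G 0 * Complex.exp (lam * u) := by
    intro u
    have hd : ∀ u, HasDerivAt (fun u => G u * Complex.exp (-lam * u)) 0 u := fun u => by
      have hid : HasDerivAt (fun u : ℂ => -lam * u) (-lam) u := by
        simpa using (hasDerivAt_id u).const_mul (-lam)
      refine ((hG u).hasDerivAt.mul hid.cexp).congr_deriv ?_
      have h' : deriv G u = lam * G u := by rw [← hlam u, div_mul_cancel₀ _ (h0 u)]
      rw [h']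
      ring
    have := is_const_of_deriv_eq_zero (fun u => (hd u).differentiableAt) (fun u => (hd u).deriv) u 0
    simp only [mul_zero, Complex.exp_zero, mul_one, neg_mul, Complex.exp_neg] at this
    rw [← this, mul_assoc, inv_mul_cancel₀ (Complex.exp_ne_zero _), mul_one]
  have x1 : Complex.exp lam = 1 := by
    have := h1 0
    rw [zero_add, hexp 1, mul_one] at this
    exact mul_left_cancel₀ (h0 0) (by rw [this, mul_one])
  -- Doubling removes the sign `ε`. Together with `e^λ = 1` this gives `λ = 2πi n` and `2 n r ∈ ℤ`,
  -- which genericity allows only for `n = 0`.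
  have x2 : Complex.exp (2 * (lam * r)) = 1 := by
    have := h2 0
    rw [zero_add, hexp r, mul_comm] at this
    have : Complex.exp (lam * r) = ε := mul_right_cancel₀ (h0 0) this
    rw [two_mul, Complex.exp_add, this, ← sq, hε]
  obtain ⟨n, hn⟩ := Complex.exp_eq_one_iff.1 x1
  obtain ⟨m, hm⟩ := Complex.exp_eq_one_iff.1 x2
  have hn0 : n = 0 := hgen m n (by
    refine mul_right_cancel₀ Complex.two_pi_I_ne_zero ?_
    rw [hn] at hm
    linear_combination hm)
  rw [hexp u, hn, hn0]
  simp

end EntireFunctions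

/-! ### Uniqueness: genericity, comparison of divisors, rigidity of the quotient. -/

section Uniqueness

variable {q r : ℂ}

theorem two_mul_eq_int_of_generic (hq0 : q ≠ 0)
    (hgen : ∀ m n : ℤ, q ^ m * (q ^ (2 * r)) ^ n = 1 → m = 0 ∧ n = 0) (m n : ℤ)
    (h : 2 * n * r = m) : n = 0 := by
  refine (hgen (-m) n ?_).2
  rw [← Complex.cpow_int_mul, ← Complex.cpow_intCast, ← Complex.cpow_add _ _ hq0]
  push_cast
  rw [show -(m : ℂ) + n * (2 * r) = 0 by rw [← h]; ring, Complex.cpow_zero]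

/-- If `k = m r + n rτ`, then `q^(2k) p^(-m) = exp(2 n rτ log q) = exp(-2πi n) = 1`, a
multiplicative relation between `q` and `p`. So `1` has infinite order modulo the period lattice. -/
theorem eq_zero_of_isPeriod (hq0 : q ≠ 0) (hq1 : ‖q‖ < 1) (hr : r ≠ 0)
    (hgen : ∀ m n : ℤ, q ^ m * (q ^ (2 * r)) ^ n = 1 → m = 0 ∧ n = 0) {k : ℤ}
    (h : IsPeriod q r k) : k = 0 := by
  obtain ⟨m, n, hmn⟩ := h
  have h1 := (hgen (2 * k) (-m) ?_).1
  · omega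
  rw [← Complex.cpow_int_mul, ← Complex.cpow_intCast, ← Complex.cpow_add _ _ hq0,
    Complex.cpow_def_of_ne_zero hq0, Complex.exp_eq_one_iff]
  refine ⟨-n, ?_⟩
  push_cast
  rw [hmn]
  linear_combination 2 * n * log_mul_tau hq0 hq1 hr

/-- The real part of `rτ log q = -πi` is zero. Were `τ` real, that real part would be `τ/2` times
`Re (2r log q)`, which is negative by `|p| < 1`; then `τ = 0`, a contradiction. -/
theorem im_tau_ne_zero (hq0 : q ≠ 0) (hq1 : ‖q‖ < 1) (hp : ‖q ^ (2 * r)‖ < 1) :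
    (tau q r).im ≠ 0 := by
  intro h
  have hr := ne_zero_of_norm_cpow_lt_one hp
  have hl := log_ne_zero hq0 hq1
  have ht : (tau q r : ℂ) = ((tau q r).re : ℂ) := by
    apply Complex.ext <;> simp [h]
  have h1 := log_mul_tau hq0 hq1 hr
  rw [ht] at h1
  have h2 := congrArg Complex.re h1
  have h3 : (Complex.log q * (2 * r)).re < 0 := by
    rw [Complex.cpow_def_of_ne_zero hq0, Complex.norm_exp] at hp
    exact Real.exp_lt_one_iff.1 hp
  rw [show Complex.log q * (r * ((tau q r).re : ℂ)) =
    (((tau q r).re / 2 : ℝ) : ℂ) * (Complex.log q * (2 * r)) by push_cast; ring,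
    Complex.re_ofReal_mul] at h2
  simp only [Complex.neg_re, Complex.mul_re, Complex.ofReal_re, Complex.I_re, mul_zero,
    Complex.ofReal_im, Complex.I_im, mul_one, sub_self, neg_zero] at h2
  have h4 : (tau q r).re = 0 := by
    rcases mul_eq_zero.1 h2 with h | h
    · linarith
    · exact absurd h h3.ne
  rw [h4] at h1
  simp at h1

/-- The divisors of two functions with finitely many zeros modulo the period lattice agree, if their
difference is invariant under `u ↦ u + 1`. -/
theorem ncard_eq_of_shift (hq0 : q ≠ 0) (hq1 : ‖q‖ < 1) (hr : r ≠ 0)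
    (hgen : ∀ m n : ℤ, q ^ m * (q ^ (2 * r)) ^ n = 1 → m = 0 ∧ n = 0) {d e : ℕ}
    (α : Fin d → ℂ) (β : Fin e → ℂ)
    (h : ∀ u : ℂ, Set.ncard {j | IsPeriod q r (u - α j)} +
        Set.ncard {j | IsPeriod q r (u + 1 - β j)} =
      Set.ncard {j | IsPeriod q r (u + 1 - α j)} + Set.ncard {j | IsPeriod q r (u - β j)}) (u : ℂ) :
    Set.ncard {j | IsPeriod q r (u - α j)} = Set.ncard {j | IsPeriod q r (u - β j)} := by
  by_contra hne
  -- A disagreement at `u` propagates to every `u + n`, so each of these points is congruent to some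
  -- `α j` or `β j`. By pigeonhole two of them are congruent to the same one, and their difference
  -- is a non-zero integer period.
  have hall : ∀ n : ℕ, Set.ncard {j | IsPeriod q r (u + n - α j)} ≠
      Set.ncard {j | IsPeriod q r (u + n - β j)} := by
    intro n
    induction n with
    | zero => simpa using hne
    | succ n ih =>
      have := h (u + n)
      push_cast
      rw [← add_assoc]
      omega
  have hex : ∀ n : ℕ, ∃ j : Fin d ⊕ Fin e, IsPeriod q r (u + n - Sum.elim α β j) := by
    intro n
    by_contra! hno
    refine hall n ?_
    rw [show {j | IsPeriod q r (u + n - α j)} = ∅ from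
        Set.eq_empty_of_forall_notMem fun j hj => hno (Sum.inl j) hj,
      show {j | IsPeriod q r (u + n - β j)} = ∅ from
        Set.eq_empty_of_forall_notMem fun j hj => hno (Sum.inr j) hj]
    simp
  choose g hg using hex
  obtain ⟨m, n, hmn, heq⟩ := Finite.exists_ne_map_eq_of_infinite g
  have h1 := hg m
  have h2 := hg n
  rw [heq] at h1
  obtain ⟨a, b, hab⟩ := h1
  obtain ⟨a', b', hab'⟩ := h2
  have := eq_zero_of_isPeriod hq0 hq1 hr hgen (k := (m : ℤ) - n) ⟨a - a', b - b', by
    push_cast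
    linear_combination hab - hab'⟩
  omega

/-- Separates the part linear in `u`, so that the multiplier has the shape `κ e^(bu)`. -/
theorem sum_exponent {d : ℕ} (α : Fin d → ℂ) (r t u : ℂ) :
    ∑ j, (2 * (u - α j) / r + t) = ∑ j, (2 * (0 - α j) / r + t) + d * (2 / r) * u := by
  have h : ∀ j, 2 * (u - α j) / r + t = 2 * (0 - α j) / r + t + 2 / r * u := fun j => by ring
  rw [Finset.sum_congr rfl fun j _ => h j, Finset.sum_add_distrib, Finset.sum_const,
    Finset.card_univ, Fintype.card_fin, nsmul_eq_mul]
  ring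

theorem exists_cpow_norm_between (hq0 : q ≠ 0) (hq1 : ‖q‖ < 1) {s t : ℝ} (hs : 0 ≤ s)
    (hst : s < t) : ∃ u : ℂ, s < ‖q ^ (2 * u)‖ ∧ ‖q ^ (2 * u)‖ < t := by
  obtain ⟨x, hsx, hxt⟩ := exists_between hst
  have hx : 0 < x := hs.trans_lt hsx
  have hl := log_ne_zero hq0 hq1
  have e : q ^ (2 * ((Real.log x : ℂ) / (2 * Complex.log q))) = x := by
    rw [Complex.cpow_def_of_ne_zero hq0,
      show Complex.log q * (2 * ((Real.log x : ℂ) / (2 * Complex.log q))) = Real.log x by field_simp,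
      ← Complex.ofReal_exp, Real.exp_log hx]
  exact ⟨_, by rw [e, Complex.norm_real, Real.norm_of_nonneg hx.le]; exact ⟨hsx, hxt⟩⟩

/-- Both functions have the eigenvalue of the same current as quotient `c P(u+1)/P(u)`. Even though
their pseudo-highest weight vectors may differ, the eigenvalue is the same, and a single sign `σ =
r/2` is enough for the conclusion. -/
theorem mul_comp_add_one_eq (hq0 : q ≠ 0) (hq1 : ‖q‖ < 1) (hp : ‖q ^ (2 * r)‖ < 1) {l : ℕ} {v : ℂ}
    {f : ℂ → ℂ} (hf : IsEllipticDrinfeldPolynomial r (evalDynRep q hq0 hq1 l v)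
      (q ^ (l * (2 * v - 1) / r)) f) (u : ℂ) :
    f u * thetaString q r l v (u + 1) = f (u + 1) * thetaString q r l v u := by
  obtain ⟨Ω, hΩ, hact⟩ := hf.action
  have htop := isTopVector_of_isPseudoHighestWeightVector hq0 hq1 hΩ
  obtain ⟨s, t, η, hs, hst, hη, hfη⟩ := hact (r / 2) (Or.inl rfl)
  have hfd := hf.entire
  have hPd := differentiable_thetaString (r := r) hq0 hp l v
  have hθ := differentiable_theta (r := r) hq0 hp
  let F : ℂ → ℂ := fun u =>
    f u * thetaString q r l v (u + 1) - f (u + 1) * thetaString q r l v u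
  -- The denominator of the eigenvalue. Keeping it as a factor makes `F * T` entire; it vanishes on
  -- an open set, hence everywhere, and the non-zero `T` is then cancelled.
  let T : ℂ → ℂ := fun u => theta q r (u - v - (l - 1) / 2)
  have hF : Differentiable ℂ F := by fun_prop
  have hT : Differentiable ℂ T := hθ.comp (by fun_prop)
  obtain ⟨u₀, h1, h2⟩ := exists_cpow_norm_between hq0 hq1 hs hst
  have hcont : Continuous fun u : ℂ => ‖q ^ (2 * u)‖ :=
    (differentiable_cpow_comp hq0 (g := fun u => 2 * u) (by fun_prop)).continuous.norm
  have hev : (fun u => F u * T u) =ᶠ[nhds u₀] fun _ => 0 := by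
    filter_upwards [hcont.continuousAt.eventually_const_lt h1,
      hcont.continuousAt.eventually_lt_const h2] with u hsu hut
    have e1 := htop.eigenvalue_mul_theta hq0 hq1 hp (Or.inl rfl) hη hsu hut
    have e2 := hfη u hsu hut
    have e3 := thetaString_mul_theta (q := q) (r := r) l v u
    have hc := cpow_ne_zero hq0 (l * (2 * v - 1) / r)
    refine mul_left_cancel₀ hc ?_
    simp only [F, T]
    linear_combination q ^ (l * (2 * v - 1) / r) * f u * e3 - thetaString q r l v u * f u * e1 +
      thetaString q r l v u * theta q r (u - v - (l - 1) / 2) * e2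
  have hall := AnalyticOnNhd.eq_of_eventuallyEq (fun x _ => (hF.mul hT).analyticAt x)
    (fun x _ => analyticAt_const) hev
  obtain ⟨x, hx⟩ : ∃ x, T x ≠ 0 := by
    refine exists_ne_zero_of_analyticOrderAt_ne_top (x := v + (l - 1) / 2) ?_
    have e : T = fun u => theta q r (u + -(v + (l - 1) / 2)) := by
      funext u
      simp only [T]
      congr 1
      ring
    rw [e, analyticOrderAt_comp_add (theta q r), add_neg_cancel,
      analyticOrderAt_theta_zero hq0 hq1 hp]
    exact ENat.one_ne_top
  exact sub_eq_zero.1 (eq_zero_of_mul_eq_zero hF hT hx (fun u => congrFun hall u) u)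

theorem eq_const_mul_thetaString (hq0 : q ≠ 0) (hq1 : ‖q‖ < 1) (hp : ‖q ^ (2 * r)‖ < 1)
    (hgen : ∀ m n : ℤ, q ^ m * (q ^ (2 * r)) ^ n = 1 → m = 0 ∧ n = 0) {l : ℕ} {v : ℂ}
    {f : ℂ → ℂ} (hf : IsEllipticDrinfeldPolynomial r (evalDynRep q hq0 hq1 l v)
      (q ^ (l * (2 * v - 1) / r)) f) :
    ∃ C : ℂ, C ≠ 0 ∧ ∀ u, f u = C * thetaString q r l v u := by
  have hr := ne_zero_of_norm_cpow_lt_one hp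
  have hfd := hf.entire
  have hPd := differentiable_thetaString (r := r) hq0 hp l v
  have hshift := mul_comp_add_one_eq hq0 hq1 hp hf
  have hPo := analyticOrderAt_thetaString hq0 hq1 hp l v
  obtain ⟨d, α, hfo, hfr, hft, -⟩ := hf.quasiPeriodic
  change ∀ u : ℂ, analyticOrderAt f u =
    ((Set.ncard {j : Fin d | IsPeriod q r (u - α j)} : ℕ) : ℕ∞) at hfo
  -- Comparison of orders on both sides of `f(u) P(u+1) = f(u+1) P(u)`. All orders are finite
  -- counts, so the identity descends to natural numbers.
  have hcard := ncard_eq_of_shift hq0 hq1 hr hgen α (stringZero l v) (fun u => by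
    have h := congrArg (fun F : ℂ → ℂ => analyticOrderAt F u) (funext hshift)
    change analyticOrderAt (f * fun x => thetaString q r l v (x + 1)) u =
      analyticOrderAt ((fun x => f (x + 1)) * thetaString q r l v) u at h
    have d1 : Differentiable ℂ fun x => thetaString q r l v (x + 1) := by fun_prop
    have d2 : Differentiable ℂ fun x => f (x + 1) := by fun_prop
    rw [analyticOrderAt_mul (hfd.analyticAt u) (d1.analyticAt u),
      analyticOrderAt_mul (d2.analyticAt u) (hPd.analyticAt u), analyticOrderAt_comp_add f,
      analyticOrderAt_comp_add (thetaString q r l v), hfo, hfo, hPo, hPo] at h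
    exact_mod_cast h)
  have htop : ∀ u, analyticOrderAt (thetaString q r l v) u ≠ ⊤ := fun u => by
    rw [hPo]; exact ENat.natCast_ne_top _
  obtain ⟨x₀, hx₀⟩ := exists_ne_zero_of_analyticOrderAt_ne_top (htop 0)
  obtain ⟨G, hG, hG0, hfG⟩ := exists_entire_quotient hfd hPd
    (fun u => by rw [hfo, hPo, hcard]) htop
  -- Entire functions have no zero divisors, so the string may be cancelled although it has zeros.
  have hcancel : ∀ {A B : ℂ → ℂ}, Differentiable ℂ A → Differentiable ℂ B →
      (∀ u, A u * thetaString q r l v u = B u * thetaString q r l v u) → ∀ u, A u = B u :=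
    fun hA hB h u => sub_eq_zero.1
      (eq_zero_of_mul_eq_zero (hA.sub hB) hPd hx₀ (fun u => by
        rw [Pi.sub_apply, sub_mul, h u, sub_self]) u)
  have g1 : ∀ u, G (u + 1) = G u := by
    refine hcancel (by fun_prop) hG fun u => ?_
    -- The relation still contains the shifted string `P(u+1)`, which is non-zero at `x₀ - 1`; it is
    -- cancelled first.
    refine sub_eq_zero.1 (eq_zero_of_mul_eq_zero (x := x₀ - 1)
      (f := fun u => G (u + 1) * thetaString q r l v u - G u * thetaString q r l v u)
      (g := fun u => thetaString q r l v (u + 1)) (by fun_prop) (by fun_prop)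
      (by simpa using hx₀) (fun u => ?_) u)
    have h := hshift u
    rw [hfG, hfG] at h
    linear_combination -h
  have hsq : ∀ n : ℕ, ((-1 : ℂ) ^ n) * (-1) ^ n = 1 := fun n => by
    rw [← mul_pow]; simp
  have g2 : ∀ u, G (u + r) = (-1) ^ (d + l) * G u := by
    refine hcancel (by fun_prop) (by fun_prop) fun u => ?_
    have h := hfr u
    rw [hfG, hfG, thetaString_add_self hq0 hp] at h
    rw [pow_add]
    linear_combination (-1) ^ l * h - G (u + r) * thetaString q r l v u * hsq l
  let ef : ℂ := -(Real.pi * Complex.I) * ∑ j, (2 * (0 - α j) / r + tau q r)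
  let eP : ℂ := -(Real.pi * Complex.I) * ∑ j, (2 * (0 - stringZero l v j) / r + tau q r)
  -- The linear terms in the two multipliers have slopes proportional to `d` and `l`. It is not
  -- necessary to know `d = l` here: a non-zero `b` disappears in the derivative of the logarithmic
  -- derivative.
  let b : ℂ := -(Real.pi * Complex.I) * ((d - l) * (2 / r))
  have g3 : ∀ u, G (u + r * tau q r) =
      ((-1) ^ (d + l) * Complex.exp (ef - eP)) * Complex.exp (b * u) * G u := by
    refine hcancel (by fun_prop) (by fun_prop) fun u => ?_
    have h := hft u
    rw [hfG, hfG, thetaString_add_tau hq0 hq1 hp, sum_exponent α, sum_exponent (stringZero l v)] at h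
    have x1 : Complex.exp (-(Real.pi * Complex.I) *
        (∑ j, (2 * (0 - α j) / r + tau q r) + d * (2 / r) * u)) =
        Complex.exp (ef - eP) * Complex.exp (b * u) * Complex.exp (-(Real.pi * Complex.I) *
        (∑ j, (2 * (0 - stringZero l v j) / r + tau q r) + l * (2 / r) * u)) := by
      rw [← Complex.exp_add, ← Complex.exp_add]
      congr 1
      simp only [ef, eP, b]
      ring
    rw [x1] at h
    have hne := Complex.exp_ne_zero (-(Real.pi * Complex.I) *
        (∑ j, (2 * (0 - stringZero l v j) / r + tau q r) + l * (2 / r) * u))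
    refine mul_right_cancel₀ hne ?_
    rw [pow_add]
    linear_combination (-1) ^ l * h - G (u + r * tau q r) * thetaString q r l v u *
      Complex.exp (-(Real.pi * Complex.I) *
        (∑ j, (2 * (0 - stringZero l v j) / r + tau q r) + l * (2 / r) * u)) * hsq l
  have hconst := eq_of_quasiPeriodic hG hG0 hr
    (by rw [mul_div_cancel_left₀ _ hr]; exact im_tau_ne_zero hq0 hq1 hp)
    (by rw [sq]; exact hsq _)
    (mul_ne_zero (pow_ne_zero _ (by norm_num)) (Complex.exp_ne_zero _)) g1 g2 g3
    (two_mul_eq_int_of_generic hq0 hgen)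
  exact ⟨G 0, hG0 0, fun u => by rw [hfG u, hconst u]⟩

end Uniqueness

end

end EllipticSl2

/-- `q ^ (2 * r)` is the elliptic nome `p`; `r` is generic in the sense that `q` and `p` are
multiplicatively independent. -/
theorem corollary4p15 (q : ℂ) (hq0 : q ≠ 0) (hq1 : ‖q‖ < 1) (r : ℂ) (hp : ‖q ^ (2 * r)‖ < 1)
    (hgen : ∀ m n : ℤ, q ^ m * (q ^ (2 * r)) ^ n = 1 → m = 0 ∧ n = 0) (l : ℕ) (v : ℂ) :
    EllipticSl2.IsEllipticDrinfeldPolynomial r (EllipticSl2.evalDynRep q hq0 hq1 l v)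
        (q ^ (l * (2 * v - 1) / r))
        (fun u => ∏ j ∈ Finset.range l, EllipticSl2.theta q r (u - v - (l - 1) / 2 + j)) ∧
      ∀ f : ℂ → ℂ, EllipticSl2.IsEllipticDrinfeldPolynomial r
          (EllipticSl2.evalDynRep q hq0 hq1 l v) (q ^ (l * (2 * v - 1) / r)) f →
        ∃ C : ℂ, C ≠ 0 ∧ ∀ u : ℂ,
          f u = C * ∏ j ∈ Finset.range l, EllipticSl2.theta q r (u - v - (l - 1) / 2 + j) :=
  ⟨EllipticSl2.isEllipticDrinfeldPolynomial_thetaString hq0 hq1 hp,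
    fun _ hf => EllipticSl2.eq_const_mul_thetaString hq0 hq1 hp hgen hf⟩
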